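/- **Theorem.** Let $k$ be a field of characteristic $p>2$. A Lie superalgebra over $k$ is a $\mathbb Z/2\mathbb Z$-graded vector space $\mathfrak g=\mathfrak g_{\bar 0}\oplus\mathfrak g_{\bar 1}$ with an even bilinear bracket which is super-skew-symmetric and satisfies the super Jacobi identity, and also (which is automatic for $p\neq 3$) $[x,[x,x]]=0$ for odd $x$. Let $\mathfrak g$ be a Lie superalgebra over $k$ (of arbitrary dimension), let $\mathfrak h\subset\mathfrak g$ be a Lie subsuperalgebra such that $\mathfrak g/\mathfrak h$ is finite dimensional, let $m=\dim(\mathfrak g/\mathfrak h)_{\bar 1}$, and let $(\pi,V)$ be a representation of $\mathfrak h$ on a superspace $V$ of arbitrary dimension. Let $U(\mathfrak g)$ be the enveloping superalgebra of $\mathfrak g$, and let $u\mapsto\check u$ be its antipode, i.e. the linear map with $\check 1=1$, $\check x=-x$ for $x\in\mathfrak g$ and $(uv)\check{\ }=(-1)^{|u||v|}\check v\,\check u$ for homogeneous $u,v$. For a representation $(\rho,W)$ of $\mathfrak h$ let $$\mathrm{Coind}_{\mathfrak h}^{\mathfrak g}(\rho)=\{\mu:U(\mathfrak g)\to W \text{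 linear}\ :\ \langle Hu,\mu\rangle=\rho(H)\langle u,\mu\rangle\ \text{ for all } H\in\mathfrak h,\ u\in U(\mathfrak g)\},$$ where $\langle u,\mu\rangle$ denotes the value of $\mu$ at $u$, with the action of $U(\mathfrak g)$ given by $\langle v,u\cdot\mu\rangle=\langle vu,\mu\rangle$, and let $I_\rho\subset U(\mathfrak g)$ be the kernel of this representation of $U(\mathfrak g)$. Let $\mathrm{strad}_{\mathfrak g/\mathfrak h}$ be the character of $\mathfrak h$ which sends $H$ to the supertrace (trace of the even-even block minus trace of the odd-odd block) of the endomorphism of $\mathfrak g/\mathfrak h$ induced by $\mathrm{ad}(H)$. For a character $\chi$ of $\mathfrak h$ let $k_\chi$ be the corresponding representation on the even line $k$; let $\Pi$ be the change of parity, with $H\cdot\Pi w=(-1)^{|H|}\Pi(H\cdot w)$; let $\pi^*$ be the contragredient representation on $V^*=\mathrm{Hom}_k(V,k)$, $(H\cdot f)(v)=-(-1)^{|H||f|}f(\pi(H)v)$; and let $H\cdot(v\otimes w)=Hv\otimes w+(-1)^{|H||v|}v\otimes Hw$ on tensor products. Then $$I_\pi=\check I_{\pi^*\otimes\Pi^m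 k_{-\mathrm{strad}_{\mathfrak g/\mathfrak h}}},$$ where $\check I=\{\check u: u\in I\}$. -/

import Mathlib

open scoped TensorProduct

noncomputable section

namespace SuperLie

/-! ## Superspaces -/

/-- The sign `(-1)^{ij}` attached to two parities. -/
def koszul (i j : ZMod 2) : ℤ := (-1) ^ (i.val * j.val)

theorem koszul_comm (i j : ZMod 2) : koszul i j = koszul j i := by
  simp only [koszul, mul_comm]

@[simp] theorem koszul_zero_left (j : ZMod 2) : koszul 0 j = 1 := by simp [koszul]
@[simp] theorem koszul_zero_right (j : ZMod 2) : koszul j 0 = 1 := by simp [koszul]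
@[simp] theorem koszul_one_one : koszul 1 1 = -1 := by decide

theorem koszul_add_right (i j l : ZMod 2) : koszul i (j + l) = koszul i j * koszul i l := by
  revert i j l; decide

theorem koszul_add_left (i j l : ZMod 2) : koszul (i + j) l = koszul i l * koszul j l := by
  revert i j l; decide

theorem koszul_mul_self (i j : ZMod 2) : koszul i j * koszul i j = 1 := by
  revert i j; decide

/-- A superspace structure on `V`: a decomposition `V = V₀ ⊕ V₁`, indexed by `ℤ/2ℤ`. -/
structure SuperGrading (k V : Type*) [Field k] [AddCommGroup V] [Module k V] where
  gr : ZMod 2 → Submodule k V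
  isCompl : IsCompl (gr 0) (gr 1)

namespace SuperGrading

variable {k V W : Type*} [Field k] [AddCommGroup V] [Module k V] [AddCommGroup W] [Module k W]

theorem isCompl_add_one (G : SuperGrading k V) (i : ZMod 2) :
    IsCompl (G.gr i) (G.gr (i + 1)) := by
  fin_cases i
  · exact G.isCompl
  · exact G.isCompl.symm

/-- The projection of `V` onto `V_i` along the other homogeneous component. -/
def proj (G : SuperGrading k V) (i : ZMod 2) : V →ₗ[k] V :=
  (G.gr i).projection (G.gr (i + 1)) (G.isCompl_add_one i)

theorem proj_mem (G : SuperGrading k V) (i : ZMod 2) (v : V) : G.proj i v ∈ G.gr i :=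
  Submodule.projection_apply_mem _ _

theorem proj_of_mem (G : SuperGrading k V) {i : ZMod 2} {v : V} (hv : v ∈ G.gr i) :
    G.proj i v = v :=
  Submodule.projection_apply_of_mem_left _ hv

theorem proj_of_mem_ne (G : SuperGrading k V) {i j : ZMod 2} {v : V} (hv : v ∈ G.gr j)
    (h : i ≠ j) : G.proj i v = 0 := by
  have : j = i + 1 := (by decide : ∀ i j : ZMod 2, i ≠ j → j = i + 1) i j h
  subst this
  exact Submodule.projection_apply_of_mem_right _ hv

theorem proj_zero_add_proj_one (G : SuperGrading k V) (v : V) :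
    G.proj 0 v + G.proj 1 v = v := by
  obtain ⟨a, ha, b, hb, rfl⟩ := Submodule.mem_sup.1
    (show v ∈ G.gr 0 ⊔ G.gr 1 from G.isCompl.sup_eq_top ▸ Submodule.mem_top)
  simp only [map_add]
  rw [G.proj_of_mem ha, G.proj_of_mem hb, G.proj_of_mem_ne ha (by decide),
    G.proj_of_mem_ne hb (by decide)]
  simp

theorem sum_proj_of_mem (G : SuperGrading k V) (F : ZMod 2 → V →ₗ[k] W) {i : ZMod 2} {v : V}
    (hv : v ∈ G.gr i) : ∑ j, F j (G.proj j v) = F i v := by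
  rw [Finset.sum_eq_single i]
  · rw [G.proj_of_mem hv]
  · intro j _ hj
    rw [G.proj_of_mem_ne hv hj, map_zero]
  · simp

theorem induction (G : SuperGrading k V) {P : V → Prop}
    (hom : ∀ i, ∀ v ∈ G.gr i, P v) (add : ∀ v w, P v → P w → P (v + w)) (v : V) : P v := by
  rw [← G.proj_zero_add_proj_one v]
  exact add _ _ (hom 0 _ (G.proj_mem 0 v)) (hom 1 _ (G.proj_mem 1 v))

/-- Linear maps which agree on homogeneous elements are equal. -/
theorem hom_ext (G : SuperGrading k V) {f g : V →ₗ[k] W}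
    (h : ∀ i, ∀ v ∈ G.gr i, f v = g v) : f = g := by
  ext v
  rw [← G.proj_zero_add_proj_one v, map_add, map_add, h 0 _ (G.proj_mem 0 v),
    h 1 _ (G.proj_mem 1 v)]

/-- The operator `v ↦ (-1)^{i|v|} v`. -/
def sgn (G : SuperGrading k V) (i : ZMod 2) : V →ₗ[k] V :=
  ∑ j, koszul i j • G.proj j

theorem sgn_of_mem (G : SuperGrading k V) (i : ZMod 2) {j : ZMod 2} {v : V}
    (hv : v ∈ G.gr j) : G.sgn i v = koszul i j • v := by
  have := G.sum_proj_of_mem (fun l => koszul i l • (LinearMap.id : V →ₗ[k] V)) hv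
  simpa [sgn, LinearMap.sum_apply] using this

/-- The ground field, purely even. -/
def base (k : Type*) [Field k] : SuperGrading k k where
  gr i := if i = 0 then ⊤ else ⊥
  isCompl := by simpa using isCompl_top_bot

/-- The change of parity functor: `(ΠV)_i = V_{i+1}`. -/
def shift (G : SuperGrading k V) : SuperGrading k V where
  gr i := G.gr (i + 1)
  isCompl := G.isCompl.symm

/-- The dual superspace: a linear form of degree `i` vanishes on the component of degree
different from `i`. -/
def dual (G : SuperGrading k V) : SuperGrading k (Module.Dual k V) where
  gr i := (G.gr (i + 1)).dualAnnihilator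
  isCompl := by
    constructor
    · rw [Submodule.disjoint_def]
      intro f h0 h1
      rw [Submodule.mem_dualAnnihilator] at h0 h1
      exact G.hom_ext fun i v hv => by
        fin_cases i
        · exact h1 v hv
        · exact h0 v hv
    · rw [codisjoint_iff, eq_top_iff]
      intro f _
      refine Submodule.mem_sup.2 ⟨f ∘ₗ G.proj 0, ?_, f ∘ₗ G.proj 1, ?_, ?_⟩
      · rw [Submodule.mem_dualAnnihilator]
        intro v hv
        rw [LinearMap.comp_apply, G.proj_of_mem_ne hv (by decide), map_zero]
      · rw [Submodule.mem_dualAnnihilator]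
        intro v hv
        rw [LinearMap.comp_apply, G.proj_of_mem_ne hv (by decide), map_zero]
      · ext v
        simp only [LinearMap.add_apply, LinearMap.comp_apply, ← map_add,
          G.proj_zero_add_proj_one]

/-- The tensor product of superspaces: `(V ⊗ W)_n = ∑_i V_i ⊗ W_{n-i}`. -/
def tensor (G : SuperGrading k V) (G' : SuperGrading k W) : SuperGrading k (V ⊗[k] W) where
  gr n := ⨆ i, Submodule.map₂ (TensorProduct.mk k V W) (G.gr i) (G'.gr (n - i))
  isCompl := by
    constructor
    · rw [Submodule.disjoint_def]
      intro x h0 h1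
      let P : V ⊗[k] W →ₗ[k] V ⊗[k] W := ∑ i, TensorProduct.map (G.proj i) (G'.proj i)
      have e0 : (⨆ i, Submodule.map₂ (TensorProduct.mk k V W) (G.gr i) (G'.gr (0 - i))) ≤
          LinearMap.ker (P - LinearMap.id) := by
        refine iSup_le fun i => Submodule.map₂_le.2 fun v hv w hw => ?_
        have hw' : w ∈ G'.gr i := by
          have : (0 : ZMod 2) - i = i := (by decide : ∀ i : ZMod 2, 0 - i = i) i
          rwa [this] at hw
        have : ∑ j, (G.proj j v) ⊗ₜ[k] (G'.proj j w) = v ⊗ₜ[k] w := by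
          rw [Finset.sum_eq_single i]
          · rw [G.proj_of_mem hv, G'.proj_of_mem hw']
          · intro j _ hj
            rw [G.proj_of_mem_ne hv hj, TensorProduct.zero_tmul]
          · simp
        simp [P, LinearMap.sum_apply, this]
      have e1 : (⨆ i, Submodule.map₂ (TensorProduct.mk k V W) (G.gr i) (G'.gr (1 - i))) ≤
          LinearMap.ker P := by
        refine iSup_le fun i => Submodule.map₂_le.2 fun v hv w hw => ?_
        have : ∑ j, (G.proj j v) ⊗ₜ[k] (G'.proj j w) = 0 := by
          refine Finset.sum_eq_zero fun j _ => ?_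
          by_cases hj : j = i
          · subst hj
            rw [G'.proj_of_mem_ne hw ((by decide : ∀ j : ZMod 2, j ≠ 1 - j) j), TensorProduct.tmul_zero]
          · rw [G.proj_of_mem_ne hv hj, TensorProduct.zero_tmul]
        simp [P, LinearMap.sum_apply, this]
      have a0 := LinearMap.mem_ker.1 (e0 h0)
      have a1 := LinearMap.mem_ker.1 (e1 h1)
      rw [LinearMap.sub_apply, a1] at a0
      simpa using a0
    · rw [codisjoint_iff, eq_top_iff, ← TensorProduct.span_tmul_eq_top, Submodule.span_le]
      rintro _ ⟨v, w, rfl⟩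
      have key : ∀ i j, (G.proj i v) ⊗ₜ[k] (G'.proj j w) ∈
          (⨆ l, Submodule.map₂ (TensorProduct.mk k V W) (G.gr l) (G'.gr (i + j - l))) := by
        intro i j
        refine Submodule.mem_iSup_of_mem i (Submodule.apply_mem_map₂ _ (G.proj_mem i v) ?_)
        rw [add_sub_cancel_left]
        exact G'.proj_mem j w
      have hs : v ⊗ₜ[k] w =
          ((G.proj 0 v) ⊗ₜ[k] (G'.proj 0 w) + (G.proj 1 v) ⊗ₜ[k] (G'.proj 1 w)) +
          ((G.proj 0 v) ⊗ₜ[k] (G'.proj 1 w) + (G.proj 1 v) ⊗ₜ[k] (G'.proj 0 w)) := by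
        conv_lhs => rw [← G.proj_zero_add_proj_one v, ← G'.proj_zero_add_proj_one w]
        simp only [TensorProduct.add_tmul, TensorProduct.tmul_add]
        abel
      rw [SetLike.mem_coe, hs]
      exact Submodule.add_mem_sup (add_mem (key 0 0) (key 1 1)) (add_mem (key 0 1) (key 1 0))

theorem tmul_mem_tensor (G : SuperGrading k V) (G' : SuperGrading k W) {i j : ZMod 2} {v : V}
    {w : W} (hv : v ∈ G.gr i) (hw : w ∈ G'.gr j) : v ⊗ₜ[k] w ∈ (G.tensor G').gr (i + j) := by
  refine Submodule.mem_iSup_of_mem i (Submodule.apply_mem_map₂ _ hv ?_)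
  rwa [add_sub_cancel_left]

/-- A subspace is a subsuperspace if it contains the components of its elements. -/
def IsHomogeneous (G : SuperGrading k V) (S : Submodule k V) : Prop :=
  ∀ v ∈ S, ∀ i, G.proj i v ∈ S

/-- The superspace structure on a subsuperspace. -/
def sub (G : SuperGrading k V) (S : Submodule k V) (hS : G.IsHomogeneous S) :
    SuperGrading k S where
  gr i := (G.gr i).comap S.subtype
  isCompl := by
    constructor
    · rw [Submodule.disjoint_def]
      intro x h0 h1
      exact Subtype.ext (Submodule.disjoint_def.1 G.isCompl.disjoint _ h0 h1)
    · rw [codisjoint_iff, eq_top_iff]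
      intro x _
      exact Submodule.mem_sup.2 ⟨⟨_, hS x x.2 0⟩, G.proj_mem 0 x, ⟨_, hS x x.2 1⟩,
        G.proj_mem 1 x, Subtype.ext (G.proj_zero_add_proj_one (x : V))⟩

/-- The superspace structure on the quotient by a subsuperspace. -/
def quot (G : SuperGrading k V) (S : Submodule k V) (hS : G.IsHomogeneous S) :
    SuperGrading k (V ⧸ S) where
  gr i := (G.gr i).map S.mkQ
  isCompl := by
    constructor
    · rw [Submodule.disjoint_def]
      rintro _ ⟨a, ha, rfl⟩ ⟨b, hb, hab⟩
      have h1 : b - a ∈ S := (Submodule.Quotient.eq S).1 hab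
      have h2 := hS _ h1 0
      rw [map_sub, G.proj_of_mem ha, G.proj_of_mem_ne hb (by decide), zero_sub,
        Submodule.neg_mem_iff] at h2
      exact (Submodule.Quotient.mk_eq_zero S).2 h2
    · rw [codisjoint_iff, ← Submodule.map_sup, G.isCompl.sup_eq_top, Submodule.map_top,
        Submodule.range_mkQ]

/-- The odd dimension of a superspace. -/
def oddDim (G : SuperGrading k V) : ℕ := Module.finrank k (G.gr 1)

/-- The supertrace `tr f₀₀ - tr f₁₁` of an endomorphism of a (finite dimensional) superspace. -/
def supertrace (G : SuperGrading k V) : (V →ₗ[k] V) →ₗ[k] k where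
  toFun f := LinearMap.trace k V (G.proj 0 * f) - LinearMap.trace k V (G.proj 1 * f)
  map_add' f g := by simp only [mul_add, map_add]; abel
  map_smul' c f := by simp [mul_sub]

theorem proj_mul_self (G : SuperGrading k V) (i : ZMod 2) : G.proj i * G.proj i = G.proj i := by
  ext v
  exact G.proj_of_mem (G.proj_mem i v)

theorem proj_mul_ne (G : SuperGrading k V) {i j : ZMod 2} (h : i ≠ j) :
    G.proj i * G.proj j = 0 := by
  ext v
  exact G.proj_of_mem_ne (G.proj_mem j v) h

theorem proj_mul_of_degree (G : SuperGrading k V) {d : ZMod 2} {f : V →ₗ[k] V}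
    (hf : ∀ j, ∀ v ∈ G.gr j, f v ∈ G.gr (d + j)) (i : ZMod 2) :
    G.proj i * f = f * G.proj (d + i) := by
  refine G.hom_ext fun j v hv => ?_
  simp only [Module.End.mul_apply]
  by_cases hj : d + j = i
  · have : d + i = j := (by decide : ∀ d i j : ZMod 2, d + j = i → d + i = j) d i j hj
    rw [this, G.proj_of_mem hv, ← hj, G.proj_of_mem (hf j v hv)]
  · have : d + i ≠ j := (by decide : ∀ d i j : ZMod 2, d + j ≠ i → d + i ≠ j) d i j hj
    rw [G.proj_of_mem_ne hv this, G.proj_of_mem_ne (hf j v hv) (Ne.symm hj), map_zero]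

theorem supertrace_odd (G : SuperGrading k V) {f : V →ₗ[k] V}
    (hf : ∀ j, ∀ v ∈ G.gr j, f v ∈ G.gr (1 + j)) : G.supertrace f = 0 := by
  have key : ∀ i, LinearMap.trace k V (G.proj i * f) = 0 := by
    intro i
    rw [← G.proj_mul_self i, mul_assoc, LinearMap.trace_mul_comm, G.proj_mul_of_degree hf i,
      mul_assoc, G.proj_mul_ne (show 1 + i ≠ i by revert i; decide), mul_zero, map_zero]
  simp [supertrace, key]

theorem supertrace_comm (G : SuperGrading k V) {d e : ZMod 2} {f g : V →ₗ[k] V}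
    (hf : ∀ j, ∀ v ∈ G.gr j, f v ∈ G.gr (d + j))
    (hg : ∀ j, ∀ v ∈ G.gr j, g v ∈ G.gr (e + j)) :
    G.supertrace (f * g - koszul d e • (g * f)) = 0 := by
  by_cases hde : d = e
  · subst hde
    have key : ∀ i, LinearMap.trace k V (G.proj i * (f * g)) =
        LinearMap.trace k V (G.proj (d + i) * (g * f)) := by
      intro i
      rw [← mul_assoc, G.proj_mul_of_degree hf i, mul_assoc, LinearMap.trace_mul_comm, mul_assoc]
    have hd : d = 0 ∨ d = 1 := (by decide : ∀ d : ZMod 2, d = 0 ∨ d = 1) d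
    rw [map_sub, map_zsmul]
    simp only [supertrace, LinearMap.coe_mk, AddHom.coe_mk, key]
    rcases hd with rfl | rfl
    · simp
    · have : (1 : ZMod 2) + 1 = 0 := by decide
      simp [this]
  · refine G.supertrace_odd fun j v hv => ?_
    have key : ∀ d e j : ZMod 2, d ≠ e → d + (e + j) = 1 + j := by decide
    have h1 := key d e j hde
    have h2 := key e d j (Ne.symm hde)
    have a1 := hf _ _ (hg j v hv)
    have a2 := hg _ _ (hf j v hv)
    rw [h1] at a1
    rw [h2] at a2
    simpa using sub_mem a1 (zsmul_mem a2 _)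

end SuperGrading

/-! ## Lie superalgebras -/

/-- A Lie superalgebra over `k`. The last axiom follows from the Jacobi identity when `3` is
invertible; in characteristic `3` it is part of the definition. (Over a field of characteristic
`2` further axioms would be needed.) -/
class LieSuperalgebra (k g : Type*) [Field k] [AddCommGroup g] [Module k g] where
  grading : SuperGrading k g
  bracket : g →ₗ[k] g →ₗ[k] g
  bracket_mem : ∀ {i j : ZMod 2} {x y : g}, x ∈ grading.gr i → y ∈ grading.gr j →
    bracket x y ∈ grading.gr (i + j)
  skew : ∀ {i j : ZMod 2} {x y : g}, x ∈ grading.gr i → y ∈ grading.gr j →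
    bracket x y = -(koszul i j • bracket y x)
  jacobi : ∀ {i j : ZMod 2} {x y : g}, x ∈ grading.gr i → y ∈ grading.gr j → ∀ z : g,
    bracket x (bracket y z) = bracket (bracket x y) z + koszul i j • bracket y (bracket x z)
  odd_cube : ∀ {x : g}, x ∈ grading.gr 1 → bracket x (bracket x x) = 0

section LieSuperalgebra

variable (k : Type*) {g : Type*} [Field k] [AddCommGroup g] [Module k g] [LieSuperalgebra k g]

variable (g) in
/-- The superspace underlying a Lie superalgebra. -/
abbrev grd : SuperGrading k g := LieSuperalgebra.grading

/-- The bracket `[x, y]`. -/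
abbrev sbr (x y : g) : g := LieSuperalgebra.bracket (k := k) x y

variable (g) in
/-- A Lie subsuperalgebra: a subsuperspace stable under the bracket. -/
structure LieSubsuperalgebra extends Submodule k g where
  homogeneous : (grd k g).IsHomogeneous toSubmodule
  bracket_mem : ∀ {x y : g}, x ∈ toSubmodule → y ∈ toSubmodule → sbr k x y ∈ toSubmodule

end LieSuperalgebra

section

variable {k g : Type*} [Field k] [AddCommGroup g] [Module k g] [LieSuperalgebra k g]

/-- A Lie subsuperalgebra is a Lie superalgebra. -/
instance (h : LieSubsuperalgebra k g) : LieSuperalgebra k h.toSubmodule where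
  grading := (grd k g).sub h.toSubmodule h.homogeneous
  bracket := LinearMap.mk₂ k (fun x y => ⟨sbr k (x : g) (y : g), h.bracket_mem x.2 y.2⟩)
    (by intro x y z; ext; simp [sbr]) (by intro c x y; ext; simp [sbr])
    (by intro x y z; ext; simp) (by intro c x y; ext; simp)
  bracket_mem := fun hx hy => LieSuperalgebra.bracket_mem (k := k) (g := g) hx hy
  skew := fun hx hy => Subtype.ext (by
    simpa using LieSuperalgebra.skew (k := k) (g := g) hx hy)
  jacobi := fun hx hy z => Subtype.ext (by
    simpa using LieSuperalgebra.jacobi (k := k) (g := g) hx hy (z : g))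
  odd_cube := fun hx => Subtype.ext (by
    simpa using LieSuperalgebra.odd_cube (k := k) (g := g) hx)

end

/-! ## Representations -/

/-- A representation of a Lie superalgebra on a superspace. -/
structure SuperRep (k h V : Type*) [Field k] [AddCommGroup h] [Module k h] [LieSuperalgebra k h]
    [AddCommGroup V] [Module k V] where
  grading : SuperGrading k V
  act : h →ₗ[k] V →ₗ[k] V
  act_mem : ∀ {i j : ZMod 2} {x : h} {v : V}, x ∈ (grd k h).gr i → v ∈ grading.gr j →
    act x v ∈ grading.gr (i + j)
  act_bracket : ∀ {i j : ZMod 2} {x y : h}, x ∈ (grd k h).gr i → y ∈ (grd k h).gr j → ∀ v : V,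
    act (sbr k x y) v = act x (act y v) - koszul i j • act y (act x v)

namespace SuperRep

variable {k h V W : Type*} [Field k] [AddCommGroup h] [Module k h] [LieSuperalgebra k h]
  [AddCommGroup V] [Module k V] [AddCommGroup W] [Module k W]

/-- The action `(x·f)(v) = -(-1)^{|x||f|} f(x·v)` on the dual. -/
def dualAct (π : SuperRep k h V) : h →ₗ[k] Module.Dual k V →ₗ[k] Module.Dual k V :=
  LinearMap.mk₂ k
    (fun x f => -∑ i, (π.grading.dual.sgn i f) ∘ₗ π.act ((grd k h).proj i x))
    (by intro x y f; ext v; simp [LinearMap.sum_apply, Finset.sum_add_distrib]; abel)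
    (by intro c x f; ext v; simp [LinearMap.sum_apply, Finset.mul_sum])
    (by intro x f f'; ext v; simp [LinearMap.sum_apply, Finset.sum_add_distrib]; abel)
    (by intro c x f; ext v; simp [LinearMap.sum_apply, Finset.mul_sum])

theorem dualAct_apply (π : SuperRep k h V) {i j : ZMod 2} {x : h} {f : Module.Dual k V}
    (hx : x ∈ (grd k h).gr i) (hf : f ∈ π.grading.dual.gr j) (v : V) :
    π.dualAct x f v = -(koszul i j • f (π.act x v)) := by
  simp only [dualAct, LinearMap.mk₂_apply, LinearMap.neg_apply, LinearMap.sum_apply,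
    LinearMap.comp_apply]
  rw [Finset.sum_eq_single i]
  · rw [(grd k h).proj_of_mem hx, π.grading.dual.sgn_of_mem i hf, LinearMap.smul_apply]
  · intro l _ hl
    rw [(grd k h).proj_of_mem_ne hx hl, map_zero, LinearMap.zero_apply, map_zero]
  · simp

theorem dualAct_mem (π : SuperRep k h V) {i j : ZMod 2} {x : h} {f : Module.Dual k V}
    (hx : x ∈ (grd k h).gr i) (hf : f ∈ π.grading.dual.gr j) :
    π.dualAct x f ∈ π.grading.dual.gr (i + j) := by
  refine (Submodule.mem_dualAnnihilator _).2 fun v hv => ?_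
  have h1 := π.act_mem hx hv
  rw [(by decide : ∀ i j : ZMod 2, i + (i + j + 1) = j + 1)] at h1
  rw [π.dualAct_apply hx hf, (Submodule.mem_dualAnnihilator _).1 hf _ h1, smul_zero, neg_zero]

/-- The contragredient representation on `V*`: `(x·f)(v) = -(-1)^{|x||f|} f(x·v)`. -/
def dual (π : SuperRep k h V) : SuperRep k h (Module.Dual k V) where
  grading := π.grading.dual
  act := π.dualAct
  act_mem := π.dualAct_mem
  act_bracket := by
    intro i j x y hx hy f
    refine π.grading.dual.induction (P := fun f => π.dualAct (sbr k x y) f =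
      π.dualAct x (π.dualAct y f) - koszul i j • π.dualAct y (π.dualAct x f)) ?_ ?_ f
    · intro l f hf
      ext v
      simp only [LinearMap.sub_apply, LinearMap.smul_apply]
      rw [π.dualAct_apply (LieSuperalgebra.bracket_mem hx hy) hf,
        π.dualAct_apply hx (π.dualAct_mem hy hf), π.dualAct_apply hy hf,
        π.dualAct_apply hy (π.dualAct_mem hx hf), π.dualAct_apply hx hf, π.act_bracket hx hy]
      have e := koszul_mul_self i j
      have e' : (koszul i j : k) * koszul i j = 1 := by
        simpa using congrArg (Int.cast : ℤ → k) e
      simp only [koszul_add_left, koszul_add_right, koszul_comm j i, map_sub, map_zsmul,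
        zsmul_eq_mul, Int.cast_mul]
      linear_combination ((koszul i l : k) * koszul j l * f (π.act x (π.act y v))) * e'
    · intro f f' hf hf'
      simp only [map_add, hf, hf', smul_add]
      abel

/-- The change of parity `ΠV` of a representation: `x·(Πv) = (-1)^{|x|} Π(x·v)`. -/
def shift (π : SuperRep k h V) : SuperRep k h V where
  grading := π.grading.shift
  act := π.act ∘ₗ (grd k h).sgn 1
  act_mem := by
    intro i j x v hx hv
    have := π.act_mem hx hv
    simp only [LinearMap.comp_apply, (grd k h).sgn_of_mem 1 hx, map_zsmul, LinearMap.smul_apply]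
    refine zsmul_mem ?_ _
    rwa [← add_assoc] at this
  act_bracket := by
    intro i j x y hx hy v
    simp only [LinearMap.comp_apply, (grd k h).sgn_of_mem 1 hx, (grd k h).sgn_of_mem 1 hy,
      (grd k h).sgn_of_mem 1 (LieSuperalgebra.bracket_mem hx hy), map_zsmul,
      LinearMap.smul_apply, π.act_bracket hx hy v, koszul_add_right, smul_sub, smul_smul]
    congr 1 <;> ring_nf

/-- The action `x·(v ⊗ w) = x·v ⊗ w + (-1)^{|x||v|} v ⊗ x·w` on a tensor product. -/
def tensorAct (π : SuperRep k h V) (ρ : SuperRep k h W) :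
    h →ₗ[k] V ⊗[k] W →ₗ[k] V ⊗[k] W where
  toFun x := TensorProduct.map (π.act x) LinearMap.id +
    ∑ i, TensorProduct.map (π.grading.sgn i) (ρ.act ((grd k h).proj i x))
  map_add' x y := by
    simp only [map_add, TensorProduct.map_add_left, TensorProduct.map_add_right,
      Finset.sum_add_distrib]
    abel
  map_smul' c x := by
    simp only [map_smul, TensorProduct.map_smul_left, TensorProduct.map_smul_right,
      Finset.smul_sum, smul_add, RingHom.id_apply]

theorem tensorAct_tmul (π : SuperRep k h V) (ρ : SuperRep k h W) {i j : ZMod 2} {x : h} {v : V}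
    (hx : x ∈ (grd k h).gr i) (hv : v ∈ π.grading.gr j) (w : W) :
    π.tensorAct ρ x (v ⊗ₜ w) = π.act x v ⊗ₜ w + koszul i j • (v ⊗ₜ ρ.act x w) := by
  simp only [tensorAct, LinearMap.coe_mk, AddHom.coe_mk, LinearMap.add_apply,
    LinearMap.sum_apply, TensorProduct.map_tmul, LinearMap.id_apply]
  congr 1
  rw [Finset.sum_eq_single i]
  · rw [(grd k h).proj_of_mem hx, π.grading.sgn_of_mem i hv, TensorProduct.smul_tmul']
  · intro l _ hl
    rw [(grd k h).proj_of_mem_ne hx hl, map_zero, LinearMap.zero_apply, TensorProduct.tmul_zero]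
  · simp

/-- The tensor product of representations: `x·(v ⊗ w) = x·v ⊗ w + (-1)^{|x||v|} v ⊗ x·w`. -/
def tensor (π : SuperRep k h V) (ρ : SuperRep k h W) : SuperRep k h (V ⊗[k] W) where
  grading := π.grading.tensor ρ.grading
  act := π.tensorAct ρ
  act_mem := by
    intro i j x t hx ht
    suffices hle : (π.grading.tensor ρ.grading).gr j ≤
        ((π.grading.tensor ρ.grading).gr (i + j)).comap (π.tensorAct ρ x) from hle ht
    refine iSup_le fun l => Submodule.map₂_le.2 fun v hv w hw => ?_
    rw [Submodule.mem_comap, TensorProduct.mk_apply, π.tensorAct_tmul ρ hx hv]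
    refine add_mem ?_ (zsmul_mem ?_ _)
    · have := π.grading.tmul_mem_tensor ρ.grading (π.act_mem hx hv) hw
      rwa [show i + l + (j - l) = i + j by ring] at this
    · have := π.grading.tmul_mem_tensor ρ.grading hv (ρ.act_mem hx hw)
      rwa [show l + (i + (j - l)) = i + j by ring] at this
  act_bracket := by
    intro i j x y hx hy t
    induction t using TensorProduct.induction_on with
    | zero => simp
    | add s t hs ht =>
      simp only [map_add, hs, ht, smul_add]
      abel
    | tmul v w =>
      refine π.grading.induction (P := fun v => π.tensorAct ρ (sbr k x y) (v ⊗ₜ[k] w) =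
        π.tensorAct ρ x (π.tensorAct ρ y (v ⊗ₜ[k] w)) -
          koszul i j • π.tensorAct ρ y (π.tensorAct ρ x (v ⊗ₜ[k] w))) ?_ ?_ v
      · intro l v hv
        rw [π.tensorAct_tmul ρ (LieSuperalgebra.bracket_mem hx hy) hv,
          π.tensorAct_tmul ρ hy hv, π.tensorAct_tmul ρ hx hv, map_add, map_add, map_zsmul,
          map_zsmul, π.tensorAct_tmul ρ hx hv, π.tensorAct_tmul ρ hy hv,
          π.tensorAct_tmul ρ hx (π.act_mem hy hv), π.tensorAct_tmul ρ hy (π.act_mem hx hv),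
          π.act_bracket hx hy, ρ.act_bracket hx hy]
        have e := koszul_mul_self i j
        simp only [koszul_add_left, koszul_add_right, koszul_comm j i, TensorProduct.sub_tmul,
          TensorProduct.tmul_sub, TensorProduct.tmul_smul, ← TensorProduct.smul_tmul', smul_add,
          smul_sub, smul_smul, ← mul_assoc, e, one_mul]
        rw [mul_comm (koszul j l) (koszul i l), mul_right_comm (koszul i l)]
        module
      · intro v v' hv hv'
        simp only [TensorProduct.add_tmul, map_add, hv, hv', smul_add]
        abel

end SuperRep

/-- A character of a Lie superalgebra: an (even) linear form vanishing on brackets. -/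
structure Character (k h : Type*) [Field k] [AddCommGroup h] [Module k h]
    [LieSuperalgebra k h] where
  toFun : h →ₗ[k] k
  map_odd : ∀ x ∈ (grd k h).gr 1, toFun x = 0
  map_bracket : ∀ x y : h, toFun (sbr k x y) = 0

instance (k h : Type*) [Field k] [AddCommGroup h] [Module k h] [LieSuperalgebra k h] :
    Neg (Character k h) where
  neg χ := ⟨-χ.toFun, fun x hx => by simp [χ.map_odd x hx], fun x y => by
    simp [χ.map_bracket x y]⟩

/-- The representation `k_χ` on the purely even line `k`. -/
def Character.rep {k h : Type*} [Field k] [AddCommGroup h] [Module k h] [LieSuperalgebra k h]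
    (χ : Character k h) : SuperRep k h k where
  grading := SuperGrading.base k
  act := (LinearMap.lsmul k k : k →ₗ[k] k →ₗ[k] k) ∘ₗ χ.toFun
  act_mem := by
    intro i j x v hx hv
    rcases (by decide : ∀ d : ZMod 2, d = 0 ∨ d = 1) i with rfl | rfl
    · rw [zero_add]
      exact Submodule.smul_mem _ _ hv
    · simp [χ.map_odd x hx]
  act_bracket := by
    intro i j x y hx hy v
    rcases (by decide : ∀ d : ZMod 2, d = 0 ∨ d = 1) i with rfl | rfl
    · simp only [LinearMap.comp_apply, χ.map_bracket]
      simp [mul_left_comm]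
    · simp only [LinearMap.comp_apply, χ.map_bracket]
      simp [χ.map_odd x hx]

/-! ## The representation on `g / h` and its supertrace -/

section quotient

variable {k g : Type*} [Field k] [AddCommGroup g] [Module k g] [LieSuperalgebra k g]

/-- The representation `ad_{g/h}` of `h` on `g / h`. -/
def adQuot (h : LieSubsuperalgebra k g) : SuperRep k h.toSubmodule (g ⧸ h.toSubmodule) where
  grading := (grd k g).quot h.toSubmodule h.homogeneous
  act :=
    { toFun := fun x => Submodule.mapQ h.toSubmodule h.toSubmodule
        (LieSuperalgebra.bracket (k := k) (x : g)) (fun _ hy => h.bracket_mem x.2 hy)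
      map_add' := by intro x y; ext z; simp
      map_smul' := by intro c x; ext z; simp }
  act_mem := by
    rintro i j x _ hx ⟨z, hz, rfl⟩
    exact ⟨_, LieSuperalgebra.bracket_mem (k := k) (g := g) hx hz, rfl⟩
  act_bracket := by
    intro i j x y hx hy v
    obtain ⟨z, rfl⟩ := h.toSubmodule.mkQ_surjective v
    have := LieSuperalgebra.jacobi (k := k) (g := g) hx hy z
    have h2 := congrArg h.toSubmodule.mkQ (eq_sub_of_add_eq this.symm)
    rw [map_sub, map_zsmul] at h2
    exact h2

/-- The character `strad_{g/h}` of `h`. -/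
def strad (h : LieSubsuperalgebra k g) : Character k h.toSubmodule where
  toFun := (adQuot h).grading.supertrace ∘ₗ (adQuot h).act
  map_odd := fun x hx => (adQuot h).grading.supertrace_odd fun _ _ hv => (adQuot h).act_mem hx hv
  map_bracket := by
    have key : ∀ i j, ∀ x ∈ (grd k h.toSubmodule).gr i, ∀ y ∈ (grd k h.toSubmodule).gr j,
        (adQuot h).grading.supertrace ((adQuot h).act (sbr k x y)) = 0 := by
      intro i j x hx y hy
      rw [← (adQuot h).grading.supertrace_comm
        (fun _ _ hv => (adQuot h).act_mem hx hv) (fun _ _ hv => (adQuot h).act_mem hy hv)]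
      congr 1
      refine LinearMap.ext fun v => ?_
      simpa using (adQuot h).act_bracket hx hy v
    intro x y
    refine (grd k h.toSubmodule).induction (P := fun x => (adQuot h).grading.supertrace
      ((adQuot h).act (sbr k x y)) = 0) (fun i x hx => ?_) (fun x x' hx hx' => ?_) x
    · refine (grd k h.toSubmodule).induction (P := fun y => (adQuot h).grading.supertrace
        ((adQuot h).act (sbr k x y)) = 0) (fun j y hy => key i j x hx y hy)
        (fun y y' hy hy' => ?_) y
      simp only [sbr, map_add] at hy hy' ⊢
      rw [hy, hy', add_zero]
    · simp only [sbr, map_add, LinearMap.add_apply] at hx hx' ⊢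
      rw [hx, hx', add_zero]

end quotient

/-! ## The enveloping superalgebra -/

section Env

variable (k g : Type*) [Field k] [AddCommGroup g] [Module k g] [LieSuperalgebra k g]

/-- The relations `x ⊗ y - (-1)^{|x||y|} y ⊗ x = [x, y]` of the enveloping superalgebra. -/
inductive EnvRel : TensorAlgebra k g → TensorAlgebra k g → Prop
  | mk {i j : ZMod 2} {x y : g} (hx : x ∈ (grd k g).gr i) (hy : y ∈ (grd k g).gr j) :
    EnvRel (TensorAlgebra.ι k x * TensorAlgebra.ι k y -
      koszul i j • (TensorAlgebra.ι k y * TensorAlgebra.ι k x)) (TensorAlgebra.ι k (sbr k x y))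

/-- The enveloping superalgebra `U(g)`. -/
def Env : Type _ := RingQuot (EnvRel k g)

instance : Ring (Env k g) := inferInstanceAs (Ring (RingQuot (EnvRel k g)))

instance : Algebra k (Env k g) := inferInstanceAs (Algebra k (RingQuot (EnvRel k g)))

variable {g}

/-- The canonical map `g → U(g)`. -/
def Env.ι : g →ₗ[k] Env k g :=
  (RingQuot.mkAlgHom k (EnvRel k g)).toLinearMap ∘ₗ TensorAlgebra.ι k

variable {k} {A : Type*} [Ring A] [Algebra k A]

theorem Env.ι_bracket {i j : ZMod 2} {x y : g} (hx : x ∈ (grd k g).gr i)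
    (hy : y ∈ (grd k g).gr j) :
    Env.ι k (sbr k x y) = Env.ι k x * Env.ι k y - koszul i j • (Env.ι k y * Env.ι k x) := by
  have := RingQuot.mkAlgHom_rel k (EnvRel.mk hx hy)
  simp only [map_sub, map_mul, map_zsmul] at this
  exact this.symm

/-- The universal property of `U(g)`. -/
def Env.lift (f : g →ₗ[k] A)
    (hf : ∀ i j, ∀ x ∈ (grd k g).gr i, ∀ y ∈ (grd k g).gr j,
      f x * f y - koszul i j • (f y * f x) = f (sbr k x y)) : Env k g →ₐ[k] A :=
  RingQuot.liftAlgHom k ⟨TensorAlgebra.lift k f, by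
    rintro _ _ ⟨hx, hy⟩
    simpa using hf _ _ _ hx _ hy⟩

@[simp] theorem Env.lift_ι (f : g →ₗ[k] A) (hf) (x : g) :
    Env.lift f hf (Env.ι k x) = f x := by
  simp only [Env.lift, Env.ι]
  exact (RingQuot.liftAlgHom_mkAlgHom_apply k _ _ _).trans (TensorAlgebra.lift_ι_apply f x)

theorem Env.hom_ext {f f' : Env k g →ₐ[k] A} (h : ∀ x, f (Env.ι k x) = f' (Env.ι k x)) :
    f = f' :=
  RingQuot.ringQuot_ext' k f f' (TensorAlgebra.hom_ext (LinearMap.ext h))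

theorem Env.induction {P : Env k g → Prop} (algebraMap : ∀ c : k, P (algebraMap k (Env k g) c))
    (ι : ∀ x : g, P (Env.ι k x)) (add : ∀ u v, P u → P v → P (u + v))
    (mul : ∀ u v, P u → P v → P (u * v)) (u : Env k g) : P u := by
  let S : Subalgebra k (Env k g) :=
    { carrier := {u | P u}
      mul_mem' := fun {u v} => mul u v
      add_mem' := fun {u v} => add u v
      algebraMap_mem' := algebraMap }
  let F : Env k g →ₐ[k] S := Env.lift
    (LinearMap.codRestrict (Subalgebra.toSubmodule S) (Env.ι k) ι) (by
      intro i j x hx y hy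
      exact Subtype.ext (Env.ι_bracket hx hy).symm)
  have h : S.val.comp F = AlgHom.id k _ := Env.hom_ext fun x => by
    rw [AlgHom.comp_apply, Env.lift_ι]
    rfl
  have h2 := congrArg (fun f => f u) h
  have h3 : P (F u : Env k g) := (F u).2
  have h4 : (F u : Env k g) = u := h2
  rwa [h4] at h3

variable (k g)

/-- The automorphism `u ↦ (-1)^{i|u|} u` of `U(g)`. -/
def Env.sgn (i : ZMod 2) : Env k g →ₐ[k] Env k g :=
  Env.lift (Env.ι k ∘ₗ (grd k g).sgn i) (by
    intro j l x hx y hy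
    simp only [LinearMap.comp_apply, (grd k g).sgn_of_mem i hx, (grd k g).sgn_of_mem i hy,
      (grd k g).sgn_of_mem i (LieSuperalgebra.bracket_mem hx hy), map_zsmul,
      Env.ι_bracket hx hy, koszul_add_right, smul_sub, smul_smul, smul_mul_assoc, mul_smul_comm]
    congr 1 <;> ring_nf)

variable {g} in
theorem Env.sgn_ι (i : ZMod 2) {j : ZMod 2} {x : g} (hx : x ∈ (grd k g).gr j) :
    Env.sgn k g i (Env.ι k x) = koszul i j • Env.ι k x := by
  simp [Env.sgn, (grd k g).sgn_of_mem i hx]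

theorem Env.sgn_sgn (i j : ZMod 2) (u : Env k g) :
    Env.sgn k g i (Env.sgn k g j u) = Env.sgn k g (i + j) u := by
  suffices h : (Env.sgn k g i).comp (Env.sgn k g j) = Env.sgn k g (i + j) from
    congrArg (fun f => f u) h
  refine Env.hom_ext fun x => ?_
  refine (grd k g).induction (P := fun x => (Env.sgn k g i).comp (Env.sgn k g j) (Env.ι k x) =
    Env.sgn k g (i + j) (Env.ι k x)) (fun l x hx => ?_) (fun x y hx hy => ?_) x
  · simp only [AlgHom.comp_apply, Env.sgn_ι k _ hx, map_zsmul, smul_smul, koszul_add_left,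
      mul_comm]
  · simp only [map_add, hx, hy]

/-- The operator `u ↦ -(-1)^{|x||u|} u x` on `U(g)`, for `x` in `g`. -/
def Env.antiMul : g →ₗ[k] Module.End k (Env k g) where
  toFun x := -∑ i : ZMod 2,
    LinearMap.mulRight k (Env.ι k ((grd k g).proj i x)) ∘ₗ (Env.sgn k g i).toLinearMap
  map_add' x y := by
    ext u
    simp only [LinearMap.neg_apply, LinearMap.sum_apply, LinearMap.comp_apply, map_add,
      LinearMap.mulRight_apply, mul_add, Finset.sum_add_distrib, LinearMap.add_apply, neg_add]
  map_smul' c x := by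
    ext u
    simp [LinearMap.sum_apply, Finset.smul_sum]

variable {g} in
theorem Env.antiMul_apply {i : ZMod 2} {x : g} (hx : x ∈ (grd k g).gr i) (u : Env k g) :
    Env.antiMul k g x u = -(Env.sgn k g i u * Env.ι k x) := by
  simp only [antiMul, LinearMap.coe_mk, AddHom.coe_mk, LinearMap.neg_apply, LinearMap.sum_apply,
    LinearMap.comp_apply, LinearMap.mulRight_apply, AlgHom.toLinearMap_apply]
  rw [Finset.sum_eq_single i]
  · rw [(grd k g).proj_of_mem hx]
  · intro l _ hl
    rw [(grd k g).proj_of_mem_ne hx hl, map_zero, mul_zero]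
  · simp

/-- The representation of `U(g)` on itself extending `x·u = -(-1)^{|x||u|} u x`. -/
def Env.antiRep : Env k g →ₐ[k] Module.End k (Env k g) :=
  Env.lift (Env.antiMul k g) (by
    intro i j x hx y hy
    ext u
    simp only [LinearMap.sub_apply, LinearMap.smul_apply, Module.End.mul_apply]
    simp only [Env.antiMul_apply k hx, Env.antiMul_apply k hy,
      Env.antiMul_apply k (LieSuperalgebra.bracket_mem hx hy), Env.ι_bracket hx hy, map_neg,
      map_mul, Env.sgn_ι k _ hx, Env.sgn_ι k _ hy, Env.sgn_sgn, koszul_comm j i, add_comm j i,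
      mul_sub, mul_smul_comm, smul_mul_assoc, smul_smul, koszul_mul_self, neg_mul, neg_neg,
      mul_assoc, one_smul]
    abel)

/-- The antipode `u ↦ ǔ` of `U(g)`: the linear map with `1ˇ = 1`, `xˇ = -x` for `x` in `g`, and
`(uv)ˇ = (-1)^{|u||v|} vˇ uˇ`. -/
def Env.antipode : Env k g →ₗ[k] Env k g where
  toFun u := Env.antiRep k g u 1
  map_add' u v := by simp
  map_smul' c u := by simp

theorem Env.sgn_antiRep (i : ZMod 2) (u w : Env k g) :
    Env.sgn k g i (Env.antiRep k g u w) = Env.antiRep k g (Env.sgn k g i u) (Env.sgn k g i w) := by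
  refine Env.induction (P := fun u => ∀ w, Env.sgn k g i (Env.antiRep k g u w) =
    Env.antiRep k g (Env.sgn k g i u) (Env.sgn k g i w)) (fun c w => ?_) (fun x w => ?_)
    (fun u v hu hv w => ?_) (fun u v hu hv w => ?_) u w
  · simp only [AlgHom.commutes, Module.algebraMap_end_apply, map_smul]
  · refine (grd k g).induction (P := fun x => Env.sgn k g i (Env.antiRep k g (Env.ι k x) w) =
      Env.antiRep k g (Env.sgn k g i (Env.ι k x)) (Env.sgn k g i w)) (fun j x hx => ?_)
      (fun x y hx hy => ?_) x
    · simp only [Env.sgn_ι k i hx, map_zsmul, LinearMap.smul_apply, antiRep, Env.lift_ι,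
        Env.antiMul_apply k hx, map_neg, map_mul, Env.sgn_sgn, add_comm j i, mul_smul_comm,
        smul_neg]
    · simp only [map_add, LinearMap.add_apply, hx, hy]
  · simp only [map_add, LinearMap.add_apply, hu, hv]
  · simp only [map_mul, Module.End.mul_apply, hu, hv]

theorem Env.antipode_one : Env.antipode k g 1 = 1 := by
  simp [antipode]

variable {g} in
theorem Env.antipode_ι (x : g) : Env.antipode k g (Env.ι k x) = -Env.ι k x := by
  refine (grd k g).induction (P := fun x => Env.antipode k g (Env.ι k x) = -Env.ι k x)
    (fun i x hx => ?_) (fun x y hx hy => ?_) x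
  · simp [antipode, antiRep, Env.antiMul_apply k hx]
  · simp only [map_add, hx, hy, neg_add]

variable {g} in
/-- `(xu)ˇ = (-1)^{|x||u|} ǔ xˇ`, for `x` in `g`; this and the values on `1` and on `g` determine
the antipode. -/
theorem Env.antipode_ι_mul {i : ZMod 2} {x : g} (hx : x ∈ (grd k g).gr i) (u : Env k g) :
    Env.antipode k g (Env.ι k x * u) =
      Env.antipode k g (Env.sgn k g i u) * Env.antipode k g (Env.ι k x) := by
  have h := Env.sgn_antiRep k g i u 1
  rw [map_one (Env.sgn k g i)] at h
  rw [Env.antipode_ι]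
  simp only [antipode, LinearMap.coe_mk, AddHom.coe_mk, map_mul, Module.End.mul_apply]
  rw [← h]
  simp only [antiRep, Env.lift_ι, Env.antiMul_apply k hx, mul_neg]

end Env

/-! ## Coinduced representations -/

section Coind

variable {k g V : Type*} [Field k] [AddCommGroup g] [Module k g] [LieSuperalgebra k g]
  [AddCommGroup V] [Module k V]

/-- The space `Coind_h^g(π)` of the linear maps `μ : U(g) → V` with `⟨Hu, μ⟩ = π(H)⟨u, μ⟩` for
`H` in `h` and `u` in `U(g)`. A map `μ` is given by its values `⟨u, μ⟩`, with the argument on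
the left, so that no sign occurs. -/
def coind (h : LieSubsuperalgebra k g) (π : SuperRep k h.toSubmodule V) :
    Submodule k (Env k g →ₗ[k] V) where
  carrier := {μ | ∀ (H : h.toSubmodule) (u : Env k g), μ (Env.ι k (H : g) * u) = π.act H (μ u)}
  zero_mem' := by simp
  add_mem' := by
    intro μ ν hμ hν H u
    simp [hμ H u, hν H u]
  smul_mem' := by
    intro c μ hμ H u
    simp [hμ H u]

/-- The coinduced representation of `U(g)` on `Coind_h^g(π)`: `⟨v, u·μ⟩ = ⟨vu, μ⟩`. -/
def coindRep (h : LieSubsuperalgebra k g) (π : SuperRep k h.toSubmodule V) :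
    Env k g →ₐ[k] Module.End k (coind h π) :=
  AlgHom.ofLinearMap
    (LinearMap.mk₂ k
      (fun u μ => ⟨(μ : Env k g →ₗ[k] V) ∘ₗ LinearMap.mulRight k u, fun H v => by
        simp [mul_assoc, μ.2 H]⟩)
      (by intro u u' μ; ext v; simp [mul_add])
      (by intro c u μ; ext v; simp)
      (by intro u μ ν; ext v; simp)
      (by intro c u μ; ext v; simp))
    (by ext μ v; simp)
    (by intro u u'; ext μ v; simp [mul_assoc])

/-- The kernel `I_π ⊆ U(g)` of the representation `Coind_h^g(π)`. -/
def coindKer (h : LieSubsuperalgebra k g) (π : SuperRep k h.toSubmodule V) : Ideal (Env k g) :=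
  RingHom.ker (coindRep h π)

end Coind

end SuperLie

end

open SuperLie

/-!
# Kernels of coinduced representations in characteristic `p > 2`

Write `π' = π* ⊗ Πᵐ k_{-strad}`. The heart of the matter is that an element `u` of `I_π` also kills
the representation induced, rather than coinduced, from a suitable twist `τ` of `π`.

Choose a homogeneous basis of a complement of `h` in `g`. By the Poincaré–Birkhoff–Witt theorem
(`Env.exists_linearMap`, proved by rewriting words and a linear diamond lemma) `U(g)` is free as a
left `U(h)`-module on the normal monomials in that basis, so that every normal monomial `T` has a
dual map `E : U(g) → End V`, which is left `U(h)`-linear (`AdaptedBasis.exists_isDual`). The maps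
`x ↦ E x v` are elements of the coinduced representation; hence `E (w u) = 0` for all `w` and all
`u` in `I_π`.

Take `q = p ^ n` and let `T` be the monomial in which each even letter occurs `q - 1` times and each
odd letter once. For an even letter `y`, the commutator with the `q`-th power of `y` is the
derivation `ad(y) ^ q`, which does not raise the degree (`Env.ι_pow_mul_sub_mem`); therefore `q`-th powers
may be moved around at the expense of terms of much lower degree, which `E` does not see. Up to
degree `deg T + C`, with `C` fixed and `q` large, it follows that `E` is linear for right
multiplication by `U(h)` as well, up to a twist: `E (w c) = E w * τ c`, where
`τ H = (-1) ^ (|T| |H|) π H + strad H` (`AdaptedBasis.exists_apply_mul_incl`). The supertrace comes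
from `[T, H]`: the letter `y` contributes the `y`-coefficient of `[y, H]` once if it is odd, and
`q - 1 = -1` times if it is even (`AdaptedBasis.IsDual.apply_top_mul_ι`).

Now write `u` in `I_π` as a sum of terms `s c_s`, with normal monomials `s` and `c_s` in `U(h)`. If
`s` is of maximal degree with `τ c_s ≠ 0`, there is a monomial `t` such that `t s` is a
rearrangement of `T`, and `0 = E (t u) = ± τ c_s`, a contradiction. So all `c_s` annihilate `τ`
(`exists_sum_of_mem_coindKer`).

The antipode maps the annihilator of `τ` in `U(h)` to that of `π'`
(`SuperRep.lift_antipode_eq_zero_of_surjective`). Hence it maps `s c_s` to a sum of elements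
`c' s'` with `π' c' = 0`, on which the elements of the coinduced representation of `π'` vanish. As
`I_π` is a graded ideal, the antipode maps `I_π` into `I_{π'}` (`antipode_mem_coindKer`). The same
argument with `π'` in place of `π` gives the other inclusion: the antipode maps the annihilator of
the twist of `π'` to that of `π`, because linear forms separate the points of `V`, whatever its
dimension (`SuperRep.lift_antipode_eq_zero_of_injective`).
-/

noncomputable section

set_option linter.unusedSectionVars false

universe u v

namespace SuperLie

/-! ### A linear diamond lemma -/

section NormalForm

/-- The linear form of Newman's diamond lemma. Here `R w r` means that the word `w` may be rewritten
as the combination `r` of smaller words. If any two results for `w` agree modulo the rewritings of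
words smaller than `w`, then a function `φ` on the irreducible words extends to a linear map which
is invariant under rewriting. -/
theorem exists_linear_normalForm {k W M : Type*} [Field k] [AddCommGroup M] [Module k M]
    {lt : W → W → Prop} (wf : WellFounded lt) (R : W → (W →₀ k) → Prop)
    (hR : ∀ w r, R w r → ∀ w' ∈ r.support, lt w' w)
    (conf : ∀ w r r', R w r → R w r' → r - r' ∈ Submodule.span k
      {x | ∃ w' s, lt w' w ∧ R w' s ∧ x = Finsupp.single w' 1 - s})
    (φ : W → M) :
    ∃ N : (W →₀ k) →ₗ[k] M, (∀ w, (∀ r, ¬ R w r) → N (Finsupp.single w 1) = φ w) ∧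
      ∀ w r, R w r → N (Finsupp.single w 1) = N r := by
  classical
  -- rewrite each reducible word by one chosen rule
  let F : ∀ w, (∀ w', lt w' w → M) → M := fun w ih =>
    if h : ∃ r, R w r then (Classical.choose h).sum
      (fun w' c => if hl : lt w' w then c • ih w' hl else 0) else φ w
  let N0 : W → M := wf.fix F
  let N : (W →₀ k) →ₗ[k] M := Finsupp.linearCombination k N0
  have hN (w) : N (Finsupp.single w 1) = N0 w := by simp [N]
  have eq1 : ∀ w (h : ∃ r, R w r), N0 w = N (Classical.choose h) := by
    intro w h
    have h1 : N0 w = F w fun y _ => N0 y := wf.fix_eq F w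
    rw [h1]
    simp only [F, dif_pos h, N, Finsupp.linearCombination_apply]
    refine Finsupp.sum_congr fun w' hw' => ?_
    rw [dif_pos (hR w _ (Classical.choose_spec h) w' hw')]
  refine ⟨N, fun w hw => ?_, fun w => ?_⟩
  · have h1 : N0 w = F w fun y _ => N0 y := wf.fix_eq F w
    have h2 : ¬ ∃ r, R w r := fun ⟨r, hr⟩ => hw r hr
    rw [hN, h1]
    simp only [F, dif_neg h2]
  · induction w using wf.induction with
    | _ w ih =>
    intro r hr
    have h : ∃ r, R w r := ⟨r, hr⟩
    rw [hN, eq1 w h, ← sub_eq_zero, ← map_sub]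
    have := conf w _ _ (Classical.choose_spec h) hr
    have hle : Submodule.span k {x | ∃ w' s, lt w' w ∧ R w' s ∧ x = Finsupp.single w' 1 - s}
        ≤ LinearMap.ker N := by
      rw [Submodule.span_le]
      rintro _ ⟨w', s, hl, hs, rfl⟩
      simp [map_sub, ih w' hl s hs]
    exact hle this

end NormalForm

/-! ### Words in a basis and the confluence of the relations -/

section Words

variable {Λ : Type*} [LinearOrder Λ]

/-- The number of inversions of a word. -/
def inversions : List Λ → ℕ
  | [] => 0
  | a :: l => l.countP (· < a) + inversions l

theorem inversions_swap_lt {a c : Λ} (h : c < a) (u v : List Λ) :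
    inversions (u ++ c :: a :: v) < inversions (u ++ a :: c :: v) := by
  induction u with
  | nil =>
    simp only [List.nil_append, inversions, List.countP_cons, h, not_lt_of_gt h, decide_true,
      decide_false]
    simp
    omega
  | cons d u ih =>
    have : (u ++ c :: a :: v).countP (· < d) = (u ++ a :: c :: v).countP (· < d) :=
      (List.Perm.append_left u (List.Perm.swap a c v)).countP_eq _
    simp only [List.cons_append, inversions, this]
    omega

/-- Words are compared by their length, then by their number of inversions. -/
def wordLT (w w' : List Λ) : Prop :=
  Prod.Lex (· < ·) (· < ·) (w.length, inversions w) (w'.length, inversions w')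

theorem wordLT_wf : WellFounded (wordLT (Λ := Λ)) :=
  InvImage.wf (fun w : List Λ => (w.length, inversions w))
    (WellFounded.prod_lex wellFounded_lt wellFounded_lt)

theorem wordLT_of_length {w w' : List Λ} (h : w.length < w'.length) : wordLT w w' :=
  Prod.Lex.left _ _ h

theorem wordLT_swap {a c : Λ} (h : c < a) (u v : List Λ) :
    wordLT (u ++ c :: a :: v) (u ++ a :: c :: v) := by
  rw [wordLT, Prod.lex_def]
  exact Or.inr ⟨by simp, inversions_swap_lt h u v⟩

theorem wordLT_trans {u v w : List Λ} (h : wordLT u v) (h' : wordLT v w) : wordLT u w := by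
  simp only [wordLT, Prod.lex_def] at *
  omega

variable {k g : Type*} [Field k] [AddCommGroup g] [Module k g] [LieSuperalgebra k g]

/-- The combination of words `u x v` for an element `x` of `g`, expanded in the basis `b`. -/
def insertWord (b : Module.Basis Λ k g) (u v : List Λ) : g →ₗ[k] (List Λ →₀ k) :=
  Finsupp.lmapDomain k k (fun a => u ++ a :: v) ∘ₗ b.repr.toLinearMap

@[simp] theorem insertWord_basis (b : Module.Basis Λ k g) (u v : List Λ) (a : Λ) :
    insertWord b u v (b a) = Finsupp.single (u ++ a :: v) 1 := by
  simp [insertWord]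

theorem length_of_mem_support_insertWord (b : Module.Basis Λ k g) (u v : List Λ) (x : g)
    {w : List Λ} (hw : w ∈ (insertWord b u v x).support) :
    w.length = u.length + v.length + 1 := by
  classical
  have := Finsupp.mapDomain_support hw
  obtain ⟨a, -, rfl⟩ := Finset.mem_image.1 this
  simp
  omega

/-- The relation `u (ac - (-1)^{|a||c|} ca - [a, c]) v` of the enveloping superalgebra. -/
def wordRel (b : Module.Basis Λ k g) (par : Λ → ZMod 2) (u : List Λ) (a c : Λ) (v : List Λ) :
    List Λ →₀ k :=
  Finsupp.single (u ++ a :: c :: v) 1 -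
    koszul (par a) (par c) • Finsupp.single (u ++ c :: a :: v) 1 -
    insertWord b u v (sbr k (b a) (b c))

/-- The pairs of letters which do not occur next to each other in a sorted monomial. -/
def Descent (par : Λ → ZMod 2) (a c : Λ) : Prop := c < a ∨ a = c ∧ par a = 1

/-- The span of the relations whose leading word is smaller than `w`. -/
def relBelow (b : Module.Basis Λ k g) (par : Λ → ZMod 2) (w : List Λ) :
    Submodule k (List Λ →₀ k) :=
  Submodule.span k {x | ∃ u a c v, Descent par a c ∧ wordLT (u ++ a :: c :: v) w ∧
    x = wordRel b par u a c v}

variable {b : Module.Basis Λ k g} {par : Λ → ZMod 2}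

theorem wordRel_mem_relBelow {u v w : List Λ} {a c : Λ} (h : Descent par a c)
    (hl : wordLT (u ++ a :: c :: v) w) : wordRel b par u a c v ∈ relBelow b par w :=
  Submodule.subset_span ⟨u, a, c, v, h, hl, rfl⟩

theorem zmod_two_eq (i : ZMod 2) : i = 0 ∨ i = 1 := by
  revert i; decide

/-- The bracket is only assumed to be skew-symmetric, which makes it alternating on the even part as
`2` is invertible. -/
theorem sbr_self_even (h2 : (2 : k) ≠ 0) {x : g} (hx : x ∈ (grd k g).gr 0) : sbr k x x = 0 := by
  have h := LieSuperalgebra.skew hx hx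
  simp only [koszul_zero_left, one_smul] at h
  have h' : (2 : k) • sbr k x x = 0 := by
    rw [two_smul]
    exact add_eq_zero_iff_eq_neg.2 h
  exact (smul_eq_zero.1 h').resolve_left h2

theorem wordRel_swap (hb : ∀ a, b a ∈ (grd k g).gr (par a)) (u v : List Λ) (a c : Λ) :
    wordRel b par u a c v = -(koszul (par a) (par c) • wordRel b par u c a v) := by
  have e := LieSuperalgebra.skew (hb a) (hb c)
  simp only [wordRel, smul_sub, smul_smul, koszul_comm (par c) (par a), koszul_mul_self, one_smul,
    sbr]
  rw [e]
  simp only [map_neg, map_zsmul]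
  abel

/-- The relations for letters `a`, `c` which are not a descent are consequences of the others, by
skew-symmetry. -/
theorem wordRel_mem_relBelow_of_length (h2 : (2 : k) ≠ 0) (hb : ∀ a, b a ∈ (grd k g).gr (par a))
    {u v w : List Λ} (a c : Λ) (hl : u.length + v.length + 2 < w.length) :
    wordRel b par u a c v ∈ relBelow b par w := by
  have hl' (a c : Λ) : wordLT (u ++ a :: c :: v) w := wordLT_of_length (by simp; omega)
  rcases lt_trichotomy a c with h | rfl | h
  · rw [wordRel_swap hb]
    exact neg_mem (zsmul_mem (wordRel_mem_relBelow (Or.inl h) (hl' _ _)) _)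
  · rcases zmod_two_eq (par a) with h | h
    · have : wordRel b par u a a v = 0 := by
        simp only [wordRel, h, koszul_zero_left, one_smul]
        rw [sbr_self_even h2 (h ▸ hb a)]
        simp
      rw [this]
      exact zero_mem _
    · exact wordRel_mem_relBelow (Or.inr ⟨rfl, h⟩) (hl' _ _)
  · exact wordRel_mem_relBelow (Or.inl h) (hl' _ _)

/-- The relation `u (x c - (-1)^{|x||c|} c x - [x, c]) v` for a homogeneous element `x` of `g`
instead of a letter. -/
theorem insertWord_rel_mem (h2 : (2 : k) ≠ 0) (hb : ∀ a, b a ∈ (grd k g).gr (par a))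
    {u v w : List Λ} {i : ZMod 2} {x : g} (hx : x ∈ (grd k g).gr i) (c : Λ)
    (hl : u.length + v.length + 2 < w.length) :
    insertWord b u (c :: v) x - koszul i (par c) • insertWord b (u ++ [c]) v x -
      insertWord b u v (sbr k x (b c)) ∈ relBelow b par w := by
  let f : g →ₗ[k] (List Λ →₀ k) := insertWord b u (c :: v) -
    insertWord b (u ++ [c]) v ∘ₗ (grd k g).sgn (par c) -
      insertWord b u v ∘ₗ (LieSuperalgebra.bracket (k := k) (g := g)).flip (b c)
  have hf : ⊤ ≤ (relBelow b par w).comap f := by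
    rw [← b.span_eq, Submodule.span_le]
    rintro _ ⟨a, rfl⟩
    have := wordRel_mem_relBelow_of_length h2 hb a c hl
    simpa [f, wordRel, (grd k g).sgn_of_mem _ (hb a), koszul_comm (par c)] using this
  have := hf (Submodule.mem_top : x ∈ ⊤)
  simpa [f, (grd k g).sgn_of_mem _ hx, koszul_comm (par c)] using this

/-- The coefficient of the word `u a c v` in the relation `wordRel b par u a c v`, for a descent
`a`, `c`: it is `2` for an odd letter `a = c`, where the relation is `2 a a - [a, a]`. -/
def descentCoeff (k : Type*) [Field k] (a c : Λ) : k := if a = c then 2 else 1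

theorem descentCoeff_ne_zero (h2 : (2 : k) ≠ 0) (a c : Λ) : descentCoeff k a c ≠ 0 := by
  rw [descentCoeff]
  split_ifs
  exacts [h2, one_ne_zero]

/-- The combination of words `u x m y v` for elements `x` and `y` of `g`. -/
def insertWord₂ (b : Module.Basis Λ k g) (u m v : List Λ) : g →ₗ[k] g →ₗ[k] (List Λ →₀ k) :=
  b.constr k fun a => insertWord b (u ++ a :: m) v

theorem insertWord₂_basis_left (u m v : List Λ) (a : Λ) (y : g) :
    insertWord₂ b u m v (b a) y = insertWord b (u ++ a :: m) v y := by
  simp [insertWord₂]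

theorem insertWord₂_basis_right (u m v : List Λ) (x : g) (c : Λ) :
    insertWord₂ b u m v x (b c) = insertWord b u (m ++ c :: v) x := by
  suffices (insertWord₂ b u m v).flip (b c) = insertWord b u (m ++ c :: v) from
    LinearMap.congr_fun this x
  refine b.ext fun a => ?_
  simp [insertWord₂]

/-- Two relations which rewrite disjoint parts of a word agree up to smaller relations. -/
theorem disjoint_confluence (h2 : (2 : k) ≠ 0)
    {a c d e : Λ} (hac : Descent par a c) (hde : Descent par d e) (u m v : List Λ) :
    (descentCoeff k a c)⁻¹ • wordRel b par u a c (m ++ d :: e :: v) -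
      (descentCoeff k d e)⁻¹ • wordRel b par (u ++ a :: c :: m) d e v ∈
      relBelow b par (u ++ a :: c :: (m ++ d :: e :: v)) := by
  set D := relBelow b par (u ++ a :: c :: (m ++ d :: e :: v)) with hD
  -- `A x` is the relation for `a c` in the word `u a c m x v`, and `B x` is the relation for `d e`
  -- in the word `u x m d e v`
  let A : g →ₗ[k] (List Λ →₀ k) := b.constr k fun l => wordRel b par u a c (m ++ l :: v)
  let B : g →ₗ[k] (List Λ →₀ k) := b.constr k fun l => wordRel b par (u ++ l :: m) d e v
  have hA (x) : A x ∈ D := by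
    have : ⊤ ≤ D.comap A := by
      rw [← b.span_eq, Submodule.span_le]
      rintro _ ⟨l, rfl⟩
      simp only [A, SetLike.mem_coe, Submodule.mem_comap, Module.Basis.constr_basis]
      exact wordRel_mem_relBelow hac (wordLT_of_length (by simp))
    exact this Submodule.mem_top
  have hB (x) : B x ∈ D := by
    have : ⊤ ≤ D.comap B := by
      rw [← b.span_eq, Submodule.span_le]
      rintro _ ⟨l, rfl⟩
      simp only [B, SetLike.mem_coe, Submodule.mem_comap, Module.Basis.constr_basis]
      exact wordRel_mem_relBelow hde (wordLT_of_length (by simp))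
    exact this Submodule.mem_top
  have eA (x) : A x = insertWord b (u ++ a :: c :: m) v x -
      koszul (par a) (par c) • insertWord b (u ++ c :: a :: m) v x -
      insertWord₂ b u m v (sbr k (b a) (b c)) x := by
    suffices h : A = insertWord b (u ++ a :: c :: m) v -
      koszul (par a) (par c) • insertWord b (u ++ c :: a :: m) v -
      insertWord₂ b u m v (sbr k (b a) (b c)) from LinearMap.congr_fun h x
    refine b.ext fun l => ?_
    simp [A, wordRel, insertWord₂_basis_right]
  have eB (x) : B x = insertWord b u (m ++ d :: e :: v) x -
      koszul (par d) (par e) • insertWord b u (m ++ e :: d :: v) x -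
      insertWord₂ b u m v x (sbr k (b d) (b e)) := by
    suffices h : B = insertWord b u (m ++ d :: e :: v) -
      koszul (par d) (par e) • insertWord b u (m ++ e :: d :: v) -
      (insertWord₂ b u m v).flip (sbr k (b d) (b e)) from LinearMap.congr_fun h x
    refine b.ext fun l => ?_
    simp [B, wordRel, insertWord₂_basis_left]
  -- both sides expand `u (ac ∓ ca - [a, c]) m (de ∓ ed - [d, e]) v`, once by its first and once by
  -- its second factor
  have key : (wordRel b par u a c (m ++ d :: e :: v) -
        koszul (par d) (par e) • wordRel b par u a c (m ++ e :: d :: v)) -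
      (wordRel b par (u ++ a :: c :: m) d e v -
        koszul (par a) (par c) • wordRel b par (u ++ c :: a :: m) d e v) =
      A (sbr k (b d) (b e)) - B (sbr k (b a) (b c)) := by
    rw [eA, eB]
    simp only [wordRel, List.append_assoc, List.cons_append]
    generalize koszul (par d) (par e) = s
    generalize koszul (par a) (par c) = s'
    module
  have h1 : descentCoeff k d e • wordRel b par u a c (m ++ d :: e :: v) -
      (wordRel b par u a c (m ++ d :: e :: v) -
        koszul (par d) (par e) • wordRel b par u a c (m ++ e :: d :: v)) ∈ D := by
    rcases hde with h | ⟨rfl, h⟩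
    · have : wordRel b par u a c (m ++ e :: d :: v) ∈ D :=
        wordRel_mem_relBelow hac (by
          simpa using wordLT_swap h (u ++ a :: c :: m) v)
      simpa [descentCoeff, h.ne'] using zsmul_mem this _
    · simp [descentCoeff, h, two_smul]
  have h3 : descentCoeff k a c • wordRel b par (u ++ a :: c :: m) d e v -
      (wordRel b par (u ++ a :: c :: m) d e v -
        koszul (par a) (par c) • wordRel b par (u ++ c :: a :: m) d e v) ∈ D := by
    rcases hac with h | ⟨rfl, h⟩
    · have : wordRel b par (u ++ c :: a :: m) d e v ∈ D :=
        wordRel_mem_relBelow hde (by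
          simpa using wordLT_swap h u (m ++ d :: e :: v))
      simpa [descentCoeff, h.ne'] using zsmul_mem this _
    · simp [descentCoeff, h, two_smul]
  have h4 := D.smul_mem ((descentCoeff k a c)⁻¹ * (descentCoeff k d e)⁻¹)
    (add_mem (sub_mem h1 h3) (key ▸ sub_mem (hA (sbr k (b d) (b e))) (hB (sbr k (b a) (b c)))))
  have n1 := descentCoeff_ne_zero h2 a c
  have n2 := descentCoeff_ne_zero h2 d e
  convert h4 using 1
  generalize descentCoeff k a c = x at *
  generalize descentCoeff k d e = y at *
  match_scalars <;> field_simp <;> ring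

/-- The syzygy between the relations on three adjacent letters: going through the six orders of the
letters `a`, `c`, `d` leads back to the start, up to the Jacobi identity. -/
theorem overlap_syzygy (h2 : (2 : k) ≠ 0) (hb : ∀ a, b a ∈ (grd k g).gr (par a))
    (a c d : Λ) (u v : List Λ) :
    wordRel b par u a c (d :: v) - wordRel b par (u ++ [a]) c d v +
      koszul (par a) (par c) • wordRel b par (u ++ [c]) a d v -
      koszul (par c) (par d) • wordRel b par u a d (c :: v) +
      (koszul (par a) (par c) * koszul (par a) (par d)) • wordRel b par u c d (a :: v) -
      (koszul (par a) (par d) * koszul (par c) (par d)) • wordRel b par (u ++ [d]) a c v ∈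
      relBelow b par (u ++ a :: c :: d :: v) := by
  have hl : u.length + v.length + 2 < (u ++ a :: c :: d :: v).length := by simp; omega
  have p1 := insertWord_rel_mem h2 hb
    (LieSuperalgebra.bracket_mem (k := k) (hb a) (hb c)) d hl
  have p2 := insertWord_rel_mem h2 hb
    (LieSuperalgebra.bracket_mem (k := k) (hb a) (hb d)) c hl
  have p3 := insertWord_rel_mem h2 hb
    (LieSuperalgebra.bracket_mem (k := k) (hb c) (hb d)) a hl
  have j1 := LieSuperalgebra.jacobi (k := k) (hb a) (hb c) (b d)
  have j2 := LieSuperalgebra.skew (k := k) (LieSuperalgebra.bracket_mem (k := k) (hb a) (hb d))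
    (hb c)
  have j3 := LieSuperalgebra.skew (k := k) (LieSuperalgebra.bracket_mem (k := k) (hb c) (hb d))
    (hb a)
  simp only [sbr] at p1 p2 p3
  rw [j2] at p2
  rw [j3, j1] at p3
  have := sub_mem (add_mem (neg_mem p1) (zsmul_mem p2 (koszul (par c) (par d))))
    (zsmul_mem p3 (koszul (par a) (par c) * koszul (par a) (par d)))
  convert this using 1
  simp only [wordRel, List.append_assoc, List.cons_append, List.nil_append, map_neg, map_zsmul,
    map_add, koszul_add_left, koszul_comm (par d), koszul_comm (par c) (par a), sbr]
  rcases zmod_two_eq (par a) with h | h <;> rcases zmod_two_eq (par c) with h' | h' <;>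
    rcases zmod_two_eq (par d) with h'' | h'' <;>
    simp only [h, h', h'', koszul_zero_left, koszul_zero_right, koszul_one_one] <;> module

/-- Two relations which rewrite overlapping parts of a word agree up to smaller relations. -/
theorem overlap_confluence (h2 : (2 : k) ≠ 0) (hb : ∀ a, b a ∈ (grd k g).gr (par a))
    {a c d : Λ} (hac : Descent par a c) (hcd : Descent par c d) (u v : List Λ) :
    (descentCoeff k a c)⁻¹ • wordRel b par u a c (d :: v) -
      (descentCoeff k c d)⁻¹ • wordRel b par (u ++ [a]) c d v ∈
      relBelow b par (u ++ a :: c :: d :: v) := by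
  have S := overlap_syzygy h2 hb a c d u v
  set D := relBelow b par (u ++ a :: c :: d :: v) with hD
  rcases hac with hac | ⟨rfl, ha⟩ <;> rcases hcd with hcd | ⟨rfl, hc⟩
  -- `d < c < a`: the four other relations of the syzygy have smaller leading words
  · have w1 : wordLT (u ++ c :: a :: d :: v) (u ++ a :: c :: d :: v) := wordLT_swap hac _ _
    have w2 : wordLT (u ++ a :: d :: c :: v) (u ++ a :: c :: d :: v) := by
      simpa using wordLT_swap hcd (u ++ [a]) v
    have w3 : wordLT (u ++ c :: d :: a :: v) (u ++ a :: c :: d :: v) :=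
      wordLT_trans (by simpa using wordLT_swap (hcd.trans hac) (u ++ [c]) v) w1
    have w4 : wordLT (u ++ d :: a :: c :: v) (u ++ a :: c :: d :: v) :=
      wordLT_trans (wordLT_swap (hcd.trans hac) u (c :: v)) w2
    have m1 : wordRel b par (u ++ [c]) a d v ∈ D :=
      wordRel_mem_relBelow (Or.inl (hcd.trans hac)) (by simpa using w1)
    have m2 : wordRel b par u a d (c :: v) ∈ D :=
      wordRel_mem_relBelow (Or.inl (hcd.trans hac)) w2
    have m3 : wordRel b par u c d (a :: v) ∈ D := wordRel_mem_relBelow (Or.inl hcd) w3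
    have m4 : wordRel b par (u ++ [d]) a c v ∈ D :=
      wordRel_mem_relBelow (Or.inl hac) (by simpa using w4)
    have := add_mem (sub_mem (add_mem (sub_mem S (zsmul_mem m1 (koszul (par a) (par c))))
      (zsmul_mem m2 (koszul (par c) (par d))))
      (zsmul_mem m3 (koszul (par a) (par c) * koszul (par a) (par d))))
      (zsmul_mem m4 (koszul (par a) (par d) * koszul (par c) (par d)))
    simp only [descentCoeff, hac.ne', hcd.ne', if_false, inv_one, one_smul]
    convert this using 1
    abel
  -- `c < a` and `c = d` is odd: half of the syzygy
  · have w1 : wordLT (u ++ c :: a :: c :: v) (u ++ a :: c :: c :: v) := wordLT_swap hac _ _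
    have w3 : wordLT (u ++ c :: c :: a :: v) (u ++ a :: c :: c :: v) :=
      wordLT_trans (by simpa using wordLT_swap hac (u ++ [c]) v) w1
    have m1 : wordRel b par (u ++ [c]) a c v ∈ D :=
      wordRel_mem_relBelow (Or.inl hac) (by simpa using w1)
    have m3 : wordRel b par u c c (a :: v) ∈ D := wordRel_mem_relBelow (Or.inr ⟨rfl, hc⟩) w3
    simp only [hc, koszul_one_one] at S
    have := D.smul_mem (2 : k)⁻¹ (sub_mem (sub_mem S
      (zsmul_mem m1 (2 * koszul (par a) 1)))
      (zsmul_mem m3 (koszul (par a) 1 * koszul (par a) 1)))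
    simp only [descentCoeff, hac.ne', if_false, if_true, inv_one]
    convert this using 1
    match_scalars <;> field_simp <;> norm_num
  -- `d < a` and `a = c` is odd: half of the syzygy
  · have w2 : wordLT (u ++ a :: d :: a :: v) (u ++ a :: a :: d :: v) := by
      simpa using wordLT_swap hcd (u ++ [a]) v
    have w4 : wordLT (u ++ d :: a :: a :: v) (u ++ a :: a :: d :: v) :=
      wordLT_trans (wordLT_swap hcd u (a :: v)) w2
    have m2 : wordRel b par u a d (a :: v) ∈ D := wordRel_mem_relBelow (Or.inl hcd) w2
    have m4 : wordRel b par (u ++ [d]) a a v ∈ D :=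
      wordRel_mem_relBelow (Or.inr ⟨rfl, ha⟩) (by simpa using w4)
    simp only [ha, koszul_one_one] at S
    have := D.smul_mem (2 : k)⁻¹ (add_mem (add_mem S
      (zsmul_mem m2 (2 * koszul 1 (par d))))
      (zsmul_mem m4 (koszul 1 (par d) * koszul 1 (par d))))
    simp only [descentCoeff, hcd.ne', if_false, if_true, inv_one]
    convert this using 1
    match_scalars <;> field_simp <;> norm_num
  -- `a = c = d` is odd: the syzygy has the factor `3`, and `[[a, a], a] = 0` is used instead
  · have ha' : b a ∈ (grd k g).gr 1 := ha ▸ hb a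
    have p := insertWord_rel_mem (par := par) (w := u ++ a :: a :: a :: v) h2 hb
      (LieSuperalgebra.bracket_mem (k := k) ha' ha') a (u := u) (v := v) (by simp; omega)
    have e : LieSuperalgebra.bracket (k := k) (LieSuperalgebra.bracket (k := k) (b a) (b a)) (b a)
        = 0 := by
      rw [LieSuperalgebra.skew (k := k) (LieSuperalgebra.bracket_mem (k := k) ha' ha') ha',
        LieSuperalgebra.odd_cube ha']
      simp
    rw [← smul_sub]
    refine D.smul_mem _ ?_
    rw [show (1 : ZMod 2) + 1 = 0 from rfl, koszul_zero_left, one_smul, sbr, e, map_zero,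
      sub_zero] at p
    convert neg_mem p using 1
    simp only [wordRel, ha, koszul_one_one, List.append_assoc, List.cons_append, List.nil_append]
    abel

end Words

/-! ### The Poincaré–Birkhoff–Witt theorem -/

section PBW

variable {Λ : Type*} [LinearOrder Λ]
  {k g : Type*} [Field k] [AddCommGroup g] [Module k g] [LieSuperalgebra k g]
  {b : Module.Basis Λ k g} {par : Λ → ZMod 2}

/-- A word is normal if its letters are weakly increasing and no odd letter is repeated. -/
def IsNormalWord (par : Λ → ZMod 2) (w : List Λ) : Prop :=
  w.Pairwise fun a c => ¬ Descent par a c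

/-- A function on the normal words extends to a linear map on all combinations of words which
vanishes on the relations of `U(g)`: the rewriting rules solve the relation of a descent for its
leading word, and the diamond lemma applies to them. -/
theorem exists_wordNormalForm {M : Type*} [AddCommGroup M] [Module k M] (h2 : (2 : k) ≠ 0)
    (hb : ∀ a, b a ∈ (grd k g).gr (par a)) (φ : List Λ → M) :
    ∃ N : (List Λ →₀ k) →ₗ[k] M,
      (∀ w, IsNormalWord par w → N (Finsupp.single w 1) = φ w) ∧
      ∀ u a c v, N (wordRel b par u a c v) = 0 := by
  let R : List Λ → (List Λ →₀ k) → Prop := fun w r => ∃ u a c v, Descent par a c ∧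
    w = u ++ a :: c :: v ∧
    r = Finsupp.single w 1 - (descentCoeff k a c)⁻¹ • wordRel b par u a c v
  suffices hex : (∀ w r, R w r → ∀ w' ∈ r.support, wordLT w' w) ∧
      ∀ w r r', R w r → R w r' → r - r' ∈ Submodule.span k
        {x | ∃ w' s, wordLT w' w ∧ R w' s ∧ x = Finsupp.single w' 1 - s} by
    obtain ⟨N, h1, hN⟩ := exists_linear_normalForm (wordLT_wf (Λ := Λ)) R hex.1 hex.2 φ
    have hrel (u a c v) (h : Descent par a c) : N (wordRel b par u a c v) = 0 := by
      have := hN _ _ ⟨u, a, c, v, h, rfl, rfl⟩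
      rw [map_sub, map_smul, eq_comm, sub_eq_self] at this
      exact (smul_eq_zero.1 this).resolve_left (inv_ne_zero (descentCoeff_ne_zero h2 a c))
    refine ⟨N, fun w hw => h1 w ?_, fun u a c v => ?_⟩
    · rintro r ⟨u, a, c, v, h, rfl, -⟩
      have := (List.pairwise_append.1 hw).2.1
      exact (List.pairwise_cons.1 this).1 c (by simp) h
    -- any word longer than `u a c v` will do here
    · have hle : relBelow b par (a :: a :: a :: (u ++ v)) ≤ LinearMap.ker N := by
        rw [relBelow, Submodule.span_le]
        rintro _ ⟨u, a, c, v, h, -, rfl⟩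
        exact hrel u a c v h
      exact hle (wordRel_mem_relBelow_of_length h2 hb a c (by simp))
  constructor
  · rintro _ _ ⟨u, a, c, v, h, rfl, rfl⟩ w' hw'
    have hins (w') (h0 : insertWord b u v (sbr k (b a) (b c)) w' ≠ 0) :
        wordLT w' (u ++ a :: c :: v) := by
      refine wordLT_of_length ?_
      rw [length_of_mem_support_insertWord b u v _ (Finsupp.mem_support_iff.2 h0)]
      simp
      omega
    rw [Finsupp.mem_support_iff] at hw'
    rcases h with h | ⟨rfl, h⟩
    · by_cases h0 : insertWord b u v (sbr k (b a) (b c)) w' = 0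
      · have : w' = u ++ c :: a :: v := by
          by_contra hne
          simp [wordRel, descentCoeff, h.ne', h0, Finsupp.single_apply, Ne.symm hne] at hw'
        rw [this]
        exact wordLT_swap h u v
      · exact hins w' h0
    · refine hins w' fun h0 => hw' ?_
      simp only [wordRel, descentCoeff, h, koszul_one_one, if_true, Finsupp.sub_apply,
        Finsupp.smul_apply, h0]
      simp only [neg_smul, one_smul, sub_neg_eq_add, sub_zero, ← two_mul, smul_eq_mul]
      field_simp
      ring
  -- two descents of a word are equal, overlap in one letter, or are disjoint
  · have key : ∀ u a c v u' a' c' v', Descent par a c → Descent par a' c' →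
        u ++ a :: c :: v = u' ++ a' :: c' :: v' → u.length ≤ u'.length →
        (descentCoeff k a c)⁻¹ • wordRel b par u a c v -
          (descentCoeff k a' c')⁻¹ • wordRel b par u' a' c' v' ∈
          relBelow b par (u ++ a :: c :: v) := by
      intro u a c v u' a' c' v' h h' e hl
      obtain ⟨m, rfl⟩ : ∃ m, u' = u ++ m := by
        obtain ⟨m, hm, -⟩ | ⟨m, hm, -⟩ := List.append_eq_append_iff.1 e
        · exact ⟨m, hm⟩
        · have : m = [] := by
            rw [hm] at hl
            simpa using hl
          exact ⟨[], by simp [hm, this]⟩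
      rw [List.append_assoc, List.append_cancel_left_eq] at e
      match m, e with
      | [], e =>
        simp only [List.nil_append, List.cons.injEq] at e
        obtain ⟨rfl, rfl, rfl⟩ := e
        simp
      | [x], e =>
        simp only [List.cons_append, List.nil_append, List.cons.injEq] at e
        obtain ⟨rfl, rfl, rfl⟩ := e
        exact overlap_confluence h2 hb h h' u v'
      | x :: y :: m, e =>
        simp only [List.cons_append, List.cons.injEq] at e
        obtain ⟨rfl, rfl, rfl⟩ := e
        exact disjoint_confluence h2 h h' u m v'
    have hle (w) : relBelow b par w ≤ Submodule.span k
        {x | ∃ w' s, wordLT w' w ∧ R w' s ∧ x = Finsupp.single w' 1 - s} := by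
      rw [relBelow, Submodule.span_le]
      rintro _ ⟨u, a, c, v, h, hl, rfl⟩
      have := Submodule.smul_mem (Submodule.span k
        {x | ∃ w' s, wordLT w' w ∧ R w' s ∧ x = Finsupp.single w' 1 - s}) (descentCoeff k a c)
        (Submodule.subset_span ⟨_, _, hl, ⟨u, a, c, v, h, rfl, rfl⟩, rfl⟩)
      rwa [sub_sub_cancel, smul_inv_smul₀ (descentCoeff_ne_zero h2 a c)] at this
    rintro w _ _ ⟨u, a, c, v, h, e, rfl⟩ ⟨u', a', c', v', h', e', rfl⟩
    refine hle w ?_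
    rw [sub_sub_sub_cancel_left]
    rcases le_total u.length u'.length with hl | hl
    · rw [← neg_sub]
      exact neg_mem (e ▸ key _ _ _ _ _ _ _ _ h h' (e.symm.trans e') hl)
    · exact e' ▸ key _ _ _ _ _ _ _ _ h' h (e'.symm.trans e) hl

theorem mem_span_basis_of_mem_gr (hb : ∀ a, b a ∈ (grd k g).gr (par a)) {i : ZMod 2} {x : g}
    (hx : x ∈ (grd k g).gr i) : x ∈ Submodule.span k {y | ∃ a, par a = i ∧ y = b a} := by
  have : ⊤ ≤ (Submodule.span k {y | ∃ a, par a = i ∧ y = b a}).comap ((grd k g).proj i) := by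
    rw [← b.span_eq, Submodule.span_le]
    rintro _ ⟨a, rfl⟩
    rw [SetLike.mem_coe, Submodule.mem_comap]
    by_cases h : par a = i
    · rw [(grd k g).proj_of_mem (h ▸ hb a)]
      exact Submodule.subset_span ⟨a, h, rfl⟩
    · rw [(grd k g).proj_of_mem_ne (hb a) (Ne.symm h)]
      exact zero_mem _
  have h := this (Submodule.mem_top : x ∈ ⊤)
  rwa [Submodule.mem_comap, (grd k g).proj_of_mem hx] at h

/-- To prove a property of the homogeneous elements of degree `i`, stable under linear combinations,
it is enough to treat the letters of degree `i`. -/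
theorem gr_induction (hb : ∀ a, b a ∈ (grd k g).gr (par a)) {i : ZMod 2} {P : g → Prop}
    (hbas : ∀ a, par a = i → P (b a)) (hz : P 0) (hadd : ∀ x y, P x → P y → P (x + y))
    (hsmul : ∀ (c : k) x, P x → P (c • x)) {x : g} (hx : x ∈ (grd k g).gr i) : P x := by
  refine Submodule.span_induction (p := fun y _ => P y) ?_ hz (fun x y _ _ => hadd x y)
    (fun c x _ => hsmul c x) (mem_span_basis_of_mem_gr hb hx)
  rintro _ ⟨a, h, rfl⟩
  exact hbas a h

/-- The product in `U(g)` of the letters of a word. -/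
def Env.word (b : Module.Basis Λ k g) (w : List Λ) : Env k g :=
  (w.map fun a => Env.ι k (b a)).prod

@[simp] theorem Env.word_nil : Env.word b [] = 1 := rfl

@[simp] theorem Env.word_cons (a : Λ) (w : List Λ) :
    Env.word b (a :: w) = Env.ι k (b a) * Env.word b w := by
  simp [Env.word]

theorem Env.word_append (u w : List Λ) :
    Env.word b (u ++ w) = Env.word b u * Env.word b w := by
  simp [Env.word]

/-- Linear independence of the normal monomials (Poincaré–Birkhoff–Witt): a linear map on `U(g)`
may be prescribed freely on them. -/
theorem Env.exists_linearMap {M : Type*} [AddCommGroup M] [Module k M] (h2 : (2 : k) ≠ 0)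
    (hb : ∀ a, b a ∈ (grd k g).gr (par a)) (φ : List Λ → M) :
    ∃ μ : Env k g →ₗ[k] M, ∀ w, IsNormalWord par w → μ (Env.word b w) = φ w := by
  obtain ⟨N, hN, hrel⟩ := exists_wordNormalForm (b := b) h2 hb φ
  -- `U(g)` acts on the combinations of words modulo relations, a letter acting by prefixing it to
  -- words; the map wanted sends `u` to the value of `N` on the image of the empty word under `u`
  let D : Submodule k (List Λ →₀ k) :=
    Submodule.span k {x | ∃ u a c v, x = wordRel b par u a c v}
  let L : g →ₗ[k] Module.End k (List Λ →₀ k) :=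
    b.constr k fun a => Finsupp.lmapDomain k k (List.cons a)
  have hL (a w) : L (b a) (Finsupp.single w 1) = Finsupp.single (a :: w) 1 := by
    simp [L]
  have hLx (x w) : L x (Finsupp.single w 1) = insertWord b [] w x := by
    suffices h : L.flip (Finsupp.single w 1) = insertWord b [] w from LinearMap.congr_fun h x
    refine b.ext fun a => ?_
    simp [hL]
  have hLi (a u v x) : L (b a) (insertWord b u v x) = insertWord b (a :: u) v x := by
    suffices h : L (b a) ∘ₗ insertWord b u v = insertWord b (a :: u) v from
      LinearMap.congr_fun h x
    refine b.ext fun c => ?_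
    simp [hL]
  have hLr (a u c d v) : L (b a) (wordRel b par u c d v) = wordRel b par (a :: u) c d v := by
    simp only [wordRel, map_sub, map_zsmul, hL, hLi, List.cons_append]
  have hD (x) : D ≤ D.comap (L x) := by
    rw [Submodule.span_le]
    rintro _ ⟨u, c, d, v, rfl⟩
    have : ⊤ ≤ D.comap (L.flip (wordRel b par u c d v)) := by
      rw [← b.span_eq, Submodule.span_le]
      rintro _ ⟨a, rfl⟩
      rw [SetLike.mem_coe, Submodule.mem_comap, LinearMap.flip_apply, hLr]
      exact Submodule.subset_span ⟨_, _, _, _, rfl⟩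
    exact this (Submodule.mem_top : x ∈ ⊤)
  let F : g →ₗ[k] Module.End k ((List Λ →₀ k) ⧸ D) :=
    { toFun := fun x => D.mapQ D (L x) (hD x)
      map_add' := by
        intro x y
        refine Submodule.linearMap_qext _ (LinearMap.ext fun w => ?_)
        simp
      map_smul' := by
        intro c x
        refine Submodule.linearMap_qext _ (LinearMap.ext fun w => ?_)
        simp }
  have hF (x w) : F x (D.mkQ w) = D.mkQ (L x w) := rfl
  have hFrel : ∀ i j, ∀ x ∈ (grd k g).gr i, ∀ y ∈ (grd k g).gr j,
      F x * F y - koszul i j • (F y * F x) = F (sbr k x y) := by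
    intro i j x hx y hy
    refine gr_induction hb (P := fun x => F x * F y - koszul i j • (F y * F x) = F (sbr k x y))
      (fun a ha => ?_) (by simp [sbr]) (fun x x' h h' => ?_) (fun c x h => ?_) hx
    rotate_left
    · simp only [sbr, map_add, LinearMap.add_apply, add_mul, mul_add, smul_add] at h h' ⊢
      rw [← h, ← h']
      abel
    · simp only [sbr, map_smul, LinearMap.smul_apply, smul_mul_assoc, mul_smul_comm] at h ⊢
      rw [← h, smul_sub, smul_comm c]
    refine gr_induction hb (P := fun y => F (b a) * F y - koszul i j • (F y * F (b a)) =
      F (sbr k (b a) y)) (fun c hc => ?_) (by simp) (fun x x' h h' => ?_) (fun c x h => ?_) hy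
    rotate_left
    · simp only [sbr, map_add, add_mul, mul_add, smul_add] at h h' ⊢
      rw [← h, ← h']
      abel
    · simp only [sbr, map_smul, smul_mul_assoc, mul_smul_comm] at h ⊢
      rw [← h, smul_sub, smul_comm c]
    refine Submodule.linearMap_qext _ (Finsupp.lhom_ext' fun w => LinearMap.ext_ring ?_)
    simp only [LinearMap.comp_apply, Finsupp.lsingle_apply, LinearMap.sub_apply,
      LinearMap.smul_apply, Module.End.mul_apply, hF, hL, hLx, ← map_sub, ← map_zsmul]
    rw [← sub_eq_zero, ← map_sub, Submodule.mkQ_apply, Submodule.Quotient.mk_eq_zero]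
    refine Submodule.subset_span ⟨[], a, c, w, ?_⟩
    simp [wordRel, ha, hc]
  have hDN : D ≤ LinearMap.ker N := by
    rw [Submodule.span_le]
    rintro _ ⟨u, a, c, v, rfl⟩
    exact hrel u a c v
  refine ⟨D.liftQ N hDN ∘ₗ LinearMap.applyₗ (D.mkQ (Finsupp.single [] 1)) ∘ₗ
    (Env.lift F hFrel).toLinearMap, fun w hw => ?_⟩
  have hw' : ∀ w, Env.lift F hFrel (Env.word b w) (D.mkQ (Finsupp.single [] 1)) =
      D.mkQ (Finsupp.single w 1) := by
    intro w
    induction w with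
    | nil => simp
    | cons a w ih =>
      rw [Env.word_cons, map_mul, Module.End.mul_apply, ih, Env.lift_ι, hF, hL]
  simp only [LinearMap.comp_apply, LinearMap.applyₗ_apply_apply, AlgHom.toLinearMap_apply, hw']
  rw [← hN w hw]
  exact D.liftQ_apply _ _

end PBW

/-! ### The filtration by degree -/

section Filtration

variable (k g : Type*) [Field k] [AddCommGroup g] [Module k g] [LieSuperalgebra k g]

/-- The span of the products of fewer than `M` elements of `g`, so that `Env.degLT k g 0 = 0` and
`Env.degLT k g 1 = k`. -/
def Env.degLT (M : ℕ) : Submodule k (Env k g) :=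
  Submodule.span k {u | ∃ l : List g, l.length < M ∧ u = (l.map (Env.ι k)).prod}

variable {k g}

theorem Env.prod_mem_degLT {l : List g} {M : ℕ} (h : l.length < M) :
    (l.map (Env.ι k)).prod ∈ Env.degLT k g M :=
  Submodule.subset_span ⟨l, h, rfl⟩

theorem Env.degLT_le_iff {M : ℕ} {S : Submodule k (Env k g)} :
    Env.degLT k g M ≤ S ↔ ∀ l : List g, l.length < M → (l.map (Env.ι k)).prod ∈ S := by
  rw [Env.degLT, Submodule.span_le]
  exact ⟨fun h l hl => h ⟨l, hl, rfl⟩, fun h => by rintro _ ⟨l, hl, rfl⟩; exact h l hl⟩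

theorem Env.degLT_mono {M N : ℕ} (h : M ≤ N) : Env.degLT k g M ≤ Env.degLT k g N :=
  Env.degLT_le_iff.2 fun _ hl => Env.prod_mem_degLT (hl.trans_le h)

theorem Env.mul_mem_degLT {M N P : ℕ} (hP : M + N ≤ P + 1) {u v : Env k g}
    (hu : u ∈ Env.degLT k g M) (hv : v ∈ Env.degLT k g N) : u * v ∈ Env.degLT k g P := by
  have h1 : Env.degLT k g M ≤ (Env.degLT k g P).comap (LinearMap.mulRight k v) := by
    refine Env.degLT_le_iff.2 fun l hl => ?_
    have h2 : Env.degLT k g N ≤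
        (Env.degLT k g P).comap (LinearMap.mulLeft k (l.map (Env.ι k)).prod) := by
      refine Env.degLT_le_iff.2 fun l' hl' => ?_
      rw [Submodule.mem_comap, LinearMap.mulLeft_apply, ← List.prod_append, ← List.map_append]
      exact Env.prod_mem_degLT (by simp; omega)
    exact h2 hv
  exact h1 hu

theorem Env.ι_mem_degLT (x : g) : Env.ι k x ∈ Env.degLT k g 2 := by
  simpa using Env.prod_mem_degLT (k := k) (l := [x]) (M := 2) (by simp)

theorem Env.algebraMap_mem_degLT (c : k) : algebraMap k (Env k g) c ∈ Env.degLT k g 1 := by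
  rw [Algebra.algebraMap_eq_smul_one]
  exact Submodule.smul_mem _ _ (Env.prod_mem_degLT (l := []) (by simp))

theorem Env.exists_mem_degLT (u : Env k g) : ∃ M, u ∈ Env.degLT k g M := by
  refine Env.induction (P := fun u => ∃ M, u ∈ Env.degLT k g M)
    (fun c => ⟨1, Env.algebraMap_mem_degLT c⟩) (fun x => ⟨2, Env.ι_mem_degLT x⟩) ?_ ?_ u
  · rintro u v ⟨M, hM⟩ ⟨N, hN⟩
    exact ⟨M + N, add_mem (Env.degLT_mono (by omega) hM) (Env.degLT_mono (by omega) hN)⟩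
  · rintro u v ⟨M, hM⟩ ⟨N, hN⟩
    exact ⟨M + N, Env.mul_mem_degLT (by omega) hM hN⟩

instance : Nontrivial (Env k g) :=
  (Env.lift (0 : g →ₗ[k] k) (by simp)).toRingHom.domain_nontrivial

/-- In characteristic `p` the commutator with the `p^n`-th power of `y` is the `p^n`-th power of the
commutator with `y`, because left and right multiplication by `y` commute. -/
theorem Env.ι_pow_mul_sub (p : ℕ) [CharP k p] [Fact p.Prime] (n : ℕ) {y : g}
    (hy : y ∈ (grd k g).gr 0) (x : g) :
    ∃ x' : g, Env.ι k y ^ p ^ n * Env.ι k x - Env.ι k x * Env.ι k y ^ p ^ n = Env.ι k x' := by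
  have : CharP (Module.End k (Env k g)) p :=
    charP_of_injective_algebraMap (algebraMap k (Module.End k (Env k g))).injective p
  have hc : Commute (LinearMap.mulLeft k (Env.ι k y)) (LinearMap.mulRight k (Env.ι k y)) :=
    LinearMap.commute_mulLeft_right _ _
  have h1 := sub_pow_char_pow_of_commute p n hc
  have h2 := LinearMap.congr_fun h1 (Env.ι k x)
  rw [LinearMap.pow_mulLeft, LinearMap.pow_mulRight, LinearMap.sub_apply,
    LinearMap.mulLeft_apply, LinearMap.mulRight_apply] at h2
  rw [← h2]
  generalize p ^ n = q
  induction q with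
  | zero => exact ⟨x, by simp⟩
  | succ q ih =>
    obtain ⟨x', hx'⟩ := ih
    refine ⟨sbr k y x', ?_⟩
    rw [pow_succ', Module.End.mul_apply, hx', LinearMap.sub_apply, LinearMap.mulLeft_apply,
      LinearMap.mulRight_apply]
    refine (grd k g).induction (P := fun x' => Env.ι k y * Env.ι k x' - Env.ι k x' * Env.ι k y =
      Env.ι k (sbr k y x')) (fun i v hv => ?_) (fun v w h h' => ?_) x'
    · rw [Env.ι_bracket hy hv, koszul_zero_left, one_smul]
    · simp only [sbr, map_add, mul_add, add_mul] at h h' ⊢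
      rw [← h, ← h']
      abel

/-- In characteristic `p` the commutator with a `p^n`-th power of an even element of `g` does not
raise the degree: `y^(p^n)` acts by the derivation `ad(y)^(p^n)` of `g`. -/
theorem Env.ι_pow_mul_sub_mem (p : ℕ) [CharP k p] [Fact p.Prime] (n : ℕ) {y : g}
    (hy : y ∈ (grd k g).gr 0) {M : ℕ} {u : Env k g} (hu : u ∈ Env.degLT k g M) :
    Env.ι k y ^ p ^ n * u - u * Env.ι k y ^ p ^ n ∈ Env.degLT k g M := by
  set z := Env.ι k y ^ p ^ n with hz
  have h : Env.degLT k g M ≤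
      (Env.degLT k g M).comap (LinearMap.mulLeft k z - LinearMap.mulRight k z) := by
    refine Env.degLT_le_iff.2 fun l hl => Env.degLT_mono hl ?_
    rw [LinearMap.sub_apply, LinearMap.mulLeft_apply, LinearMap.mulRight_apply]
    clear hl
    induction l with
    | nil => simp
    | cons x l ih =>
      obtain ⟨x', hx'⟩ := Env.ι_pow_mul_sub p n hy x
      rw [← hz] at hx'
      have e : z * ((x :: l).map (Env.ι k)).prod - ((x :: l).map (Env.ι k)).prod * z =
          Env.ι k x' * (l.map (Env.ι k)).prod +
          Env.ι k x * (z * (l.map (Env.ι k)).prod - (l.map (Env.ι k)).prod * z) := by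
        rw [← hx', List.map_cons, List.prod_cons]
        noncomm_ring
      rw [e, List.length_cons]
      exact add_mem (Env.mul_mem_degLT (N := l.length + 1) (by omega) (Env.ι_mem_degLT x')
          (Env.prod_mem_degLT (by omega)))
        (Env.mul_mem_degLT (by omega) (Env.ι_mem_degLT x) ih)
  exact h hu

end Filtration

section Spanning

variable {Λ : Type*} [LinearOrder Λ]
  {k g : Type*} [Field k] [AddCommGroup g] [Module k g] [LieSuperalgebra k g]
  {b : Module.Basis Λ k g} {par : Λ → ZMod 2}

theorem Env.word_mem_degLT {w : List Λ} {M : ℕ} (h : w.length < M) :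
    Env.word b w ∈ Env.degLT k g M := by
  have := Env.prod_mem_degLT (k := k) (l := w.map b) (M := M) (by simpa using h)
  simpa [Env.word, Function.comp_def] using this

theorem Env.degLT_le_span_word (M : ℕ) :
    Env.degLT k g M ≤ Submodule.span k {u | ∃ w : List Λ, w.length < M ∧ u = Env.word b w} := by
  refine Env.degLT_le_iff.2 fun l hl => ?_
  suffices h : (l.map (Env.ι k)).prod ∈
      Submodule.span k {u | ∃ w : List Λ, w.length = l.length ∧ u = Env.word b w} by
    refine Submodule.span_mono ?_ h
    rintro _ ⟨w, hw, rfl⟩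
    exact ⟨w, by omega, rfl⟩
  clear hl
  induction l with
  | nil => exact Submodule.subset_span ⟨[], rfl, rfl⟩
  | cons x l ih =>
    rw [List.map_cons, List.prod_cons]
    set T := Submodule.span k
      {u | ∃ w : List Λ, w.length = (x :: l).length ∧ u = Env.word b w} with hT
    have h1 : Submodule.span k {u | ∃ w : List Λ, w.length = l.length ∧ u = Env.word b w} ≤
        T.comap (LinearMap.mulLeft k (Env.ι k x)) := by
      rw [Submodule.span_le]
      rintro _ ⟨w, hw, rfl⟩
      have h2 : ⊤ ≤ T.comap (LinearMap.mulRight k (Env.word b w) ∘ₗ Env.ι k) := by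
        rw [← b.span_eq, Submodule.span_le]
        rintro _ ⟨a, rfl⟩
        exact Submodule.subset_span ⟨a :: w, by simp [hw], by simp⟩
      exact h2 (Submodule.mem_top : x ∈ ⊤)
    exact h1 ih

/-- Up to terms of lower degree, the letters of a word may be permuted. -/
theorem Env.word_perm (hb : ∀ a, b a ∈ (grd k g).gr (par a)) {w w' : List Λ} (h : w.Perm w') :
    ∃ ε : ℤˣ, Env.word b w - (ε : ℤ) • Env.word b w' ∈ Env.degLT k g w.length := by
  induction h with
  | nil => exact ⟨1, by simp⟩
  | @cons a w w' h ih =>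
    obtain ⟨ε, hε⟩ := ih
    refine ⟨ε, ?_⟩
    rw [Env.word_cons, Env.word_cons, ← mul_smul_comm, ← mul_sub]
    exact Env.mul_mem_degLT (by simp; omega) (Env.ι_mem_degLT _) hε
  | swap a c w =>
    refine ⟨⟨koszul (par c) (par a), koszul (par c) (par a), koszul_mul_self _ _,
      koszul_mul_self _ _⟩, ?_⟩
    have := Env.ι_bracket (hb c) (hb a)
    rw [Env.word_cons, Env.word_cons, Env.word_cons, Env.word_cons, ← mul_assoc, ← mul_assoc,
      ← smul_mul_assoc, ← sub_mul, ← this]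
    exact Env.mul_mem_degLT (by simp; omega) (Env.ι_mem_degLT _)
      (Env.word_mem_degLT (Nat.lt_succ_self _))
  | @trans w₁ w₂ w₃ h h' ih ih' =>
    obtain ⟨ε, hε⟩ := ih
    obtain ⟨ε', hε'⟩ := ih'
    refine ⟨ε * ε', ?_⟩
    rw [← h.length_eq] at hε'
    have := add_mem hε (zsmul_mem hε' (ε : ℤ))
    rwa [smul_sub, smul_smul, sub_add_sub_cancel, ← Units.val_mul] at this

theorem exists_perm_of_two_le_count {w : List Λ} {a : Λ} (hw : 2 ≤ w.count a) :
    ∃ w', w.Perm (a :: a :: w') := by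
  have h1 : a ∈ w := List.count_pos_iff.1 (by omega)
  have h3 : a ∈ w.erase a := List.count_pos_iff.1 (by rw [List.count_erase_self]; omega)
  exact ⟨_, (List.perm_cons_erase h1).trans ((List.perm_cons_erase h3).cons a)⟩

/-- The square of an odd letter `a` has degree at most one, because it equals `[a, a] / 2`. -/
theorem Env.word_mem_degLT_of_duplicate (h2 : (2 : k) ≠ 0)
    (hb : ∀ a, b a ∈ (grd k g).gr (par a)) {w w' : List Λ} {a : Λ} (ha : par a = 1)
    (hp : w.Perm (a :: a :: w')) : Env.word b w ∈ Env.degLT k g w.length := by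
  obtain ⟨ε, hε⟩ := Env.word_perm hb hp
  have hl := hp.length_eq
  simp only [List.length_cons] at hl
  have e : Env.word b (a :: a :: w') =
      (2 : k)⁻¹ • (Env.ι k (sbr k (b a) (b a)) * Env.word b w') := by
    rw [Env.ι_bracket (hb a) (hb a), ha, koszul_one_one, neg_smul, one_smul, sub_neg_eq_add,
      ← two_smul k, smul_mul_assoc, inv_smul_smul₀ h2, Env.word_cons, Env.word_cons, mul_assoc]
  have h3 : Env.word b (a :: a :: w') ∈ Env.degLT k g w.length := by
    rw [e]
    exact Submodule.smul_mem _ _ (Env.mul_mem_degLT (N := w'.length + 1) (by omega)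
      (Env.ι_mem_degLT _) (Env.word_mem_degLT (by omega)))
  simpa using add_mem hε (zsmul_mem h3 (ε : ℤ))

/-- A set of words which contains a rearrangement of every word without repeated odd letters spans
`U(g)`, compatibly with the filtration. -/
theorem Env.degLT_le_span_of_perm (h2 : (2 : k) ≠ 0) (hb : ∀ a, b a ∈ (grd k g).gr (par a))
    {S : List Λ → Prop}
    (hS : ∀ w : List Λ, (∀ a, par a = 1 → ∀ w', ¬ w.Perm (a :: a :: w')) →
      ∃ w', w.Perm w' ∧ S w') (M : ℕ) :
    Env.degLT k g M ≤
      Submodule.span k {u | ∃ w : List Λ, S w ∧ w.length < M ∧ u = Env.word b w} := by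
  induction M with
  | zero => exact Env.degLT_le_iff.2 fun l hl => absurd hl (by omega)
  | succ M ih =>
    set T := Submodule.span k {u | ∃ w : List Λ, S w ∧ w.length < M + 1 ∧ u = Env.word b w}
    have hT : Env.degLT k g M ≤ T := ih.trans (Submodule.span_mono (by
      rintro _ ⟨w, h, h', rfl⟩
      exact ⟨w, h, by omega, rfl⟩))
    refine (Env.degLT_le_span_word (b := b) (M + 1)).trans ?_
    rw [Submodule.span_le]
    rintro _ ⟨w, hw, rfl⟩
    by_cases h : ∀ a, par a = 1 → ∀ w', ¬ w.Perm (a :: a :: w')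
    · obtain ⟨w', hp, hw'⟩ := hS w h
      obtain ⟨ε, hε⟩ := Env.word_perm hb hp
      have h3 := hT (Env.degLT_mono (by omega) hε)
      have h4 : Env.word b w' ∈ T :=
        Submodule.subset_span ⟨w', hw', by rw [← hp.length_eq]; exact hw, rfl⟩
      simpa using add_mem h3 (zsmul_mem h4 (ε : ℤ))
    · push Not at h
      obtain ⟨a, ha, w', hc⟩ := h
      exact hT (Env.degLT_mono (by omega) (Env.word_mem_degLT_of_duplicate h2 hb ha hc))

theorem isNormalWord_iff {w : List Λ} :
    IsNormalWord par w ↔ w.Pairwise (· ≤ ·) ∧ ∀ a, par a = 1 → w.count a ≤ 1 := by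
  induction w with
  | nil => simp [IsNormalWord]
  | cons a w ih =>
    rw [IsNormalWord, List.pairwise_cons, ← IsNormalWord, ih, List.pairwise_cons]
    simp only [Descent, not_or, not_and, not_lt]
    constructor
    · rintro ⟨h, hs, hc⟩
      refine ⟨⟨fun c hc => (h c hc).1, hs⟩, fun c hpc => ?_⟩
      rw [List.count_cons]
      split_ifs with hac
      · have hac : a = c := by simpa using hac
        subst hac
        rw [List.count_eq_zero.2 fun hm => (h a hm).2 rfl hpc]
      · exact hc c hpc
    · rintro ⟨⟨h, hs⟩, hc⟩
      refine ⟨fun c hm => ⟨h c hm, ?_⟩, hs, fun c hpc => ?_⟩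
      · rintro rfl hpa
        have := hc a hpa
        rw [List.count_cons_self] at this
        have := List.count_pos_iff.2 hm
        omega
      · have := hc c hpc
        rw [List.count_cons] at this
        omega

theorem exists_perm_isNormalWord {w : List Λ}
    (h : ∀ a, par a = 1 → ∀ w', ¬ w.Perm (a :: a :: w')) :
    ∃ w', w.Perm w' ∧ IsNormalWord par w' :=
  ⟨w.insertionSort (· ≤ ·), (List.perm_insertionSort _ w).symm, isNormalWord_iff.2
    ⟨List.pairwise_insertionSort _ w, fun a ha => by
      rw [(List.perm_insertionSort _ w).count_eq]
      by_contra hc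
      obtain ⟨w', hw'⟩ := exists_perm_of_two_le_count (not_le.1 hc)
      exact h a ha w' hw'⟩⟩

theorem Env.span_normalWord (h2 : (2 : k) ≠ 0) (hb : ∀ a, b a ∈ (grd k g).gr (par a)) :
    Submodule.span k {u | ∃ w : List Λ, IsNormalWord par w ∧ u = Env.word b w} = ⊤ := by
  refine eq_top_iff.2 fun u _ => ?_
  obtain ⟨M, hM⟩ := Env.exists_mem_degLT u
  refine Submodule.span_mono ?_ (Env.degLT_le_span_of_perm h2 hb
    (fun w => exists_perm_isNormalWord) M hM)
  rintro _ ⟨w, h, -, rfl⟩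
  exact ⟨w, h, rfl⟩

end Spanning

/-! ### Bases adapted to a subsuperalgebra and their dual maps -/

section Lift

variable {k g : Type*} [Field k] [AddCommGroup g] [Module k g] [LieSuperalgebra k g]
  {V : Type*} [AddCommGroup V] [Module k V]

/-- The representation of `U(g)` defined by a representation of `g`. -/
def SuperRep.lift (π : SuperRep k g V) : Env k g →ₐ[k] Module.End k V :=
  Env.lift π.act fun _ _ x hx y hy => LinearMap.ext fun v => by
    simpa using (π.act_bracket hx hy v).symm

@[simp] theorem SuperRep.lift_ι (π : SuperRep k g V) (x : g) :
    π.lift (Env.ι k x) = π.act x := by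
  simp [SuperRep.lift]

/-- The map `U(h) → U(g)` defined by the inclusion of a Lie subsuperalgebra. -/
def Env.incl (h : LieSubsuperalgebra k g) : Env k h.toSubmodule →ₐ[k] Env k g :=
  Env.lift (Env.ι k ∘ₗ h.toSubmodule.subtype) fun _ _ _ hx _ hy =>
    (Env.ι_bracket (k := k) (g := g) hx hy).symm

@[simp] theorem Env.incl_ι (h : LieSubsuperalgebra k g) (x : h.toSubmodule) :
    Env.incl h (Env.ι k x) = Env.ι k (x : g) :=
  Env.lift_ι _ _ x

end Lift

section Adapted

variable {k g : Type*} [Field k] [AddCommGroup g] [Module k g] [LieSuperalgebra k g]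

/-- A homogeneous basis of `g` extending a basis of `h`; the letters for `h`, indexed by `κ`,
precede the letters for a complement, indexed by `ι`, so that the normal monomials are products of
a monomial for `h` and a monomial for the complement. -/
structure AdaptedBasis (h : LieSubsuperalgebra k g) (κ ι : Type*) [LinearOrder κ]
    [LinearOrder ι] where
  basis : Module.Basis (κ ⊕ₗ ι) k g
  par : κ ⊕ₗ ι → ZMod 2
  mem : ∀ a, basis a ∈ (grd k g).gr (par a)
  sub : Module.Basis κ k h.toSubmodule
  basis_inl : ∀ a, basis (Sum.inlₗ a) = sub a

theorem SuperGrading.exists_basis {K : Type u} {V : Type v} [Field K] [AddCommGroup V]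
    [Module K V] (G : SuperGrading K V) :
    ∃ (κ : Type v) (b : Module.Basis κ K V) (par : κ → ZMod 2), ∀ a, b a ∈ G.gr (par a) := by
  let b0 := Module.Basis.ofVectorSpace K (G.gr 0)
  let b1 := Module.Basis.ofVectorSpace K (G.gr 1)
  refine ⟨_, (b0.prod b1).map (Submodule.prodEquivOfIsCompl _ _ G.isCompl),
    Sum.elim (fun _ => 0) (fun _ => 1), ?_⟩
  rintro (a | a) <;> simp

theorem LieSubsuperalgebra.exists_adaptedBasis {k : Type u} {g : Type v} [Field k]
    [AddCommGroup g] [Module k g] [LieSuperalgebra k g] (h : LieSubsuperalgebra k g)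
    [FiniteDimensional k (g ⧸ h.toSubmodule)] :
    ∃ (κ ι : Type v) (_ : LinearOrder κ) (_ : LinearOrder ι) (_ : Fintype ι),
      Nonempty (AdaptedBasis h κ ι) := by
  obtain ⟨κ, b, par, hb⟩ := (grd k h.toSubmodule).exists_basis
  obtain ⟨ι, c, par', hc⟩ := (adQuot h).grading.exists_basis
  have hf := Module.Finite.finite_basis c
  classical
  let _ := Fintype.ofFinite ι
  let _ : LinearOrder κ := linearOrderOfSTO WellOrderingRel
  let _ : LinearOrder ι := linearOrderOfSTO WellOrderingRel
  have hc' : ∀ i, ∃ y ∈ (grd k g).gr (par' i), h.toSubmodule.mkQ y = c i := fun i => hc i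
  choose y hy hyc using hc'
  have li : LinearIndependent k (Sum.elim (fun a => (b a : g)) y) := by
    refine LinearIndependent.sumElim_of_quotient b.linearIndependent y ?_
    have : (Submodule.Quotient.mk ∘ y : ι → g ⧸ h.toSubmodule) = c := funext hyc
    rw [this]
    exact c.linearIndependent
  have sp : ⊤ ≤ Submodule.span k (Set.range (Sum.elim (fun a => (b a : g)) y)) := by
    rw [Set.Sum.elim_range, Submodule.span_union]
    have e1 : Submodule.span k (Set.range fun a => (b a : g)) = h.toSubmodule := by
      have := congrArg (Submodule.map h.toSubmodule.subtype) b.span_eq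
      rwa [Submodule.map_span, Submodule.map_top, Submodule.range_subtype, ← Set.range_comp]
        at this
    have e2 : (Submodule.span k (Set.range y)).map h.toSubmodule.mkQ = ⊤ := by
      rw [Submodule.map_span, ← Set.range_comp]
      have : (h.toSubmodule.mkQ ∘ y : ι → g ⧸ h.toSubmodule) = c := funext hyc
      rw [this, c.span_eq]
    intro x _
    have hx : h.toSubmodule.mkQ x ∈ (Submodule.span k (Set.range y)).map h.toSubmodule.mkQ := by
      rw [e2]; exact Submodule.mem_top
    obtain ⟨z, hz, hzx⟩ := hx
    have : x - z ∈ h.toSubmodule := (Submodule.Quotient.eq _).1 hzx.symm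
    rw [e1, ← sub_add_cancel x z]
    exact Submodule.add_mem_sup this hz
  have hmem : ∀ a, (Module.Basis.mk li sp).reindex toLex a ∈
      (grd k g).gr (Sum.elim par par' (ofLex a)) := by
    intro a
    induction a using Lex.rec with
    | _ a =>
    rcases a with a | a
    · simpa using (show (b a : g) ∈ (grd k g).gr (par a) from hb a)
    · simpa using hy a
  refine ⟨κ, ι, inferInstance, inferInstance, inferInstance, ⟨{
    basis := (Module.Basis.mk li sp).reindex toLex
    par := fun a => Sum.elim par par' (ofLex a)
    mem := hmem
    sub := b
    basis_inl := fun a => by simp [Sum.inlₗ] }⟩⟩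

end Adapted

section SplitWords

variable {κ ι : Type*}

/-- The letters of the first kind in a word. -/
def leftPart : List (κ ⊕ₗ ι) → List κ := List.filterMap fun a => Sum.getLeft? (ofLex a)

/-- The letters of the second kind in a word. -/
def rightPart : List (κ ⊕ₗ ι) → List ι := List.filterMap fun a => Sum.getRight? (ofLex a)

theorem leftPart_append_map (u : List κ) (s : List ι) :
    leftPart (u.map Sum.inlₗ ++ s.map Sum.inrₗ) = u := by
  simp [leftPart, List.filterMap_map, Function.comp_def, Sum.inlₗ, Sum.inrₗ]

theorem rightPart_append_map (u : List κ) (s : List ι) :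
    rightPart (u.map Sum.inlₗ ++ s.map Sum.inrₗ) = s := by
  simp [rightPart, List.filterMap_map, Function.comp_def, Sum.inlₗ, Sum.inrₗ]

theorem perm_leftPart_append_rightPart (w : List (κ ⊕ₗ ι)) :
    w.Perm ((leftPart w).map Sum.inlₗ ++ (rightPart w).map Sum.inrₗ) := by
  induction w with
  | nil => simp [leftPart, rightPart]
  | cons a w ih =>
    induction a using Lex.rec with
    | _ a =>
    rcases a with a | a
    · exact ih.cons _
    · exact (ih.cons _).trans List.perm_middle.symm

variable [LinearOrder κ] [LinearOrder ι] {par : κ ⊕ₗ ι → ZMod 2}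

theorem exists_perm_normal_append {w : List (κ ⊕ₗ ι)}
    (h : ∀ a, par a = 1 → ∀ w', ¬ w.Perm (a :: a :: w')) :
    ∃ u s, IsNormalWord (par ∘ Sum.inlₗ) u ∧ IsNormalWord (par ∘ Sum.inrₗ) s ∧
      w.Perm (u.map Sum.inlₗ ++ s.map Sum.inrₗ) := by
  have hp := perm_leftPart_append_rightPart w
  obtain ⟨u, hu, hu'⟩ := exists_perm_isNormalWord (par := par ∘ Sum.inlₗ) (w := leftPart w) (by
    intro a ha w' hw'
    refine h _ ha (w'.map Sum.inlₗ ++ (rightPart w).map Sum.inrₗ) (hp.trans ?_)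
    exact (hw'.map Sum.inlₗ).append_right _)
  obtain ⟨s, hs, hs'⟩ := exists_perm_isNormalWord (par := par ∘ Sum.inrₗ) (w := rightPart w) (by
    intro a ha w' hw'
    refine h _ ha ((leftPart w).map Sum.inlₗ ++ w'.map Sum.inrₗ) (hp.trans ?_)
    refine ((hw'.map Sum.inrₗ).append_left _).trans ?_
    exact List.perm_middle.trans (List.perm_middle.cons _))
  exact ⟨u, s, hu', hs', hp.trans ((hu.map _).append (hs.map _))⟩

theorem isNormalWord_append_map {u : List κ} {s : List ι}
    (hu : IsNormalWord (par ∘ Sum.inlₗ) u) (hs : IsNormalWord (par ∘ Sum.inrₗ) s) :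
    IsNormalWord par (u.map Sum.inlₗ ++ s.map Sum.inrₗ) := by
  refine List.pairwise_append.2 ⟨List.pairwise_map.2 (hu.imp ?_), List.pairwise_map.2 (hs.imp ?_),
    ?_⟩
  · intro a c hac
    simpa [Descent, Sum.inlₗ] using hac
  · intro a c hac
    simpa [Descent, Sum.inrₗ] using hac
  · intro x hx y hy
    obtain ⟨a, -, rfl⟩ := List.mem_map.1 hx
    obtain ⟨c, -, rfl⟩ := List.mem_map.1 hy
    simp [Descent, Sum.inlₗ, Sum.inrₗ]

end SplitWords

namespace AdaptedBasis

variable {k g : Type*} [Field k] [AddCommGroup g] [Module k g] [LieSuperalgebra k g]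
  {h : LieSubsuperalgebra k g} {κ ι : Type*} [LinearOrder κ] [LinearOrder ι]
  (B : AdaptedBasis h κ ι)

/-- The monomial in the chosen basis of a complement of `h` given by a word. -/
def mon (s : List ι) : Env k g := Env.word B.basis (s.map Sum.inrₗ)

theorem sub_mem (a : κ) : B.sub a ∈ (grd k h.toSubmodule).gr ((B.par ∘ Sum.inlₗ) a) := by
  have := B.mem (Sum.inlₗ a)
  rw [B.basis_inl] at this
  exact this

theorem word_inl (u : List κ) :
    Env.word B.basis (u.map Sum.inlₗ) = Env.incl h (Env.word B.sub u) := by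
  induction u with
  | nil => simp
  | cons a u ih => simp [ih, B.basis_inl]

theorem word_append_map (u : List κ) (s : List ι) :
    Env.word B.basis (u.map Sum.inlₗ ++ s.map Sum.inrₗ) =
      Env.incl h (Env.word B.sub u) * B.mon s := by
  rw [Env.word_append, word_inl, mon]

/-- A word in the letters for the complement is normal if it is weakly increasing and no odd letter
is repeated. -/
abbrev Normal (s : List ι) : Prop := IsNormalWord (B.par ∘ Sum.inrₗ) s

theorem degLT_le_span_mul_mon (h2 : (2 : k) ≠ 0) (M : ℕ) :
    Env.degLT k g M ≤ Submodule.span k {x | ∃ (u : List κ) (s : List ι), B.Normal s ∧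
      u.length + s.length < M ∧ x = Env.incl h (Env.word B.sub u) * B.mon s} := by
  refine (Env.degLT_le_span_of_perm h2 B.mem (S := fun w => ∃ (u : List κ) (s : List ι),
    B.Normal s ∧ w = u.map Sum.inlₗ ++ s.map Sum.inrₗ) (fun w hw => ?_) M).trans
    (Submodule.span_mono ?_)
  · obtain ⟨u, s, -, hs, hp⟩ := exists_perm_normal_append hw
    exact ⟨_, hp, u, s, hs, rfl⟩
  · rintro _ ⟨_, ⟨u, s, hs, rfl⟩, hl, rfl⟩
    exact ⟨u, s, hs, by simpa using hl, B.word_append_map u s⟩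

/-- The normal monomials in the complement also generate `U(g)` as a right `U(h)`-module. -/
theorem exists_sum_mon_mul (h2 : (2 : k) ≠ 0) (x : Env k g) :
    ∃ c : List ι →₀ Env k h.toSubmodule, (∀ s ∈ c.support, B.Normal s) ∧
      x = c.sum fun s c => B.mon s * Env.incl h c := by
  classical
  obtain ⟨M, hM⟩ := Env.exists_mem_degLT x
  have hx := Env.degLT_le_span_of_perm h2 B.mem (S := fun w => ∃ (u : List κ) (s : List ι),
    B.Normal s ∧ w = s.map Sum.inrₗ ++ u.map Sum.inlₗ) (fun w hw => by
      obtain ⟨u, s, -, hs, hp⟩ := exists_perm_normal_append hw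
      exact ⟨_, hp.trans List.perm_append_comm, u, s, hs, rfl⟩) M hM
  clear hM
  induction hx using Submodule.span_induction with
  | mem x hx =>
    obtain ⟨_, ⟨u, s, hs, rfl⟩, hl, rfl⟩ := hx
    refine ⟨Finsupp.single s (Env.word B.sub u), fun t ht => ?_, ?_⟩
    · rw [Finset.mem_singleton.1 (Finsupp.support_single_subset ht)]
      exact hs
    · rw [Finsupp.sum_single_index (by simp), Env.word_append, word_inl, mon]
  | zero => exact ⟨0, by simp, by simp⟩
  | add x y _ _ hx hy =>
    obtain ⟨c, hc, rfl⟩ := hx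
    obtain ⟨d, hd, rfl⟩ := hy
    refine ⟨c + d, fun s hs => ?_, ?_⟩
    · exact (Finset.mem_union.1 (Finsupp.support_add hs)).elim (hc s) (hd s)
    · rw [Finsupp.sum_add_index' (by simp) (by simp [mul_add])]
  | smul a x _ hx =>
    obtain ⟨c, hc, rfl⟩ := hx
    refine ⟨a • c, fun s hs => hc s (Finsupp.support_smul hs), ?_⟩
    rw [Finsupp.sum_smul_index' (by simp), Finsupp.smul_sum]
    simp

variable {V : Type*} [AddCommGroup V] [Module k V] (π : SuperRep k h.toSubmodule V)

/-- `E` is the left `U(h)`-linear map `U(g) → End V` which is the identity on the monomial `T` and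
`0` on the other normal monomials in the letters for the complement. -/
def IsDual (T : List ι) (E : Env k g →ₗ[k] Module.End k V) : Prop :=
  ∀ s, B.Normal s → ∀ c, E (Env.incl h c * B.mon s) = if s = T then π.lift c else 0

theorem exists_isDual (h2 : (2 : k) ≠ 0) (T : List ι) : ∃ E, B.IsDual π T E := by
  obtain ⟨E, hE⟩ := Env.exists_linearMap h2 B.mem fun w =>
    if rightPart w = T then π.lift (Env.word B.sub (leftPart w)) else 0
  refine ⟨E, fun s hs c => ?_⟩
  have hc : c ∈ Submodule.span k {u | ∃ w : List κ, IsNormalWord (B.par ∘ Sum.inlₗ) w ∧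
      u = Env.word B.sub w} := by
    rw [Env.span_normalWord h2 B.sub_mem]
    exact Submodule.mem_top
  induction hc using Submodule.span_induction with
  | mem c hc =>
    obtain ⟨w, hw, rfl⟩ := hc
    rw [← B.word_append_map, hE _ (isNormalWord_append_map hw hs), rightPart_append_map,
      leftPart_append_map]
  | zero => simp
  | add c d _ _ hc hd =>
    rw [map_add, add_mul, map_add, hc, hd, map_add]
    split_ifs <;> simp
  | smul a c _ hc =>
    rw [map_smul, smul_mul_assoc, map_smul, hc, map_smul]
    split_ifs <;> simp

variable {π B} {T : List ι} {E : Env k g →ₗ[k] Module.End k V}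

theorem IsDual.apply_incl_mul (hE : B.IsDual π T E) (h2 : (2 : k) ≠ 0)
    (c : Env k h.toSubmodule) (u : Env k g) : E (Env.incl h c * u) = π.lift c * E u := by
  obtain ⟨M, hM⟩ := Env.exists_mem_degLT u
  have := B.degLT_le_span_mul_mon h2 M hM
  clear hM
  induction this using Submodule.span_induction with
  | mem u hu =>
    obtain ⟨w, s, hs, -, rfl⟩ := hu
    rw [← mul_assoc, ← map_mul, hE s hs, hE s hs, map_mul]
    split_ifs <;> simp
  | zero => simp
  | add u v _ _ hu hv => rw [mul_add, map_add, map_add, hu, hv, mul_add]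
  | smul a u _ hu => rw [mul_smul_comm, map_smul, map_smul, hu, mul_smul_comm]

theorem IsDual.apply_eq_zero_of_mem_degLT (hE : B.IsDual π T E) (h2 : (2 : k) ≠ 0)
    {u : Env k g} (hu : u ∈ Env.degLT k g T.length) : E u = 0 := by
  suffices hle : Submodule.span k {x | ∃ (u : List κ) (s : List ι), B.Normal s ∧
      u.length + s.length < T.length ∧ x = Env.incl h (Env.word B.sub u) * B.mon s} ≤
      LinearMap.ker E from hle (B.degLT_le_span_mul_mon h2 _ hu)
  rw [Submodule.span_le]
  rintro _ ⟨w, s, hs, hl, rfl⟩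
  rw [SetLike.mem_coe, LinearMap.mem_ker, hE s hs, if_neg]
  rintro rfl
  omega

/-- In degree at most that of `T`, the map `E` only sees the rearrangements of `T`. -/
theorem IsDual.apply_word_of_not_perm (hE : B.IsDual π T E) (h2 : (2 : k) ≠ 0)
    {w : List (κ ⊕ₗ ι)} (hl : w.length ≤ T.length) (hw : ¬ w.Perm (T.map Sum.inrₗ)) :
    E (Env.word B.basis w) = 0 := by
  by_cases hd : ∀ a, B.par a = 1 → ∀ w', ¬ w.Perm (a :: a :: w')
  · obtain ⟨u, s, -, hs, hp⟩ := exists_perm_normal_append hd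
    obtain ⟨ε, hε⟩ := Env.word_perm B.mem hp
    have h1 := hE.apply_eq_zero_of_mem_degLT h2 (Env.degLT_mono hl hε)
    rw [map_sub, map_zsmul, B.word_append_map, hE s hs, if_neg, smul_zero, sub_zero] at h1
    · exact h1
    · rintro rfl
      have := hp.length_eq
      simp only [List.length_append, List.length_map] at this
      obtain rfl : u = [] := List.length_eq_zero_iff.1 (by omega)
      exact hw hp
  · push Not at hd
    obtain ⟨a, ha, w', hp⟩ := hd
    exact hE.apply_eq_zero_of_mem_degLT h2
      (Env.degLT_mono hl (Env.word_mem_degLT_of_duplicate h2 B.mem ha hp))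

theorem IsDual.apply_mon_self (hE : B.IsDual π T E) (hT : B.Normal T) : E (B.mon T) = 1 := by
  simpa using hE T hT 1

theorem IsDual.apply_mon_of_perm (hE : B.IsDual π T E) (h2 : (2 : k) ≠ 0) (hT : B.Normal T)
    {s : List ι} (hp : s.Perm T) : ∃ ε : ℤˣ, E (B.mon s) = (ε : ℤ) • 1 := by
  obtain ⟨ε, hε⟩ := Env.word_perm B.mem (hp.map Sum.inrₗ)
  refine ⟨ε, ?_⟩
  have h1 := hE.apply_eq_zero_of_mem_degLT h2 (Env.degLT_mono (by simp [hp.length_eq]) hε)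
  rw [map_sub, map_zsmul, sub_eq_zero] at h1
  rw [← hE.apply_mon_self hT]
  exact h1

end AdaptedBasis

/-! ### Twists, the supertrace, and the top monomial -/

section Twist

variable {k h V : Type*} [Field k] [AddCommGroup h] [Module k h] [LieSuperalgebra k h]
  [AddCommGroup V] [Module k V]

/-- The representation `H ↦ (-1)^{j|H|} π(H) + χ(H)`, for a character `χ` and a parity `j`. Up to a
change of parity it is `k_χ ⊗ π`; it is realised on the same superspace as `π`. -/
def SuperRep.twist (π : SuperRep k h V) (χ : Character k h) (j : ZMod 2) : SuperRep k h V where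
  grading := π.grading
  act := π.act ∘ₗ (grd k h).sgn j + χ.toFun.smulRight LinearMap.id
  act_mem := by
    intro i l x v hx hv
    simp only [LinearMap.add_apply, LinearMap.comp_apply, (grd k h).sgn_of_mem j hx, map_zsmul,
      LinearMap.smul_apply, LinearMap.smulRight_apply, LinearMap.id_apply]
    refine add_mem (zsmul_mem (π.act_mem hx hv) _) ?_
    rcases zmod_two_eq i with rfl | rfl
    · rw [zero_add]
      exact Submodule.smul_mem _ _ hv
    · simp [χ.map_odd x hx]
  act_bracket := by
    intro i l x y hx hy v
    simp only [LinearMap.add_apply, LinearMap.comp_apply, (grd k h).sgn_of_mem j hx,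
      (grd k h).sgn_of_mem j hy, (grd k h).sgn_of_mem j (LieSuperalgebra.bracket_mem hx hy),
      map_zsmul, LinearMap.smul_apply, LinearMap.smulRight_apply, LinearMap.id_apply,
      χ.map_bracket, π.act_bracket hx hy, map_add, map_smul, zero_smul, add_zero,
      koszul_add_right]
    rcases zmod_two_eq i with rfl | rfl
    · simp only [koszul_zero_left, koszul_zero_right]
      module
    · rcases zmod_two_eq l with rfl | rfl
      · simp only [koszul_zero_right, χ.map_odd x hx]
        module
      · simp only [χ.map_odd x hx, χ.map_odd y hy]
        module

theorem SuperRep.twist_act (π : SuperRep k h V) (χ : Character k h) (j : ZMod 2) {i : ZMod 2}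
    {x : h} (hx : x ∈ (grd k h).gr i) :
    (π.twist χ j).act x = koszul j i • π.act x + χ.toFun x • 1 := by
  ext v
  simp [SuperRep.twist, (grd k h).sgn_of_mem j hx]

end Twist

section SortedLists

variable {ι : Type*} [LinearOrder ι]

/-- Equal letters of a sorted word are adjacent. -/
theorem exists_append_replicate_of_le_count {s : List ι} (hs : s.Pairwise (· ≤ ·)) {i : ι}
    {q : ℕ} (hq : q ≤ s.count i) : ∃ s₁ s₂, s = s₁ ++ (List.replicate q i ++ s₂) := by
  have head : ∀ (s : List ι) (q : ℕ), (i :: s).Pairwise (· ≤ ·) → q ≤ (i :: s).count i →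
      ∃ s₂, i :: s = List.replicate q i ++ s₂ := by
    intro s
    induction s with
    | nil =>
      intro q _ hq
      rw [List.count_singleton_self] at hq
      interval_cases q
      · exact ⟨[i], rfl⟩
      · exact ⟨[], rfl⟩
    | cons d s ih =>
      intro q hs hq
      cases q with
      | zero => exact ⟨_, rfl⟩
      | succ q =>
        rw [List.count_cons_self, Nat.add_le_add_iff_right] at hq
        rw [List.pairwise_cons] at hs
        by_cases hd : d = i
        · subst hd
          obtain ⟨s₂, h⟩ := ih q hs.2 hq
          exact ⟨s₂, by rw [h]; rfl⟩
        · have : i ∉ d :: s := by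
            intro hm
            rcases List.mem_cons.1 hm with h | h
            · exact hd h.symm
            · exact hd (le_antisymm ((List.pairwise_cons.1 hs.2).1 i h) (hs.1 d (by simp)))
          rw [List.count_eq_zero.2 this] at hq
          obtain rfl : q = 0 := by omega
          exact ⟨d :: s, rfl⟩
  induction s with
  | nil =>
    obtain rfl : q = 0 := by simpa using hq
    exact ⟨[], [], rfl⟩
  | cons a s ih =>
    by_cases ha : a = i
    · subst ha
      obtain ⟨s₂, h⟩ := head s q hs hq
      exact ⟨[], s₂, h⟩
    · rw [List.count_cons_of_ne ha] at hq
      obtain ⟨s₁, s₂, h⟩ := ih (List.pairwise_cons.1 hs).2 hq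
      exact ⟨a :: s₁, s₂, by rw [h]; rfl⟩

end SortedLists

namespace AdaptedBasis

variable {k g : Type*} [Field k] [AddCommGroup g] [Module k g] [LieSuperalgebra k g]
  {h : LieSubsuperalgebra k g} {κ ι : Type*} [LinearOrder κ] [LinearOrder ι]
  (B : AdaptedBasis h κ ι)

theorem Normal.eq_of_perm {B : AdaptedBasis h κ ι} {s t : List ι} (hs : B.Normal s)
    (ht : B.Normal t) (hp : s.Perm t) : s = t :=
  hp.eq_of_pairwise (fun _ _ _ _ => le_antisymm) (isNormalWord_iff.1 hs).1
    (isNormalWord_iff.1 ht).1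

/-- A power of an even basis element may be inserted at some place of a normal monomial. -/
theorem Normal.exists_insert {B : AdaptedBasis h κ ι} {s : List ι} (hs : B.Normal s) {i : ι}
    (hi : B.par (Sum.inrₗ i) = 0) (q : ℕ) :
    ∃ s₁ s₂, s = s₁ ++ s₂ ∧ B.Normal (s₁ ++ (List.replicate q i ++ s₂)) := by
  rw [Normal, isNormalWord_iff] at hs
  obtain ⟨r, hr⟩ : ∃ r, r = (s ++ List.replicate q i).insertionSort (· ≤ ·) := ⟨_, rfl⟩
  have hp : r.Perm (s ++ List.replicate q i) := hr ▸ List.perm_insertionSort _ _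
  have hsort : r.Pairwise (· ≤ ·) := hr ▸ List.pairwise_insertionSort _ _
  obtain ⟨s₁, s₂, rfl⟩ := exists_append_replicate_of_le_count (i := i) (q := q) hsort (by
    rw [hp.count_eq]
    simp)
  have hsub : List.Sublist (s₁ ++ s₂) (s₁ ++ (List.replicate q i ++ s₂)) :=
    (List.sublist_append_right _ _).append_left _
  refine ⟨s₁, s₂, ?_, isNormalWord_iff.2 ⟨hsort, fun a ha => ?_⟩⟩
  · refine List.Perm.eq_of_pairwise (fun _ _ _ _ => le_antisymm) hs.1
      (hsort.sublist hsub) ?_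
    have h1 : (s₁ ++ (List.replicate q i ++ s₂)).Perm (List.replicate q i ++ (s₁ ++ s₂)) := by
      simpa using (List.perm_append_comm (l₁ := s₁) (l₂ := List.replicate q i)).append_right s₂
    exact (List.perm_append_left_iff _).1
      ((List.perm_append_comm.trans hp.symm).trans h1)
  · rw [hp.count_eq, List.count_append, List.count_eq_zero (l := List.replicate q i) |>.2]
    · exact hs.2 a ha
    · intro hm
      rw [List.eq_of_mem_replicate hm, Function.comp_apply, hi] at ha
      exact absurd ha (by decide)

theorem mon_append (s t : List ι) : B.mon (s ++ t) = B.mon s * B.mon t := by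
  simp [mon, Env.word_append]

theorem mon_cons (a : ι) (t : List ι) :
    B.mon (a :: t) = Env.ι k (B.basis (Sum.inrₗ a)) * B.mon t := by
  simp [mon]

@[simp] theorem mon_nil : B.mon [] = 1 := rfl

theorem mon_replicate (q : ℕ) (a : ι) :
    B.mon (List.replicate q a) = Env.ι k (B.basis (Sum.inrₗ a)) ^ q := by
  simp [mon, Env.word]

theorem mon_mem_degLT {s : List ι} {M : ℕ} (hs : s.length < M) : B.mon s ∈ Env.degLT k g M :=
  Env.word_mem_degLT (by simpa using hs)

/-- A homogeneous element only involves letters of its own degree. -/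
theorem repr_eq_zero {i : ZMod 2} {x : g} (hx : x ∈ (grd k g).gr i) {l : κ ⊕ₗ ι}
    (hl : B.par l ≠ i) : B.basis.repr x l = 0 := by
  refine gr_induction B.mem (P := fun x => B.basis.repr x l = 0) (fun a ha => ?_) (by simp)
    (fun x y hx hy => by simp [hx, hy]) (fun c x hx => by simp [hx]) hx
  rw [Module.Basis.repr_self, Finsupp.single_eq_of_ne]
  rintro rfl
  exact hl ha

section Quotient

variable [Fintype ι]

theorem repr_inr_of_mem {x : g} (hx : x ∈ h.toSubmodule) (a : ι) :
    B.basis.repr x (Sum.inrₗ a) = 0 := by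
  have : ⊤ ≤ LinearMap.ker (B.basis.coord (Sum.inrₗ a) ∘ₗ h.toSubmodule.subtype) := by
    rw [← B.sub.span_eq, Submodule.span_le]
    rintro _ ⟨c, rfl⟩
    simp only [SetLike.mem_coe, LinearMap.mem_ker, LinearMap.comp_apply,
      Submodule.subtype_apply, ← B.basis_inl, Module.Basis.coord_apply, Module.Basis.repr_self]
    exact Finsupp.single_eq_of_ne (by simp [Sum.inlₗ, Sum.inrₗ])
  exact this (Submodule.mem_top : (⟨x, hx⟩ : h.toSubmodule) ∈ ⊤)

/-- The basis of `g / h` given by the letters for a complement of `h`. -/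
def quotBasis : Module.Basis ι k (g ⧸ h.toSubmodule) :=
  Module.Basis.ofEquivFun (LinearEquiv.ofLinearMap
    (h.toSubmodule.liftQ (LinearMap.pi fun a => B.basis.coord (Sum.inrₗ a)) (fun x hx => by
      rw [LinearMap.mem_ker]
      ext a
      exact B.repr_inr_of_mem hx a))
    (Fintype.linearCombination k fun a => h.toSubmodule.mkQ (B.basis (Sum.inrₗ a)))
    (by
      classical
      refine LinearMap.pi_ext' fun a => LinearMap.ext_ring ?_
      ext c
      simp [Fintype.linearCombination_apply, Pi.single_apply, Finsupp.single_apply, eq_comm])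
    (by
      classical
      refine Submodule.linearMap_qext _ (B.basis.ext fun l => ?_)
      induction l using Lex.rec with
      | _ l =>
      rcases l with l | l
      · have e := B.basis_inl l
        simp only [Sum.inlₗ] at e
        have : h.toSubmodule.mkQ (B.basis (toLex (Sum.inl l))) = 0 := by
          rw [e]
          simp
        simp only [LinearMap.comp_apply, this, map_zero]
      · simp [Fintype.linearCombination_apply, Finsupp.single_apply, Sum.inrₗ]))

theorem quotBasis_repr (x : g) (a : ι) :
    B.quotBasis.repr (h.toSubmodule.mkQ x) a = B.basis.repr x (Sum.inrₗ a) := rfl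

theorem quotBasis_apply (a : ι) :
    B.quotBasis a = h.toSubmodule.mkQ (B.basis (Sum.inrₗ a)) := by
  classical
  simp [quotBasis, Fintype.linearCombination_apply, Pi.single_apply]

/-- The supertrace of `ad(H)` on `g / h` in coordinates. -/
theorem strad_apply {H : h.toSubmodule} (hH : H ∈ (grd k h.toSubmodule).gr 0) :
    (strad h).toFun H = ∑ a, (if B.par (Sum.inrₗ a) = 0 then 1 else -1) *
      B.basis.repr (sbr k (H : g) (B.basis (Sum.inrₗ a))) (Sum.inrₗ a) := by
  classical
  have tr (j : ZMod 2) : LinearMap.trace k _ ((adQuot h).grading.proj j * (adQuot h).act H) =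
      ∑ a, if B.par (Sum.inrₗ a) = j then
        B.basis.repr (sbr k (H : g) (B.basis (Sum.inrₗ a))) (Sum.inrₗ a) else 0 := by
    rw [LinearMap.trace_eq_matrix_trace k B.quotBasis, Matrix.trace]
    refine Finset.sum_congr rfl fun a _ => ?_
    rw [Matrix.diag_apply, LinearMap.toMatrix_apply, Module.End.mul_apply, quotBasis_apply]
    have hq : h.toSubmodule.mkQ (B.basis (Sum.inrₗ a)) ∈
        (adQuot h).grading.gr (B.par (Sum.inrₗ a)) := ⟨_, B.mem _, rfl⟩
    have hm := (adQuot h).act_mem hH hq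
    rw [zero_add] at hm
    split_ifs with hj
    · rw [← hj, (adQuot h).grading.proj_of_mem hm]
      exact B.quotBasis_repr _ a
    · rw [(adQuot h).grading.proj_of_mem_ne hm (Ne.symm hj), map_zero, Finsupp.zero_apply]
  have e : (strad h).toFun H = LinearMap.trace k _ ((adQuot h).grading.proj 0 * (adQuot h).act H) -
    LinearMap.trace k _ ((adQuot h).grading.proj 1 * (adQuot h).act H) := rfl
  rw [e, tr, tr, ← Finset.sum_sub_distrib]
  refine Finset.sum_congr rfl fun a _ => ?_
  rcases zmod_two_eq (B.par (Sum.inrₗ a)) with h | h <;> simp [h]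

end Quotient

section Top

variable [Fintype ι]

/-- The sorted word in which each even letter occurs `q - 1` times and each odd letter once; for
`q ≥ 1` it is the largest normal word in which no even letter occurs `q` times. -/
def top (q : ℕ) : List ι :=
  (∑ i, Multiset.replicate (if B.par (Sum.inrₗ i) = 0 then q - 1 else 1) i).sort (· ≤ ·)

theorem count_top (q : ℕ) (i : ι) :
    (B.top q).count i = if B.par (Sum.inrₗ i) = 0 then q - 1 else 1 := by
  rw [← Multiset.coe_count, top, Multiset.sort_eq, Multiset.count_sum']
  simp [Multiset.count_replicate]

theorem normal_top (q : ℕ) : B.Normal (B.top q) := by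
  rw [Normal, isNormalWord_iff]
  refine ⟨Multiset.pairwise_sort _ _, fun a ha => ?_⟩
  rw [count_top, if_neg]
  rw [← Function.comp_apply (f := B.par), ha]
  decide

/-- A normal monomial of degree less than `q` divides the top monomial. -/
theorem exists_append_perm_top {s : List ι} {q : ℕ} (hs : B.Normal s) (hq : s.length < q) :
    ∃ t, (t ++ s).Perm (B.top q) := by
  have hle : (s : Multiset ι) ≤ (B.top q : Multiset ι) := by
    rw [Multiset.le_iff_count]
    intro a
    rw [Multiset.coe_count, Multiset.coe_count, count_top]
    split_ifs with ha
    · have := List.count_le_length (a := a) (l := s)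
      omega
    · exact (isNormalWord_iff.1 hs).2 a ((zmod_two_eq _).resolve_left ha)
  refine ⟨((B.top q : Multiset ι) - (s : Multiset ι)).toList, ?_⟩
  rw [← Multiset.coe_eq_coe, ← Multiset.coe_add, Multiset.coe_toList, tsub_add_cancel_of_le hle]

/-- A normal monomial other than the top one, and of at least its degree, contains the `q`-th power
of an even letter. -/
theorem exists_le_count_of_ne_top {s : List ι} {q : ℕ} (hs : B.Normal s) (hne : s ≠ B.top q)
    (hl : (B.top q).length ≤ s.length) : ∃ i, B.par (Sum.inrₗ i) = 0 ∧ q ≤ s.count i := by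
  by_contra! hc
  have hle : (s : Multiset ι) ≤ (B.top q : Multiset ι) := by
    rw [Multiset.le_iff_count]
    intro a
    rw [Multiset.coe_count, Multiset.coe_count, count_top]
    split_ifs with ha
    · have := hc a ha
      omega
    · exact (isNormalWord_iff.1 hs).2 a ((zmod_two_eq _).resolve_left ha)
  refine hne (hs.eq_of_perm (B.normal_top q) (Multiset.coe_eq_coe.1 ?_))
  exact Multiset.eq_of_le_of_card_le hle (by simpa using hl)

end Top

end AdaptedBasis

/-! ### Right multiplication by the subalgebra -/

namespace AdaptedBasis

variable {k g : Type*} [Field k] [AddCommGroup g] [Module k g] [LieSuperalgebra k g]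
  {h : LieSubsuperalgebra k g} {κ ι : Type*} [LinearOrder κ] [LinearOrder ι]
  {B : AdaptedBasis h κ ι} {V : Type*} [AddCommGroup V] [Module k V]
  {π : SuperRep k h.toSubmodule V}

/-- If a letter `a` of `T` is replaced by an element `x` of `g`, then `E` sees the `a`-coefficient
of `x`. -/
theorem IsDual.apply_mon_mul_ι_mul_mon {E : Env k g →ₗ[k] Module.End k V} {t₁ t₂ : List ι} {a : ι}
    (hE : B.IsDual π (t₁ ++ a :: t₂) E) (hT : B.Normal (t₁ ++ a :: t₂)) (h2 : (2 : k) ≠ 0)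
    (x : g) :
    E (B.mon t₁ * Env.ι k x * B.mon t₂) = B.basis.repr x (Sum.inrₗ a) • 1 := by
  let f : g →ₗ[k] Module.End k V :=
    E ∘ₗ LinearMap.mulRight k (B.mon t₂) ∘ₗ LinearMap.mulLeft k (B.mon t₁) ∘ₗ Env.ι k
  suffices hf : f = (B.basis.coord (Sum.inrₗ a)).smulRight 1 by
    exact LinearMap.congr_fun hf x
  refine B.basis.ext fun l => ?_
  have e : f (B.basis l) =
      E (Env.word B.basis (t₁.map Sum.inrₗ ++ l :: t₂.map Sum.inrₗ)) := by
    simp [f, mon, Env.word_append, mul_assoc]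
  rw [e, LinearMap.smulRight_apply, Module.Basis.coord_apply, Module.Basis.repr_self]
  by_cases hl : l = Sum.inrₗ a
  · subst hl
    rw [Finsupp.single_eq_same, one_smul, ← hE.apply_mon_self hT, mon]
    simp
  · rw [Finsupp.single_eq_of_ne (Ne.symm hl), zero_smul]
    refine hE.apply_word_of_not_perm h2 (by simp) fun hp => hl ?_
    rw [List.map_append, List.map_cons] at hp
    have hp' := (List.perm_middle.symm.trans hp).trans List.perm_middle
    have hm := Multiset.coe_eq_coe.2 hp'
    rw [← Multiset.cons_coe, ← Multiset.cons_coe] at hm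
    exact (Multiset.cons_inj_left _).1 hm

/-- When `x` is moved to the left past a final segment `t₂` of `T`, the map `E` sees of the
resulting commutators with the letters `a` of `t₂` only the `a`-coefficients of `[a, x]`. -/
theorem IsDual.apply_commutator {T : List ι} {E : Env k g →ₗ[k] Module.End k V}
    (hE : B.IsDual π T E) (hT : B.Normal T) (h2 : (2 : k) ≠ 0) {i : ZMod 2} {x : g}
    (hx : x ∈ (grd k g).gr i) (t₁ t₂ : List ι) (hTt : T = t₁ ++ t₂) :
    E (B.mon t₁ * (B.mon t₂ * Env.ι k x -
      koszul i (t₂.map (B.par ∘ Sum.inrₗ)).sum • (Env.ι k x * B.mon t₂))) =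
      (t₂.map fun a =>
        B.basis.repr (sbr k (B.basis (Sum.inrₗ a)) x) (Sum.inrₗ a)).sum • 1 := by
  induction t₂ generalizing t₁ with
  | nil => simp
  | cons a t ih =>
    have ih' := ih (t₁ ++ [a]) (by simp [hTt])
    subst hTt
    have hbr := LieSuperalgebra.bracket_mem (k := k) (B.mem (Sum.inrₗ a)) hx
    have e1 := hE.apply_mon_mul_ι_mul_mon hT h2 (sbr k (B.basis (Sum.inrₗ a)) x)
    set s := koszul i (t.map (B.par ∘ Sum.inrₗ)).sum with hs
    -- the coefficient vanishes unless `x` is even, and then the sign is `1`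
    have e2 : s • (B.basis.repr (sbr k (B.basis (Sum.inrₗ a)) x) (Sum.inrₗ a)) =
        B.basis.repr (sbr k (B.basis (Sum.inrₗ a)) x) (Sum.inrₗ a) := by
      rcases zmod_two_eq i with rfl | rfl
      · rw [hs, koszul_zero_left, one_smul]
      · rw [B.repr_eq_zero hbr (by simp), smul_zero]
    have e3 : B.mon t₁ * (B.mon (a :: t) * Env.ι k x -
        koszul i ((a :: t).map (B.par ∘ Sum.inrₗ)).sum • (Env.ι k x * B.mon (a :: t))) =
        B.mon (t₁ ++ [a]) * (B.mon t * Env.ι k x - s • (Env.ι k x * B.mon t)) +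
        s • (B.mon t₁ * Env.ι k (sbr k (B.basis (Sum.inrₗ a)) x) * B.mon t) := by
      rw [Env.ι_bracket (B.mem _) hx, List.map_cons, List.sum_cons, koszul_add_right, ← hs,
        koszul_comm i, mon_append, mon_cons, mon_cons, mon_nil, mul_one, Function.comp_apply]
      simp only [mul_sub, sub_mul, mul_smul_comm, smul_mul_assoc, mul_assoc, smul_sub, smul_smul]
      rw [mul_comm s]
      abel
    rw [e3, map_add, map_zsmul, ih', e1, List.map_cons, List.sum_cons, add_smul, ← smul_assoc, e2,
      add_comm]

variable [Fintype ι]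

theorem sum_map_top {M : Type*} [AddCommMonoid M] (q : ℕ) (f : ι → M) :
    ((B.top q).map f).sum =
      ∑ a, (if B.par (Sum.inrₗ a) = 0 then q - 1 else 1) • f a := by
  rw [← Multiset.sum_coe, ← Multiset.map_coe, Finset.sum_multiset_map_count]
  simp only [Multiset.coe_count, count_top]
  refine Finset.sum_subset (Finset.subset_univ _) fun a _ ha => ?_
  rw [← count_top, List.count_eq_zero.2 (by simpa using ha), zero_smul]

variable (B) in
/-- The parity of the monomial `B.top q`: the sum of the parities of the letters for a complement
of `h`. -/
def topPar : ZMod 2 := ∑ a, B.par (Sum.inrₗ a)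

theorem sum_par_top (q : ℕ) : ((B.top q).map (B.par ∘ Sum.inrₗ)).sum = B.topPar := by
  rw [sum_map_top, topPar]
  refine Finset.sum_congr rfl fun a _ => ?_
  rcases zmod_two_eq (B.par (Sum.inrₗ a)) with ha | ha <;> simp [ha]

/-- The twist by the supertrace: `E` sees `T H` as `(-1)^{|T||H|} H T` plus the sum over the
letters `y` of `T` of the `y`-coefficient of `[y, H]`. An even letter occurs `q - 1 = -1` times and
an odd one once, so that this sum is the supertrace of `H` on `g / h`. -/
theorem IsDual.apply_top_mul_ι {q : ℕ} (hq : 1 ≤ q) (hqk : (q : k) = 0)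
    {E : Env k g →ₗ[k] Module.End k V} (hE : B.IsDual π (B.top q) E) (h2 : (2 : k) ≠ 0)
    {i : ZMod 2} {H : h.toSubmodule} (hH : H ∈ (grd k h.toSubmodule).gr i) :
    E (B.mon (B.top q) * Env.ι k (H : g)) = (π.twist (strad h) B.topPar).act H := by
  have hH' : (H : g) ∈ (grd k g).gr i := hH
  have hT := B.normal_top q
  have e := hE.apply_commutator hT h2 hH' [] (B.top q) rfl
  rw [mon_nil, one_mul, map_sub, map_zsmul, ← Env.incl_ι, hE.apply_incl_mul h2,
    hE.apply_mon_self hT, π.lift_ι, mul_one, sub_eq_iff_eq_add, sum_par_top, Env.incl_ι] at e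
  rw [e, π.twist_act _ _ hH, koszul_comm, add_comm]
  congr 2
  rw [sum_map_top]
  rcases zmod_two_eq i with rfl | rfl
  · rw [B.strad_apply hH]
    refine Finset.sum_congr rfl fun a _ => ?_
    have hs := LieSuperalgebra.skew (k := k) (B.mem (Sum.inrₗ a)) hH'
    rw [koszul_zero_right, one_smul] at hs
    rw [sbr, hs, map_neg, Finsupp.neg_apply]
    split_ifs with ha
    · rw [nsmul_eq_mul, Nat.cast_sub hq, hqk]
      simp
    · simp
  · rw [(strad h).map_odd H hH]
    refine Finset.sum_eq_zero fun a _ => ?_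
    rw [B.repr_eq_zero (LieSuperalgebra.bracket_mem (k := k) (B.mem (Sum.inrₗ a)) hH') (by simp),
      smul_zero]

section Char

variable (p : ℕ) [CharP k p] [Fact p.Prime] {n : ℕ} {E : Env k g →ₗ[k] Module.End k V}

/-- The map dual to the top monomial does not see a `q`-th power of an even letter in front of an
element of degree less than that of the top monomial: after moving this power to its place in a
normal monomial, the monomial is not the top one. -/
theorem IsDual.apply_pow_mul (hE : B.IsDual π (B.top (p ^ n)) E) (h2 : (2 : k) ≠ 0) {a : ι}
    (ha : B.par (Sum.inrₗ a) = 0) {u : Env k g}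
    (hu : u ∈ Env.degLT k g (B.top (p ^ n)).length) :
    E (Env.ι k (B.basis (Sum.inrₗ a)) ^ p ^ n * u) = 0 := by
  have hy : B.basis (Sum.inrₗ a) ∈ (grd k g).gr 0 := ha ▸ B.mem _
  set z := Env.ι k (B.basis (Sum.inrₗ a)) ^ p ^ n with hz
  suffices hle : Submodule.span k {x | ∃ (u : List κ) (s : List ι), B.Normal s ∧
      u.length + s.length < (B.top (p ^ n)).length ∧
      x = Env.incl h (Env.word B.sub u) * B.mon s} ≤
      LinearMap.ker (E ∘ₗ LinearMap.mulLeft k z) from hle (B.degLT_le_span_mul_mon h2 _ hu)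
  rw [Submodule.span_le]
  rintro _ ⟨w, s, hs, hl, rfl⟩
  rw [SetLike.mem_coe, LinearMap.mem_ker, LinearMap.comp_apply, LinearMap.mulLeft_apply]
  have hw : Env.incl h (Env.word B.sub w) ∈ Env.degLT k g (w.length + 1) := by
    rw [← B.word_inl]
    exact Env.word_mem_degLT (by simp)
  -- the power is moved past `w`, then past an initial segment of `s`; the commutators have degree
  -- less than that of the top monomial
  have c1 := Env.ι_pow_mul_sub_mem p n hy hw
  have k1 := hE.apply_eq_zero_of_mem_degLT h2 (Env.mul_mem_degLT (by omega) c1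
    (B.mon_mem_degLT (Nat.lt_succ_self s.length)))
  rw [sub_mul, map_sub, sub_eq_zero, mul_assoc, mul_assoc, ← hz] at k1
  rw [k1, hE.apply_incl_mul h2]
  obtain ⟨s₁, s₂, rfl, hn⟩ := hs.exists_insert ha (p ^ n)
  rw [List.length_append] at hl
  have c2 := Env.ι_pow_mul_sub_mem p n hy (B.mon_mem_degLT (Nat.lt_succ_self s₁.length))
  have k2 := hE.apply_eq_zero_of_mem_degLT h2 (Env.mul_mem_degLT (by omega) c2
    (B.mon_mem_degLT (Nat.lt_succ_self s₂.length)))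
  rw [sub_mul, map_sub, sub_eq_zero, mul_assoc, mul_assoc, ← hz] at k2
  have k3 := hE _ hn 1
  rw [if_neg, map_one, one_mul, mon_append, mon_append, mon_replicate, ← hz] at k3
  · rw [mon_append, k2, k3, mul_zero]
  · intro he
    have := congrArg (List.count a) he
    rw [count_top, if_pos ha, List.count_append, List.count_append,
      List.count_replicate_self] at this
    have : 0 < p ^ n := pow_pos (Fact.out : p.Prime).pos n
    omega

/-- The right action of `H` on normal monomials of degree bounded by that of the top monomial plus
`q - 2`: in a longer monomial than the top one some even letter occurs `q` times, and this power may
be moved to the front. -/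
theorem IsDual.apply_mon_mul_ι (hE : B.IsDual π (B.top (p ^ n)) E) (hn : n ≠ 0)
    (h2 : (2 : k) ≠ 0) {s : List ι} (hs : B.Normal s)
    (hl : s.length + 2 ≤ (B.top (p ^ n)).length + p ^ n)
    {i : ZMod 2} {H : h.toSubmodule} (hH : H ∈ (grd k h.toSubmodule).gr i) :
    E (B.mon s * Env.ι k (H : g)) =
      if s = B.top (p ^ n) then (π.twist (strad h) B.topPar).act H else 0 := by
  split_ifs with he
  · subst he
    exact hE.apply_top_mul_ι (Nat.one_le_pow _ _ (Fact.out : p.Prime).pos)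
      (by simp [hn]) h2 hH
  rcases lt_or_ge s.length (B.top (p ^ n)).length with hlt | hge
  · -- in this degree, `E` does not see words which contain a letter for `h`
    have : ⊤ ≤ LinearMap.ker (E ∘ₗ LinearMap.mulLeft k (B.mon s) ∘ₗ Env.ι k ∘ₗ
        h.toSubmodule.subtype) := by
      rw [← B.sub.span_eq, Submodule.span_le]
      rintro _ ⟨a, rfl⟩
      have e : B.mon s * Env.ι k (B.sub a : g) =
          Env.word B.basis (s.map Sum.inrₗ ++ [Sum.inlₗ a]) := by
        rw [Env.word_append, ← B.basis_inl, Env.word_cons, Env.word_nil, mul_one, mon]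
      simp only [SetLike.mem_coe, LinearMap.mem_ker, LinearMap.comp_apply,
        Submodule.subtype_apply, LinearMap.mulLeft_apply, e]
      refine hE.apply_word_of_not_perm h2 (by simpa using hlt) fun hp => ?_
      have : (Sum.inlₗ a : κ ⊕ₗ ι) ∈ (B.top (p ^ n)).map Sum.inrₗ := hp.subset (by simp)
      simp [Sum.inlₗ, Sum.inrₗ] at this
    exact this (Submodule.mem_top : H ∈ ⊤)
  -- the power `y ^ q` is moved to the front past `s₁`; since it accounts for `q` letters, the
  -- commutator has degree less than that of the top monomial
  · obtain ⟨a, ha, hc⟩ := B.exists_le_count_of_ne_top hs he hge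
    have hy : B.basis (Sum.inrₗ a) ∈ (grd k g).gr 0 := ha ▸ B.mem _
    obtain ⟨s₁, s₂, rfl⟩ := exists_append_replicate_of_le_count (isNormalWord_iff.1 hs).1 hc
    simp only [List.length_append, List.length_replicate] at hl
    have c1 := Env.ι_pow_mul_sub_mem p n hy (B.mon_mem_degLT (Nat.lt_succ_self s₁.length))
    have m2 : B.mon s₂ * Env.ι k (H : g) ∈ Env.degLT k g (s₂.length + 2) :=
      Env.mul_mem_degLT (by omega) (B.mon_mem_degLT (Nat.lt_succ_self s₂.length))
        (Env.ι_mem_degLT _)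
    have k1 := hE.apply_eq_zero_of_mem_degLT h2 (Env.mul_mem_degLT (by omega) c1 m2)
    rw [sub_mul, map_sub, sub_eq_zero, mul_assoc, mul_assoc] at k1
    rw [mon_append, mon_append, mon_replicate, mul_assoc, mul_assoc, ← k1]
    exact hE.apply_pow_mul p h2 ha (Env.mul_mem_degLT (by omega)
      (B.mon_mem_degLT (Nat.lt_succ_self s₁.length)) m2)

/-- For every `c` in `U(h)` and every bound `C`, if `q = p^n` is large enough then
`E (w c) = E w * τ c` for all `w` of degree less than that of the top monomial plus `C`, where
`τ` is the twist of `π` by the supertrace. -/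
theorem exists_apply_mul_incl (B : AdaptedBasis h κ ι) (π : SuperRep k h.toSubmodule V)
    (h2 : (2 : k) ≠ 0) (c : Env k h.toSubmodule) (C : ℕ) :
    ∃ n₀, ∀ n, n₀ ≤ n → ∀ E : Env k g →ₗ[k] Module.End k V, B.IsDual π (B.top (p ^ n)) E →
      ∀ w ∈ Env.degLT k g ((B.top (p ^ n)).length + C),
        E (w * Env.incl h c) = E w * (π.twist (strad h) B.topPar).lift c := by
  refine Env.induction (P := fun c => ∀ C, ∃ n₀, ∀ n, n₀ ≤ n →
    ∀ E : Env k g →ₗ[k] Module.End k V, B.IsDual π (B.top (p ^ n)) E →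
      ∀ w ∈ Env.degLT k g ((B.top (p ^ n)).length + C),
        E (w * Env.incl h c) = E w * (π.twist (strad h) B.topPar).lift c)
    (fun a C => ⟨0, fun n _ E hE w hw => ?_⟩) (fun H C => ⟨C + 1, fun n hn E hE w hw => ?_⟩)
    (fun c d hc hd C => ?_) (fun c d hc hd C => ?_) c C
  · simp [Algebra.algebraMap_eq_smul_one]
  · refine (grd k h.toSubmodule).induction (P := fun H => E (w * Env.incl h (Env.ι k H)) =
      E w * (π.twist (strad h) B.topPar).lift (Env.ι k H)) (fun i H hH => ?_)
      (fun H H' e e' => ?_) H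
    · have hq : C + 1 < p ^ n :=
        lt_of_le_of_lt hn (Nat.lt_pow_self (Fact.out : p.Prime).one_lt)
      have := B.degLT_le_span_mul_mon h2 _ hw
      clear hw
      induction this using Submodule.span_induction with
      | mem w hw =>
        obtain ⟨u, s, hs, hl, rfl⟩ := hw
        rw [mul_assoc, hE.apply_incl_mul h2, hE.apply_incl_mul h2, mul_assoc, Env.incl_ι,
          hE.apply_mon_mul_ι p (by omega) h2 hs (by omega) hH, SuperRep.lift_ι]
        have := hE s hs 1
        rw [map_one, map_one, one_mul] at this
        rw [this]
        split_ifs <;> simp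
      | zero => simp
      | add u v _ _ hu hv => rw [add_mul, map_add, map_add, hu, hv, add_mul]
      | smul a u _ hu => rw [smul_mul_assoc, map_smul, map_smul, hu, smul_mul_assoc]
    · simp only [map_add, mul_add, e, e']
  · obtain ⟨n₁, h₁⟩ := hc C
    obtain ⟨n₂, h₂⟩ := hd C
    refine ⟨max n₁ n₂, fun n hn E hE w hw => ?_⟩
    rw [map_add, mul_add, map_add, map_add, mul_add, h₁ n (by omega) E hE w hw,
      h₂ n (by omega) E hE w hw]
  -- in `w c d` the element `d` acts on `w c`, whose degree is bounded in terms of that of `c`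
  · obtain ⟨M, hM⟩ := Env.exists_mem_degLT (Env.incl h c)
    obtain ⟨n₁, h₁⟩ := hc C
    obtain ⟨n₂, h₂⟩ := hd (C + M)
    refine ⟨max n₁ n₂, fun n hn E hE w hw => ?_⟩
    rw [map_mul (Env.incl h), ← mul_assoc,
      h₂ n (by omega) E hE _ (Env.mul_mem_degLT (by omega) hw hM),
      h₁ n (by omega) E hE w hw, map_mul, mul_assoc]

end Char

end AdaptedBasis

/-! ### Elements of the kernel of a coinduced representation -/

section Kernel

variable {k g : Type*} [Field k] [AddCommGroup g] [Module k g] [LieSuperalgebra k g]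
  {h : LieSubsuperalgebra k g} {V : Type*} [AddCommGroup V] [Module k V]
  {π : SuperRep k h.toSubmodule V}

theorem mem_coindKer {u : Env k g} :
    u ∈ coindKer h π ↔ ∀ μ ∈ coind h π, ∀ w, μ (w * u) = 0 := by
  rw [coindKer, RingHom.mem_ker]
  constructor
  · intro hu μ hμ w
    have := LinearMap.congr_fun (congrArg Subtype.val (LinearMap.congr_fun hu ⟨μ, hμ⟩)) w
    exact this
  · intro hu
    exact LinearMap.ext fun μ => Subtype.ext (LinearMap.ext fun w => hu μ μ.2 w)

/-- The elements of `I_π` are sums of products `s c_s`, with monomials `s` and elements `c_s` of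
`U(h)` which annihilate the twist of `π` by the supertrace. -/
theorem exists_sum_of_mem_coindKer (p : ℕ) [CharP k p] [Fact p.Prime] (h2 : (2 : k) ≠ 0)
    {κ ι : Type*} [LinearOrder κ] [LinearOrder ι] [Fintype ι] (B : AdaptedBasis h κ ι)
    {u : Env k g} (hu : u ∈ coindKer h π) :
    ∃ c : List ι →₀ Env k h.toSubmodule,
      (∀ s, (π.twist (strad h) B.topPar).lift (c s) = 0) ∧
      u = c.sum fun s c => B.mon s * Env.incl h c := by
  classical
  obtain ⟨c, hc, rfl⟩ := B.exists_sum_mon_mul h2 u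
  refine ⟨c, ?_, rfl⟩
  by_contra! hne
  set ρ := (π.twist (strad h) B.topPar).lift with hρ
  -- `s` is a monomial of maximal degree whose coefficient does not vanish on the twist
  obtain ⟨s, hs, hmax⟩ := Finset.exists_max_image (c.support.filter fun s => ρ (c s) ≠ 0)
    List.length (by
      obtain ⟨s, hs⟩ := hne
      refine ⟨s, Finset.mem_filter.2 ⟨Finsupp.mem_support_iff.2 ?_, hs⟩⟩
      intro h0
      rw [h0, map_zero] at hs
      exact hs rfl)
  obtain ⟨hsc, hs0⟩ := Finset.mem_filter.1 hs
  set L := c.support.sup List.length with hL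
  choose n₀ hn₀ using fun t => B.exists_apply_mul_incl p π h2 (c t) (L + 1)
  -- `p ^ n` exceeds the degrees of all monomials in `u`, and `n` is large enough for right
  -- linearity with respect to all coefficients of `u`
  let n := max (c.support.sup n₀) (L + 1)
  have hq : L < p ^ n := lt_of_lt_of_le (Nat.lt_pow_self (Fact.out : p.Prime).one_lt)
    (Nat.pow_le_pow_right (Fact.out : p.Prime).pos (show L ≤ n by omega))
  have hle (t) (ht : t ∈ c.support) : t.length ≤ L := Finset.le_sup (f := List.length) ht
  obtain ⟨E, hE⟩ := B.exists_isDual π h2 (B.top (p ^ n))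
  obtain ⟨t, ht⟩ := B.exists_append_perm_top (q := p ^ n) (hc s hsc)
    (lt_of_le_of_lt (hle s hsc) hq)
  have htl := ht.length_eq
  rw [List.length_append] at htl
  -- for `v` in `V` the map `x ↦ E x v` is an element of the coinduced representation
  have hzero : E (B.mon t * c.sum fun s c => B.mon s * Env.incl h c) = 0 := by
    refine LinearMap.ext fun v => ?_
    refine mem_coindKer.1 hu (LinearMap.applyₗ v ∘ₗ E) (fun H u => ?_) (B.mon t)
    have := hE.apply_incl_mul h2 (Env.ι k H) u
    rw [Env.incl_ι, SuperRep.lift_ι] at this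
    simp [this]
  rw [Finsupp.sum, Finset.mul_sum, map_sum, Finset.sum_eq_single_of_mem s hsc] at hzero
  · obtain ⟨ε, hε⟩ := hE.apply_mon_of_perm h2 (B.normal_top _) ht
    rw [← mul_assoc, ← B.mon_append, hn₀ s n
      ((Finset.le_sup (f := n₀) hsc).trans (le_max_left _ _)) E hE _
      (B.mon_mem_degLT (by simp; omega)), hε, smul_mul_assoc, one_mul] at hzero
    refine hs0 ?_
    rcases Int.units_eq_one_or ε with rfl | rfl <;> simpa using hzero
  · intro s' hs' hne'
    have hl' := hle s' hs'
    rw [← mul_assoc, ← B.mon_append, hn₀ s' n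
      ((Finset.le_sup (f := n₀) hs').trans (le_max_left _ _)) E hE _
      (B.mon_mem_degLT (by simp; omega))]
    by_cases h0 : ρ (c s') = 0
    · rw [h0, mul_zero]
    · have hm := hmax s' (Finset.mem_filter.2 ⟨hs', h0⟩)
      have : E (B.mon (t ++ s')) = 0 := by
        refine hE.apply_word_of_not_perm h2 (by simp; omega) fun hp => hne' ?_
        have hp' := (List.map_perm_map_iff Sum.inr_injective).1 hp
        exact (hc s' hs').eq_of_perm (hc s hsc)
          ((List.perm_append_left_iff t).1 (hp'.trans ht.symm))
      rw [this, zero_mul]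

end Kernel

/-! ### The antipode -/

section Antipode

variable {k g : Type*} [Field k] [AddCommGroup g] [Module k g] [LieSuperalgebra k g]

theorem Env.induction_left {P : Env k g → Prop} (one : P 1) (smul : ∀ (c : k) u, P u → P (c • u))
    (add : ∀ u v, P u → P v → P (u + v))
    (ι_mul : ∀ i, ∀ x ∈ (grd k g).gr i, ∀ u, P u → P (Env.ι k x * u)) (u : Env k g) : P u := by
  suffices h : ∀ v, P v → P (u * v) by simpa using h 1 one
  refine Env.induction (P := fun u => ∀ v, P v → P (u * v)) (fun c v hv => ?_)
    (fun x v hv => ?_) (fun u u' hu hu' v hv => ?_) (fun u u' hu hu' v hv => ?_) u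
  · rw [← Algebra.smul_def]
    exact smul c v hv
  · refine (grd k g).induction (P := fun x => P (Env.ι k x * v)) (fun i x hx => ι_mul i x hx v hv)
      (fun x y hx hy => ?_) x
    rw [map_add, add_mul]
    exact add _ _ hx hy
  · rw [add_mul]
    exact add _ _ (hu v hv) (hu' v hv)
  · rw [mul_assoc]
    exact hu _ (hu' v hv)

theorem Env.induction_right {P : Env k g → Prop} (one : P 1) (smul : ∀ (c : k) u, P u → P (c • u))
    (add : ∀ u v, P u → P v → P (u + v))
    (mul_ι : ∀ i, ∀ x ∈ (grd k g).gr i, ∀ u, P u → P (u * Env.ι k x)) (u : Env k g) : P u := by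
  suffices h : ∀ v, P v → P (v * u) by simpa using h 1 one
  refine Env.induction (P := fun u => ∀ v, P v → P (v * u)) (fun c v hv => ?_)
    (fun x v hv => ?_) (fun u u' hu hu' v hv => ?_) (fun u u' hu hu' v hv => ?_) u
  · rw [← Algebra.commutes, ← Algebra.smul_def]
    exact smul c v hv
  · refine (grd k g).induction (P := fun x => P (v * Env.ι k x)) (fun i x hx => mul_ι i x hx v hv)
      (fun x y hx hy => ?_) x
    rw [map_add, mul_add]
    exact add _ _ hx hy
  · rw [mul_add]
    exact add _ _ (hu v hv) (hu' v hv)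
  · rw [← mul_assoc]
    exact hu' _ (hu v hv)

theorem Env.sgn_zero (u : Env k g) : Env.sgn k g 0 u = u := by
  suffices h : Env.sgn k g 0 = AlgHom.id k _ by rw [h, AlgHom.id_apply]
  refine Env.hom_ext fun x => ?_
  refine (grd k g).induction (P := fun x => Env.sgn k g 0 (Env.ι k x) =
    AlgHom.id k _ (Env.ι k x)) (fun i x hx => ?_) (fun x y hx hy => ?_) x
  · rw [Env.sgn_ι k _ hx, koszul_zero_left, one_smul, AlgHom.id_apply]
  · simp only [map_add, hx, hy]

theorem Env.sgn_sgn_self (i : ZMod 2) (u : Env k g) : Env.sgn k g i (Env.sgn k g i u) = u := by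
  rw [Env.sgn_sgn, CharTwo.add_self_eq_zero, Env.sgn_zero]

/-- An element `u` of `U(g)` is homogeneous of degree `d` if each sign operator `Env.sgn k g j`
multiplies it by `(-1)^{jd}`; in characteristic different from `2` this is the `ℤ/2ℤ`-grading of
`U(g)`. -/
def Env.IsHomogeneous (d : ZMod 2) (u : Env k g) : Prop :=
  ∀ j, Env.sgn k g j u = koszul j d • u

theorem Env.isHomogeneous_ι {i : ZMod 2} {x : g} (hx : x ∈ (grd k g).gr i) :
    Env.IsHomogeneous i (Env.ι k x) := fun j => Env.sgn_ι k j hx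

/-- The homogeneous components of an element of `U(g)`, with the formula for them. -/
theorem Env.exists_isHomogeneous_add (h2 : (2 : k) ≠ 0) (u : Env k g) :
    ∃ v : ZMod 2 → Env k g, (∀ d, Env.IsHomogeneous d (v d)) ∧ u = v 0 + v 1 ∧
      ∀ d, v d = (2 : k)⁻¹ • (u + koszul 1 d • Env.sgn k g 1 u) := by
  refine ⟨fun d => (2 : k)⁻¹ • (u + koszul 1 d • Env.sgn k g 1 u), fun d j => ?_, ?_,
    fun d => rfl⟩
  · rcases zmod_two_eq j with rfl | rfl
    · rw [Env.sgn_zero, koszul_zero_left, one_smul]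
    · rw [map_smul, map_add, map_zsmul, Env.sgn_sgn_self, smul_comm (koszul 1 d),
        smul_add (koszul 1 d), smul_smul (koszul 1 d), koszul_mul_self, one_smul, add_comm]
  · simp only [koszul_zero_right, koszul_one_one]
    match_scalars <;> field_simp <;> norm_num

theorem Env.antipode_sgn (i : ZMod 2) (u : Env k g) :
    Env.antipode k g (Env.sgn k g i u) = Env.sgn k g i (Env.antipode k g u) := by
  have h := Env.sgn_antiRep k g i u 1
  rw [map_one (Env.sgn k g i)] at h
  exact h.symm

theorem Env.IsHomogeneous.antipode {d : ZMod 2} {u : Env k g} (hu : Env.IsHomogeneous d u) :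
    Env.IsHomogeneous d (Env.antipode k g u) := fun j => by
  rw [← Env.antipode_sgn, hu j, map_zsmul]

/-- The rule `(uv)ˇ = (-1)^{|u||v|} v̌ ǔ`, for `v` homogeneous. -/
theorem Env.antipode_mul {d : ZMod 2} {v : Env k g} (hv : Env.IsHomogeneous d v) (u : Env k g) :
    Env.antipode k g (u * v) = Env.antipode k g v * Env.antipode k g (Env.sgn k g d u) := by
  refine Env.induction_left (P := fun u => Env.antipode k g (u * v) =
    Env.antipode k g v * Env.antipode k g (Env.sgn k g d u)) ?_ (fun c u hu => ?_)
    (fun u u' hu hu' => ?_) (fun i x hx u hu => ?_) u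
  · rw [one_mul, map_one, Env.antipode_one, mul_one]
  · rw [smul_mul_assoc, map_smul, hu, map_smul, map_smul, mul_smul_comm]
  · rw [add_mul, map_add, hu, hu', map_add, map_add, mul_add]
  · rw [mul_assoc, Env.antipode_ι_mul k hx, Env.antipode_sgn, hu, map_mul (Env.sgn k g i),
      hv.antipode i, map_mul (Env.sgn k g d), Env.sgn_ι k d hx, smul_mul_assoc (koszul d i),
      map_zsmul, Env.antipode_ι_mul k hx, Env.antipode_sgn, Env.antipode_sgn, Env.antipode_sgn,
      koszul_comm d i, smul_mul_assoc, smul_mul_assoc, mul_smul_comm, mul_assoc]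

theorem Env.antipode_antipode (u : Env k g) : Env.antipode k g (Env.antipode k g u) = u := by
  refine Env.induction_left (P := fun u => Env.antipode k g (Env.antipode k g u) = u) ?_
    (fun c u hu => ?_) (fun u v hu hv => ?_) (fun i x hx u hu => ?_) u
  · rw [Env.antipode_one, Env.antipode_one]
  · rw [map_smul, map_smul, hu]
  · rw [map_add, map_add, hu, hv]
  · rw [Env.antipode_ι_mul k hx, Env.antipode_ι, mul_neg, map_neg,
      Env.antipode_mul (Env.isHomogeneous_ι hx), Env.antipode_ι, ← Env.antipode_sgn,
      Env.sgn_sgn_self, hu, neg_mul, neg_neg]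

theorem Env.incl_sgn (h : LieSubsuperalgebra k g) (i : ZMod 2) (c : Env k h.toSubmodule) :
    Env.incl h (Env.sgn k _ i c) = Env.sgn k g i (Env.incl h c) := by
  suffices e : (Env.incl h).comp (Env.sgn k _ i) = (Env.sgn k g i).comp (Env.incl h) from
    congrArg (fun f => f c) e
  refine Env.hom_ext fun x => ?_
  refine (grd k h.toSubmodule).induction (P := fun x =>
    (Env.incl h).comp (Env.sgn k _ i) (Env.ι k x) = (Env.sgn k g i).comp (Env.incl h) (Env.ι k x))
    (fun j x hx => ?_) (fun x y hx hy => ?_) x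
  · have hx' : (x : g) ∈ (grd k g).gr j := hx
    simp only [AlgHom.comp_apply, Env.sgn_ι k i hx, map_zsmul, Env.incl_ι, Env.sgn_ι k i hx']
  · simp only [map_add, hx, hy]

theorem Env.incl_antipode (h : LieSubsuperalgebra k g) (c : Env k h.toSubmodule) :
    Env.incl h (Env.antipode k _ c) = Env.antipode k g (Env.incl h c) := by
  refine Env.induction_left (P := fun c => Env.incl h (Env.antipode k _ c) =
    Env.antipode k g (Env.incl h c)) ?_
    (fun a u hu => ?_) (fun u v hu hv => ?_) (fun i x hx u hu => ?_) c
  · rw [Env.antipode_one, map_one, Env.antipode_one]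
  · rw [map_smul, map_smul, hu, map_smul, map_smul]
  · rw [map_add, map_add, hu, hv, map_add, map_add]
  · have hx' : (x : g) ∈ (grd k g).gr i := hx
    rw [Env.antipode_ι_mul k hx, map_mul (Env.incl h), map_mul (Env.incl h), Env.incl_ι,
      Env.antipode_ι_mul k hx', Env.antipode_sgn, Env.incl_sgn, hu, Env.antipode_sgn,
      Env.antipode_ι, Env.antipode_ι, map_neg, Env.incl_ι]

end Antipode

section Sign

variable {k h V : Type*} [Field k] [AddCommGroup h] [Module k h] [LieSuperalgebra k h]
  [AddCommGroup V] [Module k V]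

theorem SuperGrading.sgn_sgn_self (G : SuperGrading k V) (i : ZMod 2) (v : V) :
    G.sgn i (G.sgn i v) = v := by
  refine G.induction (P := fun v => G.sgn i (G.sgn i v) = v) (fun j v hv => ?_)
    (fun v w hv hw => ?_) v
  · rw [G.sgn_of_mem i hv, map_zsmul, G.sgn_of_mem i hv, smul_smul, koszul_mul_self, one_smul]
  · rw [map_add, map_add, hv, hw]

theorem SuperRep.sgn_act (π : SuperRep k h V) (j : ZMod 2) {i : ZMod 2} {x : h}
    (hx : x ∈ (grd k h).gr i) (v : V) :
    π.grading.sgn j (π.act x v) = koszul j i • π.act x (π.grading.sgn j v) := by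
  refine π.grading.induction (P := fun v => π.grading.sgn j (π.act x v) =
    koszul j i • π.act x (π.grading.sgn j v)) (fun l v hv => ?_) (fun v w hv hw => ?_) v
  · rw [π.grading.sgn_of_mem j (π.act_mem hx hv), π.grading.sgn_of_mem j hv, map_zsmul,
      smul_smul, koszul_add_right]
  · simp only [map_add, hv, hw, smul_add]

theorem SuperRep.sgn_lift (π : SuperRep k h V) (j : ZMod 2) (c : Env k h) (v : V) :
    π.grading.sgn j (π.lift c v) = π.lift (Env.sgn k h j c) (π.grading.sgn j v) := by
  refine Env.induction_left (P := fun c => π.grading.sgn j (π.lift c v) =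
    π.lift (Env.sgn k h j c) (π.grading.sgn j v)) ?_ (fun a u hu => ?_) (fun u w hu hw => ?_)
    (fun i x hx u hu => ?_) c
  · simp only [map_one, Module.End.one_apply]
  · simp only [map_smul, LinearMap.smul_apply, hu]
  · simp only [map_add, LinearMap.add_apply, hu, hw]
  · simp only [map_mul, Module.End.mul_apply, π.lift_ι, π.sgn_act j hx, hu, Env.sgn_ι k j hx,
      map_zsmul, LinearMap.smul_apply]

theorem SuperRep.lift_sgn_eq_zero (π : SuperRep k h V) (j : ZMod 2) {c : Env k h}
    (hc : π.lift c = 0) : π.lift (Env.sgn k h j c) = 0 := by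
  ext v
  rw [← π.grading.sgn_sgn_self j v, ← π.sgn_lift, hc]
  simp

/-- The annihilator of a representation is graded. -/
theorem SuperRep.exists_isHomogeneous_of_lift_eq_zero (π : SuperRep k h V) (h2 : (2 : k) ≠ 0)
    {c : Env k h} (hc : π.lift c = 0) :
    ∃ v : ZMod 2 → Env k h, (∀ d, Env.IsHomogeneous d (v d)) ∧ c = v 0 + v 1 ∧
      ∀ d, π.lift (v d) = 0 := by
  obtain ⟨v, hv, e, hve⟩ := Env.exists_isHomogeneous_add h2 c
  refine ⟨v, hv, e, fun d => ?_⟩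
  rw [hve, map_smul, map_add, map_zsmul, hc, π.lift_sgn_eq_zero 1 hc]
  simp

end Sign

/-! ### The antipode on the kernel of a coinduced representation -/

section Kernel

variable {k g : Type*} [Field k] [AddCommGroup g] [Module k g] [LieSuperalgebra k g]
  {h : LieSubsuperalgebra k g} {V V' : Type*} [AddCommGroup V] [Module k V]
  [AddCommGroup V'] [Module k V']
  {π : SuperRep k h.toSubmodule V} {π' : SuperRep k h.toSubmodule V'}

theorem apply_incl_mul_of_mem_coind {ν : Env k g →ₗ[k] V} (hν : ν ∈ coind h π)
    (c : Env k h.toSubmodule) (u : Env k g) : ν (Env.incl h c * u) = π.lift c (ν u) := by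
  refine Env.induction_left (P := fun c => ν (Env.incl h c * u) = π.lift c (ν u)) ?_
    (fun a u hu => ?_) (fun u w hu hw => ?_) (fun i x hx u hu => ?_) c
  · simp
  · simp only [map_smul, smul_mul_assoc, hu, LinearMap.smul_apply]
  · simp only [map_add, add_mul, hu, hw, LinearMap.add_apply]
  · rw [map_mul (Env.incl h), mul_assoc, Env.incl_ι, hν x, hu, map_mul, Module.End.mul_apply,
      π.lift_ι]

/-- The kernel of a coinduced representation is graded. -/
theorem sgn_mem_coindKer (j : ZMod 2) {u : Env k g} (hu : u ∈ coindKer h π) :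
    Env.sgn k g j u ∈ coindKer h π := by
  rw [mem_coindKer] at hu ⊢
  intro μ hμ w
  have hμ' : π.grading.sgn j ∘ₗ μ ∘ₗ (Env.sgn k g j).toLinearMap ∈ coind h π := by
    intro H v
    refine (grd k h.toSubmodule).induction (P := fun H : h.toSubmodule =>
      (π.grading.sgn j ∘ₗ μ ∘ₗ (Env.sgn k g j).toLinearMap) (Env.ι k (H : g) * v) =
      π.act H ((π.grading.sgn j ∘ₗ μ ∘ₗ (Env.sgn k g j).toLinearMap) v))
      (fun i H hH => ?_) (fun H H' e e' => ?_) H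
    · have hH' : (H : g) ∈ (grd k g).gr i := hH
      simp only [LinearMap.comp_apply, AlgHom.toLinearMap_apply, map_mul, Env.sgn_ι k j hH',
        smul_mul_assoc, map_zsmul, hμ H, π.sgn_act j hH, smul_smul, koszul_mul_self, one_smul]
    · simp only [Submodule.coe_add, map_add, add_mul, e, e', LinearMap.add_apply]
  have := congrArg (π.grading.sgn j) (hu _ hμ' (Env.sgn k g j w))
  simpa only [LinearMap.comp_apply, AlgHom.toLinearMap_apply, map_mul, Env.sgn_sgn_self,
    SuperGrading.sgn_sgn_self, map_zero] using this

/-- The antipode maps `I_π` into `I_{π'}` as soon as it maps the annihilator of the twist of `π` by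
the supertrace to that of `π'`. -/
theorem antipode_mem_coindKer (p : ℕ) [CharP k p] [Fact p.Prime] (h2 : (2 : k) ≠ 0)
    {κ ι : Type*} [LinearOrder κ] [LinearOrder ι] [Fintype ι] (B : AdaptedBasis h κ ι)
    (hann : ∀ c, (π.twist (strad h) B.topPar).lift c = 0 → π'.lift (Env.antipode k _ c) = 0)
    {u : Env k g} (hu : u ∈ coindKer h π) : Env.antipode k g u ∈ coindKer h π' := by
  rw [mem_coindKer]
  intro ν hν w
  -- `ν` vanishes on the images `± č š` of the products `s c`, as `π' č = 0`
  have key : ∀ z ∈ coindKer h π, ν (Env.antipode k g z) = 0 := by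
    intro z hz
    obtain ⟨c, hc, rfl⟩ := exists_sum_of_mem_coindKer p h2 B hz
    rw [Finsupp.sum, map_sum, map_sum]
    refine Finset.sum_eq_zero fun s _ => ?_
    obtain ⟨v, hv, e, hv0⟩ :=
      SuperRep.exists_isHomogeneous_of_lift_eq_zero (π.twist (strad h) B.topPar) h2 (hc s)
    have hd (d) : ν (Env.antipode k g (B.mon s * Env.incl h (v d))) = 0 := by
      have hom : Env.IsHomogeneous d (Env.incl h (v d)) := fun j => by
        rw [← Env.incl_sgn, hv d j, map_zsmul]
      rw [Env.antipode_mul hom, ← Env.incl_antipode, apply_incl_mul_of_mem_coind hν,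
        hann _ (hv0 d), LinearMap.zero_apply]
    rw [e, map_add, mul_add, map_add, map_add, hd, hd, add_zero]
  -- `w ǔ` is up to sign the image of `u w̌`, which lies in the ideal `I_π`
  obtain ⟨v, hv, rfl, -⟩ := Env.exists_isHomogeneous_add h2 w
  have hd (d) : ν (v d * Env.antipode k g u) = 0 := by
    have e := Env.antipode_mul (hv d).antipode (Env.sgn k g d u)
    rw [Env.antipode_antipode, Env.sgn_sgn_self] at e
    rw [← e]
    refine key _ ?_
    have := sgn_mem_coindKer d hu
    rw [coindKer, RingHom.mem_ker] at this ⊢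
    rw [map_mul, this, zero_mul]
  rw [add_mul, map_add, hd, hd, add_zero]

end Kernel

/-! ### Annihilators and contragredient representations -/

section Duality

variable {k h V V' : Type*} [Field k] [AddCommGroup h] [Module k h] [LieSuperalgebra k h]
  [AddCommGroup V] [Module k V] [AddCommGroup V'] [Module k V']

theorem comp_act_mem_dual (σ : SuperRep k h V) {i j : ZMod 2} {x : h} {f : Module.Dual k V}
    (hx : x ∈ (grd k h).gr i) (hf : f ∈ σ.grading.dual.gr j) :
    f ∘ₗ σ.act x ∈ σ.grading.dual.gr (i + j) := by
  refine (Submodule.mem_dualAnnihilator _).2 fun v hv => ?_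
  have h1 := σ.act_mem hx hv
  rw [(by decide : ∀ i j : ZMod 2, i + (i + j + 1) = j + 1)] at h1
  exact (Submodule.mem_dualAnnihilator _).1 hf _ h1

/-- If `D` identifies `ρ`, up to a shift of parities by `e`, with the contragredient of `σ`, then
`U(h)` acts through `ρ` as the transpose of its action through `σ`, composed with the antipode. -/
theorem SuperRep.lift_apply_dual {ρ : SuperRep k h V'} {σ : SuperRep k h V}
    (D : Module.Dual k V →ₗ[k] V') (e : ZMod 2)
    (hD : ∀ i j, ∀ x ∈ (grd k h).gr i, ∀ f ∈ σ.grading.dual.gr j,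
      ρ.act x (D f) = -(koszul i (j + e) • D (f ∘ₗ σ.act x)))
    (c : Env k h) {j : ZMod 2} {f : Module.Dual k V} (hf : f ∈ σ.grading.dual.gr j) :
    ρ.lift c (D f) = D (f ∘ₗ σ.lift (Env.antipode k h (Env.sgn k h (j + e) c))) := by
  refine Env.induction_right (P := fun c => ∀ j, ∀ f ∈ σ.grading.dual.gr j,
    ρ.lift c (D f) = D (f ∘ₗ σ.lift (Env.antipode k h (Env.sgn k h (j + e) c))))
    (fun j f hf => ?_) (fun a u hu j f hf => ?_) (fun u v hu hv j f hf => ?_)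
    (fun i x hx u hu j f hf => ?_) c j f hf
  · rw [map_one, map_one (Env.sgn k h _), Env.antipode_one, map_one]
    rfl
  · simp only [map_smul, LinearMap.smul_apply, hu j f hf, LinearMap.comp_smul]
  · simp only [map_add, LinearMap.add_apply, hu j f hf, hv j f hf, LinearMap.comp_add]
  · have e1 := hu _ _ (comp_act_mem_dual σ hx hf)
    rw [map_mul, Module.End.mul_apply, ρ.lift_ι, hD i j x hx f hf, map_neg, map_zsmul, e1,
      map_mul (Env.sgn k h _), Env.sgn_ι k _ hx, mul_smul_comm, map_zsmul,
      Env.antipode_mul (Env.isHomogeneous_ι hx), Env.antipode_ι, Env.sgn_sgn, neg_mul,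
      koszul_comm i, add_assoc, smul_neg, map_neg, map_zsmul, map_mul σ.lift, σ.lift_ι]
    generalize σ.lift (Env.antipode k h (Env.sgn k h _ u)) = S
    have e2 (n : ℤ) : f ∘ₗ (-(n • (σ.act x * S))) = -(n • ((f ∘ₗ σ.act x) ∘ₗ S)) := by
      ext v
      simp
    rw [e2, map_neg, map_zsmul]

theorem SuperRep.lift_antipode_eq_zero_of_surjective {ρ : SuperRep k h V'} {σ : SuperRep k h V}
    (D : Module.Dual k V →ₗ[k] V') (hs : Function.Surjective D) (e : ZMod 2)
    (hD : ∀ i j, ∀ x ∈ (grd k h).gr i, ∀ f ∈ σ.grading.dual.gr j,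
      ρ.act x (D f) = -(koszul i (j + e) • D (f ∘ₗ σ.act x)))
    {c : Env k h} (hc : σ.lift c = 0) : ρ.lift (Env.antipode k h c) = 0 := by
  suffices h0 : ρ.lift (Env.antipode k h c) ∘ₗ D = 0 by
    ext v
    obtain ⟨f, rfl⟩ := hs v
    exact LinearMap.congr_fun h0 f
  refine σ.grading.dual.hom_ext fun j f hf => ?_
  rw [LinearMap.comp_apply, SuperRep.lift_apply_dual D e hD _ hf, Env.antipode_sgn,
    Env.antipode_antipode, σ.lift_sgn_eq_zero _ hc, LinearMap.comp_zero, map_zero]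
  simp

/-- As linear forms separate the points of the space of `σ`, the annihilator of its contragredient
determines that of `σ`, without any condition of finite dimension. -/
theorem SuperRep.lift_antipode_eq_zero_of_injective {ρ : SuperRep k h V'} {σ : SuperRep k h V}
    (D : Module.Dual k V →ₗ[k] V') (hs : Function.Injective D) (e : ZMod 2)
    (hD : ∀ i j, ∀ x ∈ (grd k h).gr i, ∀ f ∈ σ.grading.dual.gr j,
      ρ.act x (D f) = -(koszul i (j + e) • D (f ∘ₗ σ.act x)))
    {c : Env k h} (hc : ρ.lift c = 0) : σ.lift (Env.antipode k h c) = 0 := by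
  ext v
  rw [LinearMap.zero_apply, ← Module.forall_dual_apply_eq_zero_iff k]
  intro f
  refine σ.grading.dual.induction (P := fun f : Module.Dual k V =>
    f (σ.lift (Env.antipode k h c) v) = 0) (fun j f hf => ?_) (fun f f' hf hf' => ?_) f
  · have := SuperRep.lift_apply_dual D e hD (Env.sgn k h (j + e) c) hf
    rw [ρ.lift_sgn_eq_zero _ hc, Env.sgn_sgn_self, LinearMap.zero_apply, eq_comm,
      map_eq_zero_iff D hs] at this
    exact LinearMap.congr_fun this v
  · rw [LinearMap.add_apply, hf, hf', add_zero]

/-- The change of parity multiplies the action of odd elements by `-1`, but these act by `0` on the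
line of a character. -/
theorem Character.shift_iterate_rep_act (χ : Character k h) (m : ℕ) (x : h) (a : k) :
    (SuperRep.shift^[m] χ.rep).act x a = χ.toFun x * a := by
  suffices hm : ∀ ρ : SuperRep k h k, (∀ x a, ρ.act x a = χ.toFun x * a) →
      ∀ x a, (SuperRep.shift^[m] ρ).act x a = χ.toFun x * a from
    hm χ.rep (fun x a => by simp [Character.rep]) x a
  induction m with
  | zero => exact fun ρ hρ => hρ
  | succ m ih =>
    intro ρ hρ
    refine ih ρ.shift fun x a => ?_
    refine (grd k h).induction (P := fun x => ρ.shift.act x a = χ.toFun x * a)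
      (fun i x hx => ?_) (fun x y hx hy => ?_) x
    · simp only [SuperRep.shift, LinearMap.comp_apply, (grd k h).sgn_of_mem 1 hx, map_zsmul,
        LinearMap.smul_apply, hρ]
      rcases zmod_two_eq i with rfl | rfl
      · rw [koszul_zero_right, one_smul]
      · rw [χ.map_odd x hx, zero_mul, smul_zero]
    · rw [map_add, LinearMap.add_apply, hx, hy, map_add, add_mul]

/-- The action on `π* ⊗ Πᵐ k_{-χ}`, whose underlying space is identified with `V*`. -/
theorem SuperRep.dual_tensor_act (π : SuperRep k h V) (χ : Character k h) (m : ℕ) {i j : ZMod 2}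
    {x : h} (hx : x ∈ (grd k h).gr i) {f : Module.Dual k V} (hf : f ∈ π.grading.dual.gr j) :
    (π.dual.tensor (SuperRep.shift^[m] (-χ).rep)).act x ((TensorProduct.rid k _).symm f) =
      (TensorProduct.rid k _).symm (-(koszul i j • (f ∘ₗ π.act x)) - χ.toFun x • f) := by
  rw [TensorProduct.rid_symm_apply, TensorProduct.rid_symm_apply]
  have e1 : π.dual.act x f = -(koszul i j • (f ∘ₗ π.act x)) := by
    ext v
    exact π.dualAct_apply hx hf v
  have e2 := π.dual.tensorAct_tmul (SuperRep.shift^[m] (-χ).rep) hx hf 1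
  rw [Character.shift_iterate_rep_act, e1] at e2
  refine e2.trans ?_
  have e3 : (-χ).toFun x = -χ.toFun x := rfl
  rw [e3, mul_one, TensorProduct.sub_tmul, sub_eq_add_neg]
  congr 1
  rcases zmod_two_eq i with rfl | rfl
  · rw [koszul_zero_left, one_smul, TensorProduct.smul_tmul, TensorProduct.tmul_neg, smul_eq_mul,
      mul_one]
  · rw [χ.map_odd x hx, neg_zero, TensorProduct.tmul_zero, smul_zero, zero_smul,
      TensorProduct.zero_tmul]
    exact (neg_zero (G := Module.Dual k V ⊗[k] k)).symm

end Duality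

end SuperLie

end

theorem mainTheorem1 {k : Type*} [Field k] (p : ℕ) [CharP k p] (hp : 2 < p)
    {g : Type*} [AddCommGroup g] [Module k g] [LieSuperalgebra k g]
    (h : LieSubsuperalgebra k g) [FiniteDimensional k (g ⧸ h.toSubmodule)]
    {V : Type*} [AddCommGroup V] [Module k V] (π : SuperRep k h.toSubmodule V)
    (m : ℕ) (hm : m = (adQuot h).grading.oddDim) :
    (coindKer h π : Set (Env k g)) =
      Env.antipode k g '' (coindKer h (π.dual.tensor (SuperRep.shift^[m] (-strad h).rep))) := by
  have hprime : Fact p.Prime := ⟨(CharP.char_is_prime_or_zero k p).resolve_right (by omega)⟩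
  have h2 : (2 : k) ≠ 0 := fun h0 => by
    have := (CharP.cast_eq_zero_iff k p 2).1 (by simpa using h0)
    exact absurd (Nat.le_of_dvd (by norm_num) this) (by omega)
  obtain ⟨κ, ι, _, _, _, ⟨B⟩⟩ := h.exists_adaptedBasis
  let D : Module.Dual k V →ₗ[k] Module.Dual k V ⊗[k] k := (TensorProduct.rid k _).symm.toLinearMap
  have hDs : Function.Surjective D := (TensorProduct.rid k _).symm.surjective
  have hDi : Function.Injective D := (TensorProduct.rid k _).symm.injective
  set π' := π.dual.tensor (SuperRep.shift^[m] (-strad h).rep) with hπ'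
  have hact : ∀ i j, ∀ x ∈ (grd k h.toSubmodule).gr i, ∀ f ∈ π.grading.dual.gr j,
      π'.act x (D f) = D (-(koszul i j • (f ∘ₗ π.act x)) - (strad h).toFun x • f) :=
    fun i j x hx f hf => π.dual_tensor_act (strad h) m hx hf
  -- `π'` is contragredient to the twist of `π`, and the twist of `π'` is contragredient to `π`
  have a1 : ∀ c, (π.twist (strad h) B.topPar).lift c = 0 → π'.lift (Env.antipode k _ c) = 0 := by
    intro c hc
    refine SuperRep.lift_antipode_eq_zero_of_surjective D hDs B.topPar (fun i j x hx f hf => ?_) hc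
    rw [hact i j x hx f hf, π.twist_act _ _ hx, ← map_zsmul D, ← map_neg D]
    congr 1
    rcases zmod_two_eq i with rfl | rfl
    · ext v
      simp
      ring
    · rw [(strad h).map_odd x hx, zero_smul, zero_smul, add_zero, sub_zero, koszul_add_right,
        koszul_comm B.topPar]
      ext v
      simp only [LinearMap.neg_apply, LinearMap.smul_apply, LinearMap.comp_apply, map_zsmul,
        smul_smul, mul_assoc, koszul_mul_self, mul_one]
  have a2 : ∀ c, (π'.twist (strad h) B.topPar).lift c = 0 → π.lift (Env.antipode k _ c) = 0 := by
    intro c hc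
    refine SuperRep.lift_antipode_eq_zero_of_injective D hDi B.topPar (fun i j x hx f hf => ?_) hc
    rw [SuperRep.twist_act _ _ _ hx, LinearMap.add_apply, LinearMap.smul_apply, hact i j x hx f hf,
      LinearMap.smul_apply, Module.End.one_apply, ← map_zsmul D, ← map_smul D, ← map_add D,
      ← map_zsmul D, ← map_neg D]
    congr 1
    rcases zmod_two_eq i with rfl | rfl
    · rw [koszul_zero_left, koszul_zero_left, koszul_zero_right]
      module
    · rw [(strad h).map_odd x hx, koszul_add_right, koszul_comm B.topPar]
      module
  ext u
  constructor
  · intro hu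
    exact ⟨_, antipode_mem_coindKer p h2 B a1 hu, Env.antipode_antipode u⟩
  · rintro ⟨u, hu, rfl⟩
    exact antipode_mem_coindKer p h2 B a2 hu
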